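/- Let $N\cong\mathbb{Z}^d$ and $M=\mathrm{Hom}(N,\mathbb{Z})$ be dual lattices with pairing $\langle\cdot,\cdot\rangle$. Let $\Delta\subset M\otimes\mathbb{R}$ be a reflexive polytope, i.e. a lattice polytope with $0\in\mathrm{int}\,\Delta$ whose polar $\Delta^*=\{n\in N\otimes\mathbb{R} : \langle m,n\rangle\ge -1 \ \forall m\in\Delta\}$ is also a lattice polytope. Let $\Sigma\subset N\otimes\mathbb{R}$ be the (inner) normal fan of $\Delta$, and $\Sigma^*\subset M\otimes\mathbb{R}$ its face fan, i.e. the zero cone together with the positive hulls of the proper nonempty faces of $\Delta$. For a rational cone $\sigma$ in $N\otimes\mathbb R$, write $\sigma\cap N$ for the sublattice generated by the lattice points of $\sigma$ and let $N_\sigma\subset N/2N$ be its image; $\sigma$ is called $\mathbb{Z}_2$-regular if the images in $N/2N$ of the first lattice points on its rays form a basis of the $\mathbb{Z}_2$-vector space $N_\sigma$. The same notion is used for cones in $M\otimes\mathbb{R}$ with respect to $M$. For $\sigma\in\Sigma$ put $E_\sigma=(N/2N)/N_\sigma$; if $\sigma$ is a face of $\tau$, the identity of $N/2N$ induces a map $E_\sigma\to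 E_\tau$. For $q\ge 0$ let $C_p(\wedge^q\mathscr{E})=\bigoplus_{\sigma\in\Sigma,\ \mathrm{codim}\,\sigma=p}\wedge^qE_\sigma$, with boundary map $C_p\to C_{p-1}$ given on $\wedge^qE_\sigma$ by the sum of the induced maps $\wedge^qE_\sigma\to\wedge^qE_\tau$ over all $\tau\in\Sigma$ of codimension $p-1$ having $\sigma$ as a face. The $\mathbb{Z}_2$ Hodge spaces are the homology groups $H_{pq}(\Sigma)=H_p(\wedge^q\mathscr{E})$. Let $A^T_q(X_\Sigma)$ be the $q$-th $\mathbb{Z}_2$ torus invariant Chow group: the $\mathbb{Z}_2$-vector space with basis the orbit closures $[V(\tau)]$, $\tau\in\Sigma$ of codimension $q$ (these are the closures of the $q$-dimensional torus orbits of $X_\Sigma$), modulo the span of the elements $\sum_{\tau}(\langle u,n_{\sigma,\tau}\rangle \bmod 2)\,[V(\tau)]$ for $\sigma\in\Sigma$ of codimension $q+1$ and $u\in\sigma^\perp\cap M$, where $\tau$ runs over the cones of codimension $q$ having $\sigma$ as a face and $n_{\sigma,\tau}$ is a lattice generator of $(\tau\cap N)/(\sigma\cap N)$. **Theorem.** Let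 $e\le d$ and suppose that all cones of $\Sigma^*$ of dimension at most $e$ are $\mathbb{Z}_2$-regular. Then 1. $H_{pq}(\Sigma)=0$ for $q<p<e-1$; 2. for $0\le q<e-1$ one has $H_{qq}(\Sigma)\cong\mathbb{Z}_2$, and there is an isomorphism $H_{qq}(\Sigma)\cong A^T_q(X_\Sigma)$ which, for every cone $\beta\in\Sigma$ of codimension $q$, sends the class of the nonzero element of the summand $\wedge^qE_\beta$ of $C_q(\wedge^q\mathscr{E})$ to $[V(\beta)]$. Moreover this space is generated by the closure of any $q$-dimensional torus orbit, i.e. by $[V(\beta)]$ for any $\beta\in\Sigma$ of codimension $q$. -/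

import Mathlib

open scoped DirectSum

noncomputable section

namespace Z2Hodge

/-! ### Lattices, polytopes and cones

We fix dual bases of `N ≅ ℤ^d` and `M = Hom(N, ℤ)`, so that `N = M = Fin d → ℤ` inside
`Fin d → ℝ`, and the pairing is `⬝ᵥ`. Since `N` and `M` play symmetric roles, the notions for
cones below are used on both sides. -/

variable {d : ℕ}

/-- A lattice point viewed in the ambient real vector space. -/
def latticePt (n : Fin d → ℤ) : Fin d → ℝ := fun i => (n i : ℝ)

/-- The image of a lattice point in `N / 2N = (ℤ/2)^d`. -/
def mod2 (n : Fin d → ℤ) : Fin d → ZMod 2 := fun i => (n i : ZMod 2)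

/-- Convex hulls of finitely many lattice points. -/
def IsLatticePolytope (P : Set (Fin d → ℝ)) : Prop :=
  ∃ S : Finset (Fin d → ℤ), P = convexHull ℝ (latticePt '' (S : Set (Fin d → ℤ)))

/-- The polar set, with the convention `⟨m, n⟩ ≥ -1`. -/
def polar (P : Set (Fin d → ℝ)) : Set (Fin d → ℝ) :=
  {n | ∀ m ∈ P, -1 ≤ m ⬝ᵥ n}

/-- Reflexive polytopes. -/
structure IsReflexive (P : Set (Fin d → ℝ)) : Prop where
  isLatticePolytope : IsLatticePolytope P
  zero_mem_interior : (0 : Fin d → ℝ) ∈ interior P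
  isLatticePolytope_polar : IsLatticePolytope (polar P)

/-- Nonempty faces of a polytope, the polytope itself included. -/
def IsFace (P F : Set (Fin d → ℝ)) : Prop :=
  F.Nonempty ∧ IsExposed ℝ P F

/-- The (inner) normal cone of a subset `F` of `P`: the vectors `n` for which `⟨·, n⟩`
attains its minimum over `P` at every point of `F`. -/
def normalCone (P F : Set (Fin d → ℝ)) : PointedCone ℝ (Fin d → ℝ) where
  carrier := {n | ∀ m ∈ F, ∀ m' ∈ P, m ⬝ᵥ n ≤ m' ⬝ᵥ n}
  zero_mem' := by
    intro m _ m' _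
    simp
  add_mem' := by
    intro a b ha hb m hm m' hm'
    rw [dotProduct_add, dotProduct_add]
    exact add_le_add (ha m hm m' hm') (hb m hm m' hm')
  smul_mem' := by
    intro c a ha m hm m' hm'
    have h : c • a = (c : ℝ) • a := rfl
    rw [h, dotProduct_smul, dotProduct_smul]
    exact mul_le_mul_of_nonneg_left (ha m hm m' hm') c.2

/-- The set of cones of the normal fan of `P`. -/
def normalFan (P : Set (Fin d → ℝ)) : Set (PointedCone ℝ (Fin d → ℝ)) :=
  {σ | ∃ F, IsFace P F ∧ σ = normalCone P F}

/-- The set of cones of the face fan of `P`: the zero cone and the positive hulls of the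
proper nonempty faces of `P`. -/
def faceFan (P : Set (Fin d → ℝ)) : Set (PointedCone ℝ (Fin d → ℝ)) :=
  {σ | σ = ⊥ ∨ ∃ F, IsFace P F ∧ F ≠ P ∧ σ = PointedCone.hull ℝ F}

/-- The dimension of a cone. -/
def coneDim (σ : PointedCone ℝ (Fin d → ℝ)) : ℕ :=
  Module.finrank ℝ (Submodule.span ℝ (σ : Set (Fin d → ℝ)))

/-- The sublattice `(σ ∩ N) + (-σ ∩ N)` of `N`. -/
def coneLattice (σ : PointedCone ℝ (Fin d → ℝ)) : AddSubgroup (Fin d → ℤ) :=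
  AddSubgroup.closure {n | latticePt n ∈ σ}

/-- `N_σ`, as a subspace of `N / 2N`: the image of the sublattice of `σ`, that is, the span of the
classes of the lattice points of `σ`. -/
def coneMod2 (σ : PointedCone ℝ (Fin d → ℝ)) : Submodule (ZMod 2) (Fin d → ZMod 2) :=
  Submodule.span (ZMod 2) (mod2 '' {n | latticePt n ∈ σ})

/-- The first lattice points on the rays (one-dimensional faces) of `σ`. -/
def rayGenerators (σ : PointedCone ℝ (Fin d → ℝ)) : Set (Fin d → ℤ) :=
  {r | (∀ (k : ℤ) (s : Fin d → ℤ), r = k • s → IsUnit k) ∧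
    (PointedCone.hull ℝ {latticePt r}).IsFaceOf σ}

/-- A cone is `ℤ/2`-regular if the images of its rays in `N / 2N` form a basis of `N_σ`. -/
def IsZ2Regular (σ : PointedCone ℝ (Fin d → ℝ)) : Prop :=
  LinearIndependent (ZMod 2) (fun r : rayGenerators σ => mod2 (r : Fin d → ℤ)) ∧
    Submodule.span (ZMod 2) (mod2 '' rayGenerators σ) = coneMod2 σ

/-! ### The cosheaves `⋀^q 𝓔` and the `ℤ/2` Hodge spaces -/

theorem coneMod2_mono {σ τ : PointedCone ℝ (Fin d → ℝ)} (h : σ.IsFaceOf τ) :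
    coneMod2 σ ≤ coneMod2 τ :=
  Submodule.span_mono (Set.image_mono fun _ hn => h.le hn)

/-- The stalk `E_σ = (N / 2N) / N_σ`. -/
abbrev stalkE (σ : PointedCone ℝ (Fin d → ℝ)) : Type :=
  (Fin d → ZMod 2) ⧸ coneMod2 σ

/-- The restriction map `E_σ → E_τ` for a face `σ` of `τ`, induced by the identity of `N / 2N`. -/
def resE {σ τ : PointedCone ℝ (Fin d → ℝ)} (h : σ.IsFaceOf τ) :
    stalkE σ →ₗ[ZMod 2] stalkE τ :=
  Submodule.mapQ (coneMod2 σ) (coneMod2 τ) LinearMap.id (coneMod2_mono h)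

/-- `Σ(d - p)`, the cones of codimension `p`. -/
abbrev ConesOfCodim (Sig : Set (PointedCone ℝ (Fin d → ℝ))) (p : ℤ) : Type :=
  {σ : PointedCone ℝ (Fin d → ℝ) // σ ∈ Sig ∧ (coneDim σ : ℤ) + p = d}

/-- The stalk `⋀^q E_σ` of the cosheaf `⋀^q 𝓔`. -/
def ExtStalk (q : ℕ) (σ : PointedCone ℝ (Fin d → ℝ)) : Type :=
  ⋀[ZMod 2]^q (stalkE σ)

instance extStalkAddCommGroup (q : ℕ) (σ : PointedCone ℝ (Fin d → ℝ)) :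
    AddCommGroup (ExtStalk q σ) :=
  inferInstanceAs (AddCommGroup (⋀[ZMod 2]^q (stalkE σ)))

instance extStalkModule (q : ℕ) (σ : PointedCone ℝ (Fin d → ℝ)) :
    Module (ZMod 2) (ExtStalk q σ) :=
  inferInstanceAs (Module (ZMod 2) (⋀[ZMod 2]^q (stalkE σ)))

/-- The restriction map `⋀^q E_σ → ⋀^q E_τ` for a face `σ` of `τ`. -/
def extRes (q : ℕ) {σ τ : PointedCone ℝ (Fin d → ℝ)} (h : σ.IsFaceOf τ) :
    ExtStalk q σ →ₗ[ZMod 2] ExtStalk q τ :=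
  exteriorPower.map q (resE h)

/-- The chain group `C_p(⋀^q 𝓔)`. -/
abbrev Chains (Sig : Set (PointedCone ℝ (Fin d → ℝ))) (q : ℕ) (p : ℤ) : Type :=
  ⨁ σ : ConesOfCodim Sig p, ExtStalk q σ.1

open Classical in
/-- The inclusion of the summand at `σ` in `C_p(⋀^q 𝓔)`. -/
def summand (Sig : Set (PointedCone ℝ (Fin d → ℝ))) (q : ℕ) (p : ℤ) (σ : ConesOfCodim Sig p) :
    ExtStalk q σ.1 →ₗ[ZMod 2] Chains Sig q p :=
  DirectSum.lof (ZMod 2) (ConesOfCodim Sig p) (fun σ => ExtStalk q σ.1) σ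

open Classical in
/-- The map `C_p(⋀^q 𝓔) → C_{p'}(⋀^q 𝓔)` which on the summand at `σ` is the sum of the restriction
maps to all `τ` in `Σ(d - p')` having `σ` as a face (a finite sum, since fans are finite). It is
the boundary map of the cosheaf complex for `p' = p - 1`. -/
def boundary (Sig : Set (PointedCone ℝ (Fin d → ℝ))) (q : ℕ) (p p' : ℤ) :
    Chains Sig q p →ₗ[ZMod 2] Chains Sig q p' :=
  DirectSum.toModule (ZMod 2) (ConesOfCodim Sig p) (Chains Sig q p') fun σ =>
    ∑ᶠ τ : ConesOfCodim Sig p',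
      if h : σ.1.IsFaceOf τ.1 then summand Sig q p' τ ∘ₗ extRes q h else 0

/-- The cycles of degree `p` in the complex of `⋀^q 𝓔`. -/
abbrev cycles (Sig : Set (PointedCone ℝ (Fin d → ℝ))) (p : ℤ) (q : ℕ) :
    Submodule (ZMod 2) (Chains Sig q p) :=
  LinearMap.ker (boundary Sig q p (p - 1))

/-- The boundaries of degree `p` in the complex of `⋀^q 𝓔`, inside the cycles. -/
abbrev boundaries (Sig : Set (PointedCone ℝ (Fin d → ℝ))) (p : ℤ) (q : ℕ) :
    Submodule (ZMod 2) (cycles Sig p q) :=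
  (LinearMap.range (boundary Sig q (p + 1) p)).comap (cycles Sig p q).subtype

/-- The `ℤ/2` Hodge space `H_{pq}(Σ) = H_p(⋀^q 𝓔)`. -/
abbrev HodgeSpace (Sig : Set (PointedCone ℝ (Fin d → ℝ))) (p : ℤ) (q : ℕ) : Type :=
  cycles Sig p q ⧸ boundaries Sig p q

/-! ### The `ℤ/2` torus invariant Chow groups -/

/-- `n` is a lattice generator of `(τ ∩ N) / (σ ∩ N)`. -/
def IsRelativeGenerator (σ τ : PointedCone ℝ (Fin d → ℝ)) (n : Fin d → ℤ) : Prop :=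
  n ∈ coneLattice τ ∧ coneLattice τ = coneLattice σ ⊔ AddSubgroup.zmultiples n

/-- `Z^T_q`: the vector space with basis the orbit closures `[V(τ)]`, `codim τ = q`. -/
abbrev InvariantCycles (Sig : Set (PointedCone ℝ (Fin d → ℝ))) (q : ℤ) : Type :=
  ConesOfCodim Sig q →₀ ZMod 2

/-- `R^T_{q+1}`: the span of the divisors `div χ^u` modulo 2 on the varieties `V(σ)`, for `σ` of
codimension `q + 1` and `u` in `σ^⊥ ∩ M`. The coefficient of `[V(τ)]` is `⟨u, n_{σ,τ}⟩` mod 2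
for `σ` a face of `τ`, and zero otherwise. -/
def invariantRelations (Sig : Set (PointedCone ℝ (Fin d → ℝ))) (q : ℤ) :
    Submodule (ZMod 2) (InvariantCycles Sig q) :=
  Submodule.span (ZMod 2)
    {r | ∃ (σ : ConesOfCodim Sig (q + 1)) (u : Fin d → ℤ) (n : ConesOfCodim Sig q → Fin d → ℤ),
      (∀ x ∈ σ.1, latticePt u ⬝ᵥ x = 0) ∧
      ∀ τ : ConesOfCodim Sig q,
        (σ.1.IsFaceOf τ.1 → IsRelativeGenerator σ.1 τ.1 (n τ) ∧ r τ = ((u ⬝ᵥ n τ : ℤ) : ZMod 2)) ∧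
        (¬ σ.1.IsFaceOf τ.1 → r τ = 0)}

/-- The `ℤ/2` torus invariant Chow group `A^T_q(X_Σ) = Z^T_q / R^T_{q+1}`. -/
abbrev InvariantChow (Sig : Set (PointedCone ℝ (Fin d → ℝ))) (q : ℤ) : Type :=
  InvariantCycles Sig q ⧸ invariantRelations Sig q

/-- The class in `A^T_q(X_Σ)` of the closure `V(β)` of the `q`-dimensional orbit `O_β`. -/
def orbitClosureClass (Sig : Set (PointedCone ℝ (Fin d → ℝ))) (q : ℤ) (β : ConesOfCodim Sig q) :
    InvariantChow Sig q :=
  (invariantRelations Sig q).mkQ (Finsupp.single β 1)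

end Z2Hodge

end

/-!
Let `v` enumerate the vertices of the reflexive polytope `Δ`. A proper face lies at height `-1` for
some lattice vector, so its vertices are primitive and are the ray generators of the cone over it.
Regularity of the cones of dimension at most `e` therefore says that the faces of dimension less
than `e` are simplices whose vertices are linearly independent modulo 2, and the cones of
codimension `p < e` in the normal fan correspond to the faces with `p + 1` vertices, inclusions
being reversed. A face is handled as the finset `F` of labels of its vertices (`IsLabel`).

For such a cone `σ` the sublattice of `σ` consists of the lattice vectors on which the vertices in
`F` agree. Hence `E_σ` is generated by classes dual to the vertices in `F` with the single relation
that their sum vanishes (`IsSimplexFrame`), compatibly with restriction, and `⋀^q E_σ` is the space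
of functions on the `q`-subsets of `F` modulo coboundaries. The complex of `⋀^q 𝓔` in degrees below
`e` is thus obtained from the double complex of functions `c F A` on pairs `A ⊆ F`, with the
simplicial boundary in `F` and the coboundary in `A`, by dividing out the vertical boundaries.

The columns of the double complex are exact because a simplex is acyclic. The row of `A` is the
chain complex of the faces containing `A`, and it is exact below degree `e`: with `h` a generic
function exposing `A` and `φ` an affine function vanishing on `A` and negative on the other
vertices, the star of `A` is swept by increasing slope `φ / h`, each vertex contributing a lower
star of a larger face, which is acyclic by induction (`SimplicialUpTo.lowerStar_acyclic`). A diagram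
chase gives the vanishing of `H_{pq}` for `q < p` and shows that for `p = q` the only obstruction to
being a boundary is the sum of all coefficients (`SimplicialUpTo.exists_eq_hd_add_vd`). In
codimension `q` each stalk `⋀^q E_σ` is one-dimensional and in codimension `q - 1` it is zero, so
the sum of the coefficients identifies `H_{qq}` with `ℤ/2`.

In the Chow group, the difference of two vertices of `F` equates the orbit closures of the two
facets of `F` omitting one of them, and every relation has coefficient sum zero. Sending a chain to
the combination of orbit closures with the same coefficients therefore kills boundaries, so a
combination with coefficient sum zero, being the image of a boundary, is zero. Thus the coefficient
sum also identifies the Chow group with `ℤ/2`, and every `[V(β)]` is its nonzero element.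
-/

namespace Z2Hodge

set_option linter.unusedSectionVars false

/-! ### Sweeping the star of a face -/

section Sweep

variable {ι : Type*}

/-- A set `F` of vertices is exposed by a space `L` of functions on the vertices if some member
of `L` vanishes on `F` and is positive elsewhere. With `L` the restrictions of the affine
functions to the vertices of a polytope, these are the vertex sets of its faces, the empty
face included. -/
def Exposed (L : Submodule ℝ (ι → ℝ)) (F : Finset ι) : Prop :=
  ∃ h ∈ L, (∀ i ∈ F, h i = 0) ∧ ∀ i ∉ F, 0 < h i

/-- The exposing function of a face can be chosen in general position with respect to finitely many
linear forms. -/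
lemma Exposed.exists_generic [Finite ι] {L : Submodule ℝ (ι → ℝ)} {S : Finset ι} (hS : Exposed L S)
    (Q : Finset (Module.Dual ℝ (ι → ℝ))) :
    ∃ h ∈ L, (∀ i ∈ S, h i = 0) ∧ (∀ i ∉ S, 0 < h i) ∧
      ∀ D ∈ Q, (∃ g ∈ L, (∀ i ∈ S, g i = 0) ∧ D g ≠ 0) → D h ≠ 0 := by
  classical
  induction Q using Finset.induction_on with
  | empty =>
    obtain ⟨h, hL, h0, h1⟩ := hS
    exact ⟨h, hL, h0, h1, by simp⟩
  | insert D Q _ ih =>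
    obtain ⟨h, hL, h0, h1, h2⟩ := ih
    by_cases hD : (∃ g ∈ L, (∀ i ∈ S, g i = 0) ∧ D g ≠ 0) ∧ D h = 0
    · obtain ⟨⟨g, hgL, hg0, hg⟩, hDh⟩ := hD
      -- A small positive multiple of `g` keeps all the open conditions and makes `D` nonzero.
      have hpos : ∀ i, ∀ᶠ t in nhdsWithin (0 : ℝ) (Set.Ioi 0), i ∉ S → 0 < h i + t * g i := by
        intro i
        by_cases hi : i ∈ S
        · simp [hi]
        have hc : Filter.Tendsto (fun t : ℝ => h i + t * g i) (nhdsWithin 0 (Set.Ioi 0))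
            (nhds (h i + 0 * g i)) :=
          (Continuous.tendsto (by fun_prop) 0).mono_left nhdsWithin_le_nhds
        have := hc.eventually (lt_mem_nhds (by simpa using h1 i hi))
        filter_upwards [this] with t ht _ using ht
      have hne : ∀ D' ∈ Q, ∀ᶠ t in nhdsWithin (0 : ℝ) (Set.Ioi 0),
          (D' h ≠ 0 → D' h + t * D' g ≠ 0) := by
        intro D' _
        by_cases hi : D' h = 0
        · simp [hi]
        have hc : Filter.Tendsto (fun t : ℝ => D' h + t * D' g) (nhdsWithin 0 (Set.Ioi 0))
            (nhds (D' h + 0 * D' g)) :=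
          (Continuous.tendsto (by fun_prop) 0).mono_left nhdsWithin_le_nhds
        have := hc.eventually_ne (b₂ := 0) (by simpa using hi)
        filter_upwards [this] with t ht _ using ht
      have hall := (Filter.eventually_all.2 hpos).and
        (((Filter.eventually_all_finset Q).2 hne).and self_mem_nhdsWithin)
      obtain ⟨t, ht1, ht2, ht3⟩ := hall.exists
      have ht3 : (0 : ℝ) < t := ht3
      refine ⟨h + t • g, L.add_mem hL (L.smul_mem _ hgL), ?_, ?_, ?_⟩
      · intro i hi; simp [h0 i hi, hg0 i hi]
      · intro i hi; simpa using ht1 i hi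
      · intro D' hD' hex
        rcases Finset.mem_insert.1 hD' with rfl | hD'
        · simp [hDh, hg, ht3.ne']
        · simpa using ht2 D' hD' (h2 D' hD' hex)
    · refine ⟨h, hL, h0, h1, ?_⟩
      intro D' hD' hex
      rcases Finset.mem_insert.1 hD' with rfl | hD'
      · exact fun h3 => hD ⟨hex, h3⟩
      · exact h2 D' hD' hex

variable [Fintype ι] [DecidableEq ι]

/-- The faces with at most `e` vertices form a simplicial complex, and every face spanned by at most
`e` vertices is a simplex. -/
structure SimplicialUpTo (L : Submodule ℝ (ι → ℝ)) (e : ℕ) : Prop where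
  card_lt : e < Fintype.card ι
  empty : Exposed L ∅
  mono : ∀ {F F' : Finset ι}, Exposed L F → F.card ≤ e → F' ⊆ F → Exposed L F'
  eq_insert : ∀ {S G : Finset ι} {v : ι}, Exposed L G → insert v S ⊆ G → S.card < e →
    (∀ g ∈ L, (∀ i ∈ insert v S, g i = 0) → ∀ i ∈ G, g i = 0) → G = insert v S

/-- A sweep of the star of a face `S`: a function `h` exposing `S` such that the slopes `φ / h`
separate the vertices joined to `S` from all others, and the vertex of smallest slope is joined
to `S`. -/
lemma SimplicialUpTo.exists_sweep {L : Submodule ℝ (ι → ℝ)} {e : ℕ} (K : SimplicialUpTo L e)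
    {S : Finset ι} (hS : Exposed L S) (hSe : S.card < e) {φ : ι → ℝ} (hφ : φ ∈ L)
    (hφS : ∀ i ∈ S, φ i = 0) (hneg : ∃ i, φ i < 0) :
    ∃ h ∈ L, (∀ i ∈ S, h i = 0) ∧ (∀ i ∉ S, 0 < h i) ∧ ∃ v₀, φ v₀ < 0 ∧ Exposed L (insert v₀ S) ∧
      (∀ w, φ w < 0 → w ≠ v₀ → φ v₀ / h v₀ < φ w / h w) ∧
      ∀ a w, φ a < 0 → φ w < 0 → Exposed L (insert a S) → φ a / h a = φ w / h w → w = a := by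
  classical
  let D : ι × ι → Module.Dual ℝ (ι → ℝ) := fun p =>
    φ p.1 • LinearMap.proj p.2 - φ p.2 • LinearMap.proj p.1
  have hD : ∀ v w g, D (v, w) g = φ v * g w - φ w * g v := fun v w g => by simp [D]
  obtain ⟨h, hL, h0, h1, h2⟩ := hS.exists_generic (Finset.univ.image D)
  have hnot : ∀ v, φ v < 0 → v ∉ S := fun v hv hvS => by simp [hφS v hvS] at hv
  have hhpos : ∀ v, φ v < 0 → 0 < h v := fun v hv => h1 v (hnot v hv)
  have key : ∀ v w, φ v < 0 → φ w < 0 → φ v / h v = φ w / h w →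
      ∀ g ∈ L, (∀ i ∈ S, g i = 0) → φ v * g w = φ w * g v := by
    intro v w hv hw hvw g hg hgS
    by_contra hne
    refine h2 (D (v, w)) (Finset.mem_image_of_mem _ (Finset.mem_univ _)) ⟨g, hg, hgS, ?_⟩ ?_
    · rw [hD]; exact sub_ne_zero.2 hne
    · rw [div_eq_div_iff (hhpos v hv).ne' (hhpos w hw).ne'] at hvw
      rw [hD]; linarith
  obtain ⟨v₀, hv₀, hmin⟩ := Finset.exists_min_image (Finset.univ.filter fun i => φ i < 0)
    (fun i => φ i / h i) (by obtain ⟨i, hi⟩ := hneg; exact ⟨i, by simpa using hi⟩)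
  simp only [Finset.mem_filter, Finset.mem_univ, true_and] at hv₀ hmin
  -- The vertices of smallest slope form, together with `S`, a face.
  let s := φ v₀ / h v₀
  have hs : s < 0 := div_neg_of_neg_of_pos hv₀ (hhpos v₀ hv₀)
  let G : Finset ι := Finset.univ.filter fun i => φ i - s * h i = 0
  have hG : Exposed L G := by
    refine ⟨φ - s • h, L.sub_mem hφ (L.smul_mem _ hL), ?_, ?_⟩
    · intro i hi; simpa [G] using hi
    · intro i hi
      have hi' : φ i - s * h i ≠ 0 := by simpa [G] using hi
      refine lt_of_le_of_ne ?_ (by simpa using hi'.symm)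
      simp only [Pi.sub_apply, Pi.smul_apply, smul_eq_mul]
      by_cases hiS : i ∈ S
      · simp [hφS i hiS, h0 i hiS]
      have hhi := h1 i hiS
      rcases lt_or_ge (φ i) 0 with hneg | hnn
      · have := hmin i hneg
        rw [le_div_iff₀ hhi] at this
        exact sub_nonneg.2 this
      · nlinarith
  have hsub : insert v₀ S ⊆ G := by
    intro i hi
    rcases Finset.mem_insert.1 hi with rfl | hi
    · simp [G, s, div_mul_cancel₀ _ (hhpos i hv₀).ne']
    · simp [G, hφS i hi, h0 i hi]
  have hslope : ∀ i, i ∈ G → i ∉ S → φ i < 0 ∧ φ v₀ / h v₀ = φ i / h i := by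
    intro i hi hiS
    have hi' : φ i - s * h i = 0 := by simpa [G] using hi
    have hhi := h1 i hiS
    refine ⟨by nlinarith, ?_⟩
    rw [eq_div_iff hhi.ne']
    exact (sub_eq_zero.1 hi').symm
  have hGeq : G = insert v₀ S := by
    refine K.eq_insert hG hsub hSe fun g hg hg0 i hi => ?_
    by_cases hiS : i ∈ S
    · exact hg0 i (Finset.mem_insert_of_mem hiS)
    obtain ⟨hi1, hi2⟩ := hslope i hi hiS
    have := key v₀ i hv₀ hi1 hi2 g hg fun j hj => hg0 j (Finset.mem_insert_of_mem hj)
    rw [hg0 v₀ (Finset.mem_insert_self _ _), mul_zero] at this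
    exact (mul_eq_zero.1 this).resolve_left hv₀.ne
  refine ⟨h, hL, h0, h1, v₀, hv₀, hGeq ▸ hG, ?_, ?_⟩
  · intro w hw hne
    refine lt_of_le_of_ne (hmin w hw) fun heq => ?_
    have : w ∈ G := by
      have := hhpos w hw
      simp [G, s, heq, div_mul_cancel₀ _ this.ne']
    rw [hGeq, Finset.mem_insert] at this
    exact this.elim hne (hnot w hw)
  · intro a w ha hw ⟨g, hg, hg0, hg1⟩ heq
    by_contra hne
    have hw' : w ∉ insert a S := by
      simp [hne, hnot w hw]
    have := key a w ha hw heq g hg fun j hj => hg0 j (Finset.mem_insert_of_mem hj)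
    rw [hg0 a (Finset.mem_insert_self _ _), mul_zero] at this
    exact (mul_ne_zero ha.ne (hg1 w hw').ne') this

/-- Every size up to `e` occurs: a face with fewer vertices is extended by the vertex of smallest
slope. -/
lemma SimplicialUpTo.exists_exposed_card_eq {L : Submodule ℝ (ι → ℝ)} {e : ℕ}
    (K : SimplicialUpTo L e) {k : ℕ} (hk : k ≤ e) : ∃ F, Exposed L F ∧ F.card = k := by
  induction k with
  | zero => exact ⟨∅, K.empty, rfl⟩
  | succ k ih =>
    obtain ⟨S, hS, hSk⟩ := ih (by omega)
    obtain ⟨h, hL, h0, h1⟩ := id hS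
    have hcard := K.card_lt
    obtain ⟨w, hw⟩ : ∃ w, w ∉ S := by
      by_contra hall
      push Not at hall
      rw [← Finset.card_univ, ← Finset.eq_univ_iff_forall.2 hall] at hcard
      omega
    obtain ⟨-, -, -, -, u, hu, hE, -⟩ := K.exists_sweep hS (by omega) (L.neg_mem hL)
      (fun i hi => by simp [h0 i hi]) ⟨w, by simpa using h1 w hw⟩
    refine ⟨insert u S, hE, ?_⟩
    rw [Finset.card_insert_of_notMem, hSk]
    intro huS
    simp [h0 u huS] at hu

/-- The simplicial boundary modulo 2: the coefficient at `G` is the sum of the coefficients at the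
sets with one more vertex. -/
def bdry (z : Finset ι → ZMod 2) (G : Finset ι) : ZMod 2 := ∑ v ∈ Gᶜ, z (insert v G)

/-- The faces with `k` vertices that contain `S` and on whose other vertices `φ` is negative. -/
def LowerStar (L : Submodule ℝ (ι → ℝ)) (S : Finset ι) (φ : ι → ℝ) (k : ℕ) (F : Finset ι) : Prop :=
  Exposed L F ∧ F.card = k ∧ S ⊆ F ∧ ∀ v ∈ F, v ∉ S → φ v < 0

lemma bdry_add (z w : Finset ι → ZMod 2) : bdry (z + w) = bdry z + bdry w := by
  funext G; simp [bdry, Finset.sum_add_distrib]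

lemma exists_of_bdry_ne_zero {z : Finset ι → ZMod 2} {G : Finset ι} (h : bdry z G ≠ 0) :
    ∃ v ∉ G, z (insert v G) ≠ 0 := by
  obtain ⟨v, hv, h⟩ := Finset.exists_ne_zero_of_sum_ne_zero h
  exact ⟨v, by simpa using hv, h⟩

lemma add_self_zmod2 (a : ZMod 2) : a + a = 0 := CharTwo.add_self_eq_zero a

lemma bdry_bdry (y : Finset ι → ZMod 2) (G : Finset ι) : bdry (bdry y) G = 0 := by
  simp only [bdry]
  rw [Finset.sum_sigma']
  refine Finset.sum_involution (fun p _ => ⟨p.2, p.1⟩) ?_ ?_ ?_ ?_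
  · rintro ⟨v, w⟩ _
    simp only [Finset.insert_comm w v, add_self_zmod2]
  · rintro ⟨v, w⟩ h _ heq
    simp only [Finset.mem_sigma, Finset.mem_compl, Finset.mem_insert, not_or] at h
    exact h.2.1 (by simpa using congrArg Sigma.fst heq)
  · rintro ⟨v, w⟩ h
    simp only [Finset.mem_sigma, Finset.mem_compl, Finset.mem_insert, not_or] at h ⊢
    exact ⟨h.2.2, fun h' => h.2.1 h'.symm, h.1⟩
  · rintro ⟨v, w⟩ _; rfl

/-- Two-term case of the sweep: a chain supported on `S` alone bounds a chain on `insert v₀ S`. -/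
lemma exists_bdry_eq_of_support_singleton {L : Submodule ℝ (ι → ℝ)} {S : Finset ι} {φ : ι → ℝ}
    {k : ℕ} {v₀ : ι} (hv₀ : φ v₀ < 0) (hv₀S : v₀ ∉ S) (hE : Exposed L (insert v₀ S))
    {z : Finset ι → ZMod 2} (hz : ∀ F, z F ≠ 0 → LowerStar L S φ k F)
    (hzS : ∀ F, z F ≠ 0 → F = S) :
    ∃ y : Finset ι → ZMod 2, (∀ F, y F ≠ 0 → LowerStar L S φ (k + 1) F) ∧
      ∀ F, S ⊆ F → bdry y F = z F := by
  refine ⟨Pi.single (insert v₀ S) (z S), ?_, ?_⟩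
  · intro F hF
    obtain rfl : F = insert v₀ S := by
      by_contra h; simp [h] at hF
    simp only [Pi.single_eq_same] at hF
    refine ⟨hE, ?_, Finset.subset_insert _ _, ?_⟩
    · rw [Finset.card_insert_of_notMem hv₀S, (hz S hF).2.1]
    · intro v hv hvS
      rcases Finset.mem_insert.1 hv with rfl | hv
      · exact hv₀
      · exact absurd hv hvS
  · intro F hF
    by_cases hFS : F = S
    · subst hFS
      rw [bdry, Finset.sum_eq_single v₀]
      · simp
      · intro v hv hne
        rw [Pi.single_apply, if_neg]
        intro heq
        have : v ∈ insert v₀ F := heq ▸ Finset.mem_insert_self _ _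
        exact (Finset.mem_insert.1 this).elim hne (by simpa using hv)
      · intro h; simp [hv₀S] at h
    · have : z F = 0 := by by_contra h; exact hFS (hzS F h)
      rw [this, bdry]
      refine Finset.sum_eq_zero fun v hv => ?_
      rw [Pi.single_apply, if_neg]
      intro heq
      have hv : v ∉ F := by simpa using hv
      refine hFS (Finset.Subset.antisymm ?_ hF)
      -- `S ⊆ F`, and both have one vertex fewer than `insert v₀ S`.
      have hc := congrArg Finset.card heq
      rw [Finset.card_insert_of_notMem hv, Finset.card_insert_of_notMem hv₀S] at hc
      exact (Finset.eq_of_subset_of_card_le hF (by omega)).ge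

/-- The lower star of a face, relative to the faces not containing it, is acyclic below the top
dimension `e`. The faces are swept by their vertex of largest slope `φ / h`; those with a given
largest vertex `a` form a lower star of `insert a S`. -/
theorem SimplicialUpTo.lowerStar_acyclic {L : Submodule ℝ (ι → ℝ)} {e : ℕ}
    (K : SimplicialUpTo L e) {k : ℕ} (hk : k < e) (n : ℕ) {S : Finset ι} (hn : k ≤ S.card + n)
    (hS : Exposed L S) {φ : ι → ℝ} (hφ : φ ∈ L)
    (hφS : ∀ i ∈ S, φ i = 0) (hneg : ∃ i, φ i < 0)
    {z : Finset ι → ZMod 2} (hz : ∀ F, z F ≠ 0 → LowerStar L S φ k F)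
    (hcyc : ∀ G, S ⊆ G → bdry z G = 0) :
    ∃ y : Finset ι → ZMod 2, (∀ F, y F ≠ 0 → LowerStar L S φ (k + 1) F) ∧
      ∀ F, S ⊆ F → bdry y F = z F := by
  classical
  induction n generalizing S φ z with
  | zero =>
    by_cases hz0 : ∃ F, z F ≠ 0
    · obtain ⟨F, hF⟩ := hz0
      have hcard := Finset.card_le_card (hz F hF).2.2.1
      have hFk := (hz F hF).2.1
      obtain ⟨h, hL, h0, h1, v₀, hv₀, hE, -, -⟩ := K.exists_sweep hS (by omega) hφ hφS hneg
      refine exists_bdry_eq_of_support_singleton hv₀ (fun h => ?_) hE hz ?_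
      · simp [hφS v₀ h] at hv₀
      · intro F' hF'
        exact (Finset.eq_of_subset_of_card_le (hz F' hF').2.2.1
          (by rw [(hz F' hF').2.1]; omega)).symm
    · push Not at hz0
      exact ⟨0, by simp, fun F _ => by simp [bdry, hz0]⟩
  | succ n ih =>
    by_cases hSk : k < S.card
    · have hz0 : ∀ F, z F = 0 := by
        intro F
        by_contra hF
        have hcard := Finset.card_le_card (hz F hF).2.2.1
        have hFk := (hz F hF).2.1
        omega
      exact ⟨0, by simp, fun F _ => by simp [bdry, hz0]⟩
    push Not at hSk
    obtain ⟨h, hL, h0, h1, v₀, hv₀, hE, hmin, htie⟩ :=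
      K.exists_sweep hS (by omega) hφ hφS hneg
    have hnot : ∀ v, φ v < 0 → v ∉ S := fun v hv hvS => by simp [hφS v hvS] at hv
    let Lk : Finset ι := Finset.univ.filter fun v => φ v < 0 ∧ Exposed L (insert v S)
    have hmemLk : ∀ v, v ∈ Lk ↔ φ v < 0 ∧ Exposed L (insert v S) := by simp [Lk]
    have hlink : ∀ {j : ℕ}, j ≤ e → ∀ {F}, LowerStar L S φ j F → ∀ v ∈ F, v ∉ S → v ∈ Lk := by
      intro j hj F hF v hv hvS
      exact (hmemLk v).2 ⟨hF.2.2.2 v hv hvS, K.mono hF.1 (hF.2.1.trans_le hj)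
        (Finset.insert_subset hv hF.2.2.1)⟩
    -- Sweep over the threshold `t`, by induction on the number of link vertices below it.
    suffices H : ∀ (m : ℕ) (t : ℝ) (z : Finset ι → ZMod 2),
        (Lk.filter fun v => φ v / h v < t).card ≤ m →
        (∀ F, z F ≠ 0 → LowerStar L S φ k F) →
        (∀ F, z F ≠ 0 → ∀ v ∈ F, v ∉ S → φ v / h v < t) →
        (∀ G, S ⊆ G → bdry z G = 0) →
        ∃ y : Finset ι → ZMod 2, (∀ F, y F ≠ 0 → LowerStar L S φ (k + 1) F) ∧
          ∀ F, S ⊆ F → bdry y F = z F by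
      refine H _ 0 z le_rfl hz (fun F hF v hv hvS => ?_) hcyc
      exact div_neg_of_neg_of_pos ((hz F hF).2.2.2 v hv hvS) (h1 v hvS)
    intro m
    induction m with
    | zero =>
      intro t z hm hz hzt _
      have hempty : Lk.filter (fun v => φ v / h v < t) = ∅ := Finset.card_eq_zero.1 (by omega)
      refine exists_bdry_eq_of_support_singleton hv₀ (hnot v₀ hv₀) hE hz fun F hF => ?_
      refine Finset.Subset.antisymm (fun v hv => ?_) (hz F hF).2.2.1
      by_contra hvS
      have : v ∈ Lk.filter (fun v => φ v / h v < t) :=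
        Finset.mem_filter.2 ⟨hlink hk.le (hz F hF) v hv hvS, hzt F hF v hv hvS⟩
      simp [hempty] at this
    | succ m ihm =>
      intro t z hm hz hzt hcyc
      by_cases hne : (Lk.filter fun v => φ v / h v < t).Nonempty
      swap
      · rw [Finset.not_nonempty_iff_eq_empty] at hne
        exact ihm t z (by simp [hne]) hz hzt hcyc
      obtain ⟨a, ha, hmax⟩ := Finset.exists_max_image _ (fun v => φ v / h v) hne
      obtain ⟨haLk, hat⟩ := Finset.mem_filter.1 ha
      obtain ⟨haneg, haE⟩ := (hmemLk a).1 haLk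
      have haS := hnot a haneg
      have hha := h1 a haS
      -- Link vertices below `t` other than `a` have smaller slope than `a`.
      have hlt : ∀ v ∈ Lk, φ v / h v < t → v ≠ a → φ v / h v < φ a / h a := by
        intro v hv hvt hva
        refine lt_of_le_of_ne (hmax v (Finset.mem_filter.2 ⟨hv, hvt⟩)) fun heq => ?_
        exact hva (htie a v haneg ((hmemLk v).1 hv).1 haE heq.symm)
      have hcardlt : (Lk.filter fun v => φ v / h v < φ a / h a).card ≤ m := by
        have : (Lk.filter fun v => φ v / h v < φ a / h a) ⊂
            (Lk.filter fun v => φ v / h v < t) := by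
          rw [Finset.ssubset_iff_of_subset]
          · exact ⟨a, ha, by simp⟩
          · intro v hv
            obtain ⟨hv1, hv2⟩ := Finset.mem_filter.1 hv
            exact Finset.mem_filter.2 ⟨hv1, hv2.trans hat⟩
        have := Finset.card_lt_card this
        omega
      by_cases hav : a = v₀
      · -- Below the minimum there is nothing left, so the cycle condition at `S` kills `insert a S`.
        subst hav
        have hFeq : ∀ F, z F ≠ 0 → F ⊆ insert a S := by
          intro F hF v hv
          by_contra hv'
          have hva : v ≠ a := fun h => hv' (by simp [h])
          have hvS : v ∉ S := fun h => hv' (by simp [h])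
          have hvneg := (hz F hF).2.2.2 v hv hvS
          have := hlt v (hlink hk.le (hz F hF) v hv hvS) (hzt F hF v hv hvS) hva
          exact absurd (hmin v hvneg hva) this.not_gt
        have hzero : z (insert a S) = 0 := by
          have := hcyc S subset_rfl
          rwa [bdry, Finset.sum_eq_single a] at this
          · intro v hv hva
            by_contra hF
            have := hFeq _ hF (Finset.mem_insert_self v S)
            exact (Finset.mem_insert.1 this).elim hva (by simpa using hv)
          · intro h; simp [haS] at h
        have hzS : ∀ F, z F ≠ 0 → F = S := by
          intro F hF
          have h3 : S ⊆ F := (hz F hF).2.2.1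
          have hcases : F = insert a S ∨ a ∉ F := by
            by_cases haF : a ∈ F
            · exact Or.inl (Finset.Subset.antisymm (hFeq F hF) (Finset.insert_subset haF h3))
            · exact Or.inr haF
          rcases hcases with heq | haF
          · exact absurd (heq ▸ hzero) hF
          · refine Finset.Subset.antisymm (fun v hv => ?_) h3
            exact (Finset.mem_insert.1 (hFeq F hF hv)).elim (fun h => absurd (h ▸ hv) haF) id
        exact exists_bdry_eq_of_support_singleton hv₀ haS hE hz hzS
      -- The part of `z` on the faces containing `a` is a cycle in a lower star of `insert a S`.
      let φ' : ι → ℝ := φ - (φ a / h a) • h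
      have hφ'v : ∀ v, φ' v = φ v - φ a / h a * h v := fun v => by simp [φ']
      have hφ'neg : ∀ v, v ∉ S → (φ' v < 0 ↔ φ v / h v < φ a / h a) := by
        intro v hv
        rw [hφ'v, sub_neg, div_lt_iff₀ (h1 v hv)]
      let za : Finset ι → ZMod 2 := fun F => if a ∈ F then z F else 0
      have hza : ∀ F, za F ≠ 0 → a ∈ F ∧ z F ≠ 0 := by
        intro F hF
        by_cases h : a ∈ F
        · exact ⟨h, by simpa [za, h] using hF⟩
        · simp [za, h] at hF
      obtain ⟨y, hy, hyb⟩ := ih (S := insert a S) (φ := φ') (z := za)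
        (by rw [Finset.card_insert_of_notMem haS]; omega) haE
        (L.sub_mem hφ (L.smul_mem _ hL))
        (by
          intro i hi
          rw [hφ'v]
          rcases Finset.mem_insert.1 hi with rfl | hi
          · rw [div_mul_cancel₀ _ hha.ne', sub_self]
          · simp [hφS i hi, h0 i hi])
        ⟨v₀, (hφ'neg v₀ (hnot v₀ hv₀)).2 (hmin a haneg hav)⟩
        (by
          intro F hF
          obtain ⟨haF, hzF⟩ := hza F hF
          refine ⟨(hz F hzF).1, (hz F hzF).2.1, Finset.insert_subset haF (hz F hzF).2.2.1, ?_⟩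
          intro v hv hv'
          have hvS : v ∉ S := fun h => hv' (by simp [h])
          rw [hφ'neg v hvS]
          exact hlt v (hlink hk.le (hz F hzF) v hv hvS) (hzt F hzF v hv hvS)
            (fun h => hv' (by simp [h])))
        (by
          intro G hG
          have haG : a ∈ G := hG (Finset.mem_insert_self _ _)
          rw [← hcyc G ((Finset.subset_insert _ _).trans hG)]
          refine Finset.sum_congr rfl fun v _ => ?_
          simp [za, haG])
      have hyS : ∀ F, y F ≠ 0 → LowerStar L S φ (k + 1) F ∧
          ∀ v ∈ F, v ∉ S → v ≠ a → φ v / h v < φ a / h a := by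
        intro F hF
        obtain ⟨h3, h4, h5, h6⟩ := hy F hF
        have h7 : ∀ v ∈ F, v ∉ S → v ≠ a → φ v / h v < φ a / h a := fun v hv hvS hva =>
          (hφ'neg v hvS).1 (h6 v hv (by simp [hva, hvS]))
        refine ⟨⟨h3, h4, (Finset.subset_insert _ _).trans h5, fun v hv hvS => ?_⟩, h7⟩
        by_cases hva : v = a
        · rw [hva]; exact haneg
        · have := (h7 v hv hvS hva).trans (div_neg_of_neg_of_pos haneg hha)
          rw [div_lt_iff₀ (h1 v hvS)] at this
          simpa using this
      let z' : Finset ι → ZMod 2 := fun F => if S ⊆ F then z F + bdry y F else 0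
      have hz'a : ∀ F, z' F ≠ 0 → a ∉ F := by
        intro F hF haF
        by_cases hSF : S ⊆ F
        · have := hyb F (Finset.insert_subset haF hSF)
          simp [z', hSF, this, za, haF, add_self_zmod2] at hF
        · simp [z', hSF] at hF
      have hz'supp : ∀ F, z' F ≠ 0 → LowerStar L S φ k F ∧
          ∀ v ∈ F, v ∉ S → φ v / h v < φ a / h a := by
        intro F hF
        have haF := hz'a F hF
        have hSF : S ⊆ F := by
          by_contra hSF; simp [z', hSF] at hF
        by_cases hzF : z F = 0
        · have hb : bdry y F ≠ 0 := by simpa [z', hSF, hzF] using hF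
          obtain ⟨v, hvF, hv⟩ := exists_of_bdry_ne_zero hb
          obtain ⟨⟨h3, h4, h5, h6⟩, h7⟩ := hyS _ hv
          rw [Finset.card_insert_of_notMem hvF] at h4
          refine ⟨⟨K.mono h3 (by rw [Finset.card_insert_of_notMem hvF]; omega)
            (Finset.subset_insert _ _), by omega, hSF, fun w hw hwS =>
            h6 w (Finset.mem_insert_of_mem hw) hwS⟩, fun w hw hwS =>
            h7 w (Finset.mem_insert_of_mem hw) hwS (fun h => haF (h ▸ hw))⟩
        · refine ⟨hz F hzF, fun w hw hwS => ?_⟩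
          exact hlt w (hlink hk.le (hz F hzF) w hw hwS) (hzt F hzF w hw hwS)
            (fun h => haF (h ▸ hw))
      obtain ⟨y', hy', hyb'⟩ := ihm (φ a / h a) z' hcardlt (fun F hF => (hz'supp F hF).1)
        (fun F hF => (hz'supp F hF).2) (by
          intro G hG
          have : bdry z' G = bdry z G + bdry (bdry y) G := by
            simp only [bdry]
            rw [← Finset.sum_add_distrib]
            refine Finset.sum_congr rfl fun v _ => ?_
            simp [z', hG.trans (Finset.subset_insert _ _), bdry]
          rw [this, hcyc G hG, bdry_bdry, add_zero])
      refine ⟨y' + y, ?_, ?_⟩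
      · intro F hF
        by_cases hyF : y F = 0
        · exact hy' F (by simpa [hyF] using hF)
        · exact (hyS F hyF).1
      · intro F hF
        rw [bdry_add, Pi.add_apply, hyb' F hF]
        simp [z', hF, add_assoc, add_self_zmod2]

end Sweep

/-! ### The double complex -/

section DoubleComplex

variable {ι : Type*} [Fintype ι] [DecidableEq ι]

/-- The horizontal differential of the double complex of functions `c F A` on pairs `A ⊆ F`: the
simplicial boundary in `F`. -/
def hd (c : Finset ι → Finset ι → ZMod 2) (G A : Finset ι) : ZMod 2 :=
  if A ⊆ G then ∑ v ∈ Gᶜ, c (insert v G) A else 0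

/-- The vertical differential of the double complex: the simplicial coboundary in `A`, within the
simplex `F`. -/
def vd (c : Finset ι → Finset ι → ZMod 2) (F A : Finset ι) : ZMod 2 :=
  if A ⊆ F then ∑ a ∈ A, c F (A.erase a) else 0

/-- Members of bidegree `(m, k)` of the double complex: functions supported on the pairs `A ⊆ F`
with `F` a face with `m` vertices and `A` of size `k`. Bidegrees are integers, so that `k - 1`
makes sense for `k = 0`. -/
def IsBichain (L : Submodule ℝ (ι → ℝ)) (m k : ℤ) (c : Finset ι → Finset ι → ZMod 2) : Prop :=
  ∀ F A, c F A ≠ 0 → Exposed L F ∧ (F.card : ℤ) = m ∧ (A.card : ℤ) = k ∧ A ⊆ F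

/-- The sum of all coefficients. -/
def total (c : Finset ι → Finset ι → ZMod 2) : ZMod 2 := ∑ F, ∑ A, c F A

lemma hd_add (b c : Finset ι → Finset ι → ZMod 2) : hd (b + c) = hd b + hd c := by
  funext G A
  by_cases h : A ⊆ G <;> simp [hd, h, Finset.sum_add_distrib]

lemma vd_add (b c : Finset ι → Finset ι → ZMod 2) : vd (b + c) = vd b + vd c := by
  funext G A
  by_cases h : A ⊆ G <;> simp [vd, h, Finset.sum_add_distrib]

lemma vd_zero : vd (0 : Finset ι → Finset ι → ZMod 2) = 0 := by
  funext G A; simp [vd]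

lemma hd_vd (c : Finset ι → Finset ι → ZMod 2) : hd (vd c) = vd (hd c) := by
  funext G A
  by_cases h : A ⊆ G
  · have h1 : ∀ v, A ⊆ insert v G := fun v => h.trans (Finset.subset_insert _ _)
    have h2 : ∀ a, A.erase a ⊆ G := fun a => (Finset.erase_subset _ _).trans h
    simp only [hd, vd, h, h1, h2, if_true]
    exact Finset.sum_comm
  · simp [hd, vd, h]

lemma hd_hd (c : Finset ι → Finset ι → ZMod 2) : hd (hd c) = 0 := by
  funext G A
  by_cases h : A ⊆ G
  · have h1 : ∀ v, A ⊆ insert v G := fun v => h.trans (Finset.subset_insert _ _)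
    simp only [hd, h, h1, if_true]
    exact bdry_bdry (fun F => c F A) G
  · simp [hd, h]

lemma vd_vd (c : Finset ι → Finset ι → ZMod 2) : vd (vd c) = 0 := by
  funext F A
  by_cases h : A ⊆ F
  · have h2 : ∀ a, A.erase a ⊆ F := fun a => (Finset.erase_subset _ _).trans h
    simp only [vd, h, h2, if_true]
    rw [Finset.sum_sigma']
    refine Finset.sum_involution (fun p _ => ⟨p.2, p.1⟩) ?_ ?_ ?_ ?_
    · rintro ⟨v, w⟩ _
      simp only [Finset.erase_right_comm (a := w) (b := v), add_self_zmod2]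
    · rintro ⟨v, w⟩ h _ heq
      simp only [Finset.mem_sigma, Finset.mem_erase] at h
      exact h.2.1 (by simpa using congrArg Sigma.fst heq)
    · rintro ⟨v, w⟩ h
      simp only [Finset.mem_sigma, Finset.mem_erase] at h ⊢
      exact ⟨h.2.2, fun h' => h.2.1 h'.symm, h.1⟩
    · rintro ⟨v, w⟩ _; rfl
  · simp [vd, h]

variable {L : Submodule ℝ (ι → ℝ)} {e : ℕ}

lemma IsBichain.add {m k : ℤ} {b c : Finset ι → Finset ι → ZMod 2} (hb : IsBichain L m k b)
    (hc : IsBichain L m k c) : IsBichain L m k (b + c) := by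
  intro F A h
  by_cases h0 : b F A = 0
  · exact hc F A (by simpa [h0] using h)
  · exact hb F A h0

lemma IsBichain.eq_zero {m k : ℤ} {c : Finset ι → Finset ι → ZMod 2} (hc : IsBichain L m k c)
    (h : m < k ∨ k < 0) : c = 0 := by
  funext F A
  by_contra h0
  obtain ⟨-, h1, h2, h3⟩ := hc F A h0
  have := Finset.card_le_card h3
  omega

lemma IsBichain.vd {m k : ℤ} {c : Finset ι → Finset ι → ZMod 2} (hc : IsBichain L m k c) :
    IsBichain L m (k + 1) (vd c) := by
  intro F A h
  by_cases hAF : A ⊆ F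
  · simp only [Z2Hodge.vd, hAF, if_true] at h
    obtain ⟨a, ha, h⟩ := Finset.exists_ne_zero_of_sum_ne_zero h
    obtain ⟨h0, h1, h2, -⟩ := hc _ _ h
    have := Finset.card_erase_add_one ha
    exact ⟨h0, h1, by omega, hAF⟩
  · simp [Z2Hodge.vd, hAF] at h

lemma IsBichain.hd (K : SimplicialUpTo L e) {m k : ℤ} (hm : m ≤ e)
    {c : Finset ι → Finset ι → ZMod 2} (hc : IsBichain L m k c) :
    IsBichain L (m - 1) k (hd c) := by
  intro F A h
  by_cases hAF : A ⊆ F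
  · simp only [Z2Hodge.hd, hAF, if_true] at h
    obtain ⟨v, hv, h⟩ := Finset.exists_ne_zero_of_sum_ne_zero h
    obtain ⟨h0, h1, h2, -⟩ := hc _ _ h
    have hcard := Finset.card_insert_of_notMem (by simpa using hv : v ∉ F)
    exact ⟨K.mono h0 (by omega) (Finset.subset_insert _ _), by omega, h2, hAF⟩
  · simp [Z2Hodge.hd, hAF] at h

/-- The rows of the double complex are exact below degree `e`: the row of `A` is the complex of
faces containing `A`. -/
lemma SimplicialUpTo.exists_hd_eq (K : SimplicialUpTo L e) {m k : ℤ} (hm : m < e)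
    {c : Finset ι → Finset ι → ZMod 2} (hc : IsBichain L m k c) (h0 : hd c = 0) :
    ∃ b, IsBichain L (m + 1) k b ∧ hd b = c := by
  have key : ∀ A : Finset ι, ∃ y : Finset ι → ZMod 2, (∀ F, y F ≠ 0 →
      Exposed L F ∧ (F.card : ℤ) = m + 1 ∧ (A.card : ℤ) = k ∧ A ⊆ F) ∧
      ∀ F, A ⊆ F → bdry y F = c F A := by
    intro A
    by_cases hz : ∃ F, c F A ≠ 0
    swap
    · push Not at hz
      exact ⟨0, by simp, fun F _ => by simp [bdry, hz]⟩
    obtain ⟨F₀, hF₀⟩ := hz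
    obtain ⟨hE, hF₀m, hAk, hAF₀⟩ := hc _ _ hF₀
    have hle := Finset.card_le_card hAF₀
    have hA : Exposed L A := K.mono hE (by omega) hAF₀
    obtain ⟨h, hL, hh0, hh1⟩ := id hA
    have hcard := K.card_lt
    obtain ⟨v, hv⟩ : ∃ v, v ∉ A := by
      by_contra hall
      push Not at hall
      have := Finset.card_univ (α := ι)
      rw [← Finset.eq_univ_iff_forall.2 hall] at this
      omega
    obtain ⟨y, hy, hyb⟩ := K.lowerStar_acyclic (k := F₀.card) (by omega) F₀.card (by omega) hA
      (L.neg_mem hL) (by intro i hi; simp [hh0 i hi]) ⟨v, by simpa using hh1 v hv⟩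
      (z := fun F => c F A) (by
        intro F hF
        obtain ⟨h1, h2, h3, h4⟩ := hc _ _ hF
        exact ⟨h1, by omega, h4, fun w _ hw => by simpa using hh1 w hw⟩) (by
        intro G hG
        have := congrFun (congrFun h0 G) A
        simpa [Z2Hodge.hd, hG, bdry] using this)
    refine ⟨y, fun F hF => ?_, hyb⟩
    obtain ⟨h1, h2, h3, -⟩ := hy F hF
    exact ⟨h1, by omega, hAk, h3⟩
  choose y hy hyb using key
  refine ⟨fun F A => y A F, fun F A h => hy A F h, ?_⟩
  funext F A
  by_cases hAF : A ⊆ F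
  · simpa [Z2Hodge.hd, hAF, bdry] using hyb A F hAF
  · have : c F A = 0 := by
      by_contra h
      exact hAF (hc F A h).2.2.2
    simp [Z2Hodge.hd, hAF, this]

/-- The columns of the double complex are exact: the column of `F` is the augmented cochain
complex of a simplex. Contraction with a vertex of `F` is a homotopy. -/
lemma exists_vd_eq {m k : ℤ} {c : Finset ι → Finset ι → ZMod 2} (hc : IsBichain L m k c)
    (h0 : vd c = 0) (hm : m = 0 → c = 0) : ∃ b, IsBichain L m (k - 1) b ∧ vd b = c := by
  classical
  by_cases hm0 : m = 0
  · exact ⟨0, fun F A h => absurd rfl h, by rw [vd_zero, hm hm0]⟩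
  let b : Finset ι → Finset ι → ZMod 2 := fun F B =>
    if h : F.Nonempty then (if h.choose ∈ B then 0 else c F (insert h.choose B)) else 0
  refine ⟨b, ?_, ?_⟩
  · intro F B h
    by_cases hF : F.Nonempty
    · by_cases hB : hF.choose ∈ B
      · simp [b, hF, hB] at h
      · simp only [b, hF, hB, dif_pos, if_false] at h
        obtain ⟨h1, h2, h3, h4⟩ := hc _ _ h
        rw [Finset.card_insert_of_notMem hB] at h3
        push_cast at h3
        exact ⟨h1, h2, by omega, (Finset.subset_insert _ _).trans h4⟩
    · simp [b, hF] at h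
  · funext F A
    by_cases hAF : A ⊆ F
    swap
    · have : c F A = 0 := by
        by_contra h
        exact hAF (hc F A h).2.2.2
      simp [Z2Hodge.vd, hAF, this]
    by_cases hF : F.Nonempty
    swap
    · have hF' : F = ∅ := Finset.not_nonempty_iff_eq_empty.1 hF
      have hcF : c F A = 0 := by
        by_contra h
        have := (hc F A h).2.1
        simp [hF'] at this
        exact hm0 this.symm
      simp [Z2Hodge.vd, b, hF, hcF]
    set f := hF.choose with hf
    have hfF : f ∈ F := hF.choose_spec
    simp only [Z2Hodge.vd, hAF, if_true, b, hF, dif_pos, ← hf]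
    by_cases hfA : f ∈ A
    · rw [Finset.sum_eq_single f]
      · simp [Finset.insert_erase hfA]
      · intro a _ haf
        simp [Finset.mem_erase, hfA, haf.symm]
      · exact fun h => absurd hfA h
    · have h1 := congrFun (congrFun h0 F) (insert f A)
      simp only [Z2Hodge.vd, Finset.insert_subset hfF hAF, if_true, Pi.zero_apply] at h1
      rw [Finset.sum_insert hfA, Finset.erase_insert hfA] at h1
      rw [← add_eq_zero_iff_eq_neg.1 ((add_comm _ _).trans h1 : _ + c F A = 0) |>.trans
        (ZMod.neg_eq_self_mod_two _)]
      refine Finset.sum_congr rfl fun a ha => ?_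
      rw [if_neg (fun h => hfA (Finset.mem_of_mem_erase h)), Finset.erase_insert_of_ne]
      rintro rfl; exact hfA ha

/-- The sets with one element more than `G` that contain `G` are the sets `insert u G`. -/
lemma sum_eq_sum_insert {M : Type*} [AddCommMonoid M] {G : Finset ι} {φ : Finset ι → M}
    (hφ : ∀ F, φ F ≠ 0 → G ⊆ F ∧ F.card = G.card + 1) :
    ∑ F, φ F = ∑ u ∈ Gᶜ, φ (insert u G) := by
  have hinj : Set.InjOn (fun v => insert v G) (Gᶜ : Finset ι) := by
    intro v hv w hw h
    have : v ∈ insert w G := by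
      rw [← show insert v G = insert w G from h]; exact Finset.mem_insert_self _ _
    exact (Finset.mem_insert.1 this).resolve_right (by simpa using hv)
  rw [← Finset.sum_image (f := φ) hinj]
  refine (Finset.sum_subset (Finset.subset_univ _) fun F _ hF => ?_).symm
  by_contra h
  obtain ⟨h2, h1⟩ := hφ F h
  obtain ⟨v, hv⟩ := Finset.card_eq_one.1
    (by rw [Finset.card_sdiff_of_subset h2]; omega : (F \ G).card = 1)
  have hvF : v ∈ F \ G := by simp [hv]
  rw [Finset.mem_sdiff] at hvF
  refine hF (Finset.mem_image.2 ⟨v, by simpa using hvF.2, ?_⟩)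
  exact Finset.eq_of_subset_of_card_le (Finset.insert_subset hvF.1 h2)
    (by rw [Finset.card_insert_of_notMem hvF.2]; omega)

lemma total_hd {k : ℤ} {c : Finset ι → Finset ι → ZMod 2} (hc : IsBichain L (k + 1) k c) :
    total (hd c) = total c := by
  unfold total
  rw [Finset.sum_comm, Finset.sum_comm (f := c)]
  refine Finset.sum_congr rfl fun A _ => ?_
  have hcard : ∀ F, c F A ≠ 0 → F.card = A.card + 1 ∧ A ⊆ F := by
    intro F h
    obtain ⟨-, h1, h2, h3⟩ := hc _ _ h
    exact ⟨by omega, h3⟩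
  rw [Finset.sum_eq_single A]
  · simp only [hd, subset_rfl, if_true]
    exact (sum_eq_sum_insert fun F hF => ⟨(hcard F hF).2, (hcard F hF).1⟩).symm
  · intro G _ hG
    by_contra h
    by_cases hAG : A ⊆ G
    · simp only [hd, hAG, if_true] at h
      obtain ⟨v, hv, h⟩ := Finset.exists_ne_zero_of_sum_ne_zero h
      have h1 := (hcard _ h).1
      rw [Finset.card_insert_of_notMem (by simpa using hv)] at h1
      exact hG (Finset.eq_of_subset_of_card_le hAG (by omega)).symm
    · simp [hd, hAG] at h
  · simp

lemma total_vd {k : ℤ} {c : Finset ι → Finset ι → ZMod 2} (hc : IsBichain L (k + 1) k c) :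
    total (vd c) = total c := by
  unfold total
  refine Finset.sum_congr rfl fun F _ => ?_
  have hcard : ∀ A, c F A ≠ 0 → F.card = A.card + 1 ∧ A ⊆ F := by
    intro A h
    obtain ⟨-, h1, h2, h3⟩ := hc _ _ h
    exact ⟨by omega, h3⟩
  rw [Finset.sum_eq_single F]
  · simp only [vd, subset_rfl, if_true]
    have hinj : Set.InjOn (fun v => F.erase v) F := by
      intro v hv w hw h
      by_contra hne
      have : v ∈ F.erase w := Finset.mem_erase.2 ⟨hne, hv⟩
      simp [← show F.erase v = F.erase w from h] at this
    rw [← Finset.sum_image (f := fun A => c F A) hinj]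
    refine Finset.sum_subset (Finset.subset_univ _) fun A _ hA => ?_
    by_contra h
    obtain ⟨h1, h2⟩ := hcard A h
    obtain ⟨v, hv⟩ := Finset.card_eq_one.1
      (by rw [Finset.card_sdiff_of_subset h2]; omega : (F \ A).card = 1)
    have hvF : v ∈ F \ A := by simp [hv]
    rw [Finset.mem_sdiff] at hvF
    refine hA (Finset.mem_image.2 ⟨v, by simpa using hvF.1, ?_⟩)
    have hsub : A ⊆ F.erase v := fun w hw =>
      Finset.mem_erase.2 ⟨fun h => hvF.2 (h ▸ hw), h2 hw⟩
    exact (Finset.eq_of_subset_of_card_le hsub (by rw [Finset.card_erase_of_mem hvF.1]; omega)).symm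
  · intro A _ hA
    by_contra h
    by_cases hAF : A ⊆ F
    · simp only [vd, hAF, if_true] at h
      obtain ⟨v, hv, h⟩ := Finset.exists_ne_zero_of_sum_ne_zero h
      have h1 := (hcard _ h).1
      have h2 := Finset.card_erase_add_one hv
      exact hA (Finset.eq_of_subset_of_card_le hAF (by omega))
    · simp [vd, hAF] at h
  · simp

lemma IsBichain.eq_zero_of_total {k : ℤ} {c : Finset ι → Finset ι → ZMod 2}
    (hc : IsBichain L 0 k c) (htot : total c = 0) : c = 0 := by
  have hempty : ∀ F A, c F A ≠ 0 → F = ∅ ∧ A = ∅ := by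
    intro F A h
    obtain ⟨-, h1, -, h2⟩ := hc F A h
    obtain rfl : F = ∅ := Finset.card_eq_zero.1 (by exact_mod_cast h1)
    exact ⟨rfl, Finset.subset_empty.1 h2⟩
  funext F A
  by_contra h
  obtain ⟨rfl, rfl⟩ := hempty F A h
  refine h ?_
  unfold total at htot
  rwa [Finset.sum_eq_single ∅, Finset.sum_eq_single ∅] at htot
  · intro A _ hA
    by_contra hn
    exact hA (hempty _ _ hn).2
  · simp
  · intro F _ hF
    refine Finset.sum_eq_zero fun A _ => ?_
    by_contra hn
    exact hF (hempty _ _ hn).1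
  · simp

/-- Chains modulo vertical boundaries are exact in bidegrees `k < m < e`, up to the total
coefficient when `m = k + 1`: if the horizontal boundary of `c` is a vertical one then `c` is a sum
of a horizontal and a vertical boundary. -/
theorem SimplicialUpTo.exists_eq_hd_add_vd (K : SimplicialUpTo L e) (k : ℕ) {m : ℤ} (hkm : k < m)
    (hm : m < e) {c a : Finset ι → Finset ι → ZMod 2} (hc : IsBichain L m k c)
    (ha : IsBichain L (m - 1) (k - 1) a) (hca : hd c = vd a) (htot : m = k + 1 → total c = 0) :
    ∃ b b', IsBichain L (m + 1) k b ∧ IsBichain L m (k - 1) b' ∧ c = hd b + vd b' := by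
  induction k generalizing m c a with
  | zero =>
    obtain rfl : a = 0 := ha.eq_zero (by simp)
    obtain ⟨b, hb, rfl⟩ := K.exists_hd_eq hm hc (by rw [hca, vd_zero])
    exact ⟨b, 0, hb, fun F A h => absurd rfl h, by simp [vd_zero]⟩
  | succ k ih =>
    push_cast at ha hkm htot hc
    have ha : IsBichain L (m - 1) k a := by simpa using ha
    have htota : m - 1 = k + 1 → total a = 0 := by
      intro h
      have h1 : m = k + 1 + 1 := by omega
      rw [h] at ha
      rw [← total_vd ha, ← hca]
      rw [h1] at hc
      rw [total_hd hc]
      exact htot h1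
    obtain ⟨a', ha', hda'⟩ := exists_vd_eq (ha.hd K (by omega))
      (by rw [← hd_vd, ← hca, hd_hd]) (by
        -- In bidegree `(0, 0)` the only coefficient is the total one.
        intro h
        have hk : k = 0 := by omega
        subst hk
        have hmm : m - 1 = 0 + 1 := by omega
        have ha1 := ha
        rw [hmm] at ha1
        have h2 := total_hd (k := 0) (by simpa using ha1)
        rw [htota (by simpa using hmm)] at h2
        have hz := ha.hd K (by omega)
        rw [h] at hz
        exact hz.eq_zero_of_total h2)
    obtain ⟨b₁, b₂, hb₁, hb₂, hab⟩ := ih (by omega) (by omega) ha ha' hda'.symm htota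
    have hb₁ : IsBichain L m k b₁ := by simpa using hb₁
    have hcyc : hd (c + vd b₁) = 0 := by
      rw [hd_add, hca, hd_vd, hab, vd_add, vd_vd, add_zero]
      funext F A
      exact add_self_zmod2 _
    obtain ⟨b, hb, hbc⟩ := K.exists_hd_eq hm (hc.add hb₁.vd) hcyc
    refine ⟨b, b₁, by exact_mod_cast hb, by simpa using hb₁, ?_⟩
    rw [hbc]
    funext F A
    simp [add_assoc, add_self_zmod2]

/-- On the diagonal `m = k + 1` the hypothesis on the horizontal boundary is automatic. -/
theorem SimplicialUpTo.exists_eq_hd_add_vd_of_total_eq_zero (K : SimplicialUpTo L e) (k : ℕ)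
    (hk : k + 1 < e) {c : Finset ι → Finset ι → ZMod 2} (hc : IsBichain L (k + 1) k c)
    (htot : total c = 0) :
    ∃ b b', IsBichain L (k + 1 + 1) k b ∧ IsBichain L (k + 1) (k - 1) b' ∧ c = hd b + vd b' := by
  have hz : IsBichain L (k + 1 - 1) k (hd c) := hc.hd K (by exact_mod_cast hk.le)
  obtain ⟨a, ha, hda⟩ := exists_vd_eq hz (hz.vd.eq_zero (by left; omega)) (by
    intro h
    rw [h] at hz
    exact hz.eq_zero_of_total ((total_hd hc).trans htot))
  exact K.exists_eq_hd_add_vd k (by omega) (by exact_mod_cast hk) hc ha hda.symm fun _ => htot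

end DoubleComplex

/-! ### Exterior powers of simplex frames -/

section ExteriorPower

variable {ι : Type*} [LinearOrder ι] {E : Type*} [AddCommGroup E] [Module (ZMod 2) E]

/-- The exterior product of the vectors `x a`, `a ∈ A`, as an element of the `q`-th exterior power;
zero if `A` does not have `q` elements. -/
def extGen (q : ℕ) (x : ι → E) (A : Finset ι) : ⋀[ZMod 2]^q E :=
  if h : A.card = q then exteriorPower.ιMulti (ZMod 2) q (fun i => x (A.orderEmbOfFin h i)) else 0

lemma extGen_of_card_ne {q : ℕ} {x : ι → E} {A : Finset ι} (h : A.card ≠ q) :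
    extGen q x A = 0 := dif_neg h

lemma extGen_eq_zero {q : ℕ} {x : ι → E} {A : Finset ι} {a : ι} (ha : a ∈ A) (hx : x a = 0) :
    extGen q x A = 0 := by
  by_cases h : A.card = q
  · rw [extGen, dif_pos h]
    have : a ∈ Set.range (A.orderEmbOfFin h) := by simpa using ha
    obtain ⟨i, hi⟩ := this
    exact AlternatingMap.map_coord_zero _ i (by rw [hi, hx])
  · exact extGen_of_card_ne h

/-- Modulo 2 the order of the factors does not matter. -/
lemma ιMulti_eq_extGen {q : ℕ} (x : ι → E) {w : Fin q → ι} (hw : Function.Injective w) :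
    exteriorPower.ιMulti (ZMod 2) q (fun i => x (w i)) = extGen q x (Finset.univ.image w) := by
  have hc : (Finset.univ.image w).card = q := by
    rw [Finset.card_image_of_injective _ hw, Finset.card_univ, Fintype.card_fin]
  rw [extGen, dif_pos hc]
  have hmem : ∀ i, ∃ j, (Finset.univ.image w).orderEmbOfFin hc j = w i := by
    intro i
    have : w i ∈ Set.range ((Finset.univ.image w).orderEmbOfFin hc) := by simp
    exact this
  choose s hs using hmem
  have hsinj : Function.Injective s := fun i j h => hw (by rw [← hs i, ← hs j, h])
  let σ : Equiv.Perm (Fin q) := Equiv.ofBijective s (Finite.injective_iff_bijective.1 hsinj)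
  have h1 : (fun i => x (w i)) =
      (fun i => x ((Finset.univ.image w).orderEmbOfFin hc i)) ∘ σ := by
    funext i
    simp [σ, hs]
  rw [h1, AlternatingMap.map_perm]
  rcases Int.units_eq_one_or (Equiv.Perm.sign σ) with h | h
  · rw [h, one_smul]
  · rw [h, Units.neg_smul, one_smul, ZModModule.neg_eq_self]

lemma map_extGen {E' : Type*} [AddCommGroup E'] [Module (ZMod 2) E'] (q : ℕ) (f : E →ₗ[ZMod 2] E')
    (x : ι → E) (A : Finset ι) :
    exteriorPower.map q f (extGen q x A) = extGen q (fun a => f (x a)) A := by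
  by_cases h : A.card = q
  · rw [extGen, dif_pos h, extGen, dif_pos h, exteriorPower.map_apply_ιMulti]
    rfl
  · rw [extGen_of_card_ne h, extGen_of_card_ne h, map_zero]

/-- If the `x a` add up to zero then so do the exterior products over the sets `insert a B`: their
sum is the product of `∑ x a` with the vectors of `B`. -/
lemma sum_extGen_insert [Fintype ι] {q : ℕ} {x : ι → E} (hx : ∑ a, x a = 0) (B : Finset ι) :
    ∑ a ∈ Bᶜ, extGen q x (insert a B) = 0 := by
  by_cases hB : B.card + 1 = q
  swap
  · refine Finset.sum_eq_zero fun a ha => extGen_of_card_ne ?_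
    rwa [Finset.card_insert_of_notMem (by simpa using ha)]
  subst hB
  let W : E → ⋀[ZMod 2]^(B.card + 1) E := fun y => exteriorPower.ιMulti (ZMod 2) (B.card + 1)
    (Matrix.vecCons y (fun i => x (B.orderEmbOfFin rfl i)))
  have hcons : ∀ a, (Matrix.vecCons (x a) (fun i => x (B.orderEmbOfFin rfl i))) =
      fun i => x (Matrix.vecCons a (B.orderEmbOfFin rfl) i) := by
    intro a
    funext i
    refine Fin.cases ?_ (fun i => ?_) i <;> simp
  have h0 : ∑ a, W (x a) = 0 := by
    let W' : E →+ ⋀[ZMod 2]^(B.card + 1) E :=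
      AddMonoidHom.mk' W fun y z => AlternatingMap.map_vecCons_add _ _ y z
    rw [show ∑ a, W (x a) = W' (∑ a, x a) from (map_sum W' _ _).symm, hx, map_zero]
  rw [← Finset.sum_compl_add_sum B] at h0
  rw [Finset.sum_eq_zero (s := B), add_zero] at h0
  · rw [← h0]
    refine Finset.sum_congr rfl fun a ha => ?_
    have haB : a ∉ B := by simpa using ha
    simp only [W]
    rw [hcons, ιMulti_eq_extGen x]
    · congr 1
      ext b
      have hr : b ∈ B ↔ ∃ i, B.orderEmbOfFin rfl i = b := by
        rw [← Set.mem_range, Finset.range_orderEmbOfFin, Finset.mem_coe]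
      rw [Finset.mem_insert, Finset.mem_image, hr, Fin.exists_fin_succ]
      simp [eq_comm]
    · refine Fin.cons_injective_iff.2 ⟨?_, (B.orderEmbOfFin rfl).injective⟩
      rw [Finset.range_orderEmbOfFin]; exact haB
  · intro a ha
    simp only [W]
    have : a ∈ Set.range (B.orderEmbOfFin rfl) := by simpa using ha
    obtain ⟨i, hi⟩ := this
    exact AlternatingMap.map_eq_zero_of_eq _ _ (i := 0) (j := i.succ) (by simp [hi])
      (Fin.succ_ne_zero i).symm

/-- Pairs `(A, a)` with `a ∈ A` correspond to pairs `(B, a)` with `a ∉ B`, via `A = insert a B`. -/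
lemma sum_sum_erase [Fintype ι] {M : Type*} [AddCommMonoid M] (f : Finset ι → Finset ι → M) :
    ∑ A, ∑ a ∈ A, f (A.erase a) A = ∑ B, ∑ a ∈ Bᶜ, f B (insert a B) := by
  rw [Finset.sum_sigma', Finset.sum_sigma']
  refine Finset.sum_bij' (fun p _ => ⟨p.1.erase p.2, p.2⟩) (fun p _ => ⟨insert p.2 p.1, p.2⟩)
    ?_ ?_ ?_ ?_ ?_
  · rintro ⟨A, a⟩ h; simp
  · rintro ⟨B, a⟩ h; simp
  · rintro ⟨A, a⟩ h
    simp only [Finset.mem_sigma, Finset.mem_univ, true_and] at h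
    simp [Finset.insert_erase h]
  · rintro ⟨B, a⟩ h
    simp only [Finset.mem_sigma, Finset.mem_univ, true_and, Finset.mem_compl] at h
    simp [Finset.erase_insert h]
  · rintro ⟨A, a⟩ h
    simp only [Finset.mem_sigma, Finset.mem_univ, true_and] at h
    simp [Finset.insert_erase h]

lemma sum_coboundary_smul_extGen [Fintype ι] {q : ℕ} {x : ι → E} (hx : ∑ a, x a = 0)
    (b : Finset ι → ZMod 2) : ∑ A, (∑ a ∈ A, b (A.erase a)) • extGen q x A = 0 := by
  simp only [Finset.sum_smul]
  rw [sum_sum_erase (fun B A => b B • extGen q x A)]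
  refine Finset.sum_eq_zero fun B _ => ?_
  rw [← Finset.smul_sum, sum_extGen_insert hx, smul_zero]

lemma exists_eq_sum_extGen [Fintype ι] {q : ℕ} {x : ι → E}
    (hx : Submodule.span (ZMod 2) (Set.range x) = ⊤) (ω : ⋀[ZMod 2]^q E) :
    ∃ c : Finset ι → ZMod 2, (∀ A, c A ≠ 0 → A.card = q) ∧ ω = ∑ A, c A • extGen q x A := by
  classical
  have h : ω ∈ Submodule.span (ZMod 2) (Set.range (extGen q x)) := by
    have h1 := exteriorPower.ιMulti_family_span_of_span (n := q) (ZMod 2) hx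
    have h2 : ω ∈ (⊤ : Submodule (ZMod 2) (⋀[ZMod 2]^q E)) := trivial
    rw [← h1] at h2
    refine Submodule.span_mono ?_ h2
    rintro _ ⟨s, rfl⟩
    refine ⟨s, ?_⟩
    have hs : s.1.card = q := s.2
    rw [extGen, dif_pos hs, exteriorPower.ιMulti_family, Set.powersetCard.ofFinEmbEquiv_symm_apply]
    rfl
  obtain ⟨c, rfl⟩ := (Submodule.mem_span_range_iff_exists_fun _).1 h
  refine ⟨fun A => if A.card = q then c A else 0, fun A hA => ?_, ?_⟩
  · by_contra h; simp [h] at hA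
  · refine Finset.sum_congr rfl fun A _ => ?_
    by_cases hA : A.card = q
    · simp [hA]
    · simp [hA, extGen_of_card_ne hA]

lemma linearIndependent_extGen {q : ℕ} {x : ι → E} {s : Set ι}
    (hx : LinearIndependent (ZMod 2) fun a : s => x a) :
    LinearIndependent (ZMod 2)
      fun A : {A : Finset ι // A.card = q ∧ (A : Set ι) ⊆ s} => extGen q x A.1 := by
  classical
  have h := exteriorPower.ιMulti_family_linearIndependent_field q hx
  let g : {A : Finset ι // A.card = q ∧ (A : Set ι) ⊆ s} → Set.powersetCard s q := fun A =>
    ⟨A.1.subtype (· ∈ s), by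
      show (A.1.subtype (· ∈ s)).card = q
      rw [Finset.card_subtype, Finset.filter_true_of_mem fun a ha => A.2.2 ha, A.2.1]⟩
  have hmap : ∀ A, ((g A).1.map (Function.Embedding.subtype _)) = A.1 := by
    intro A
    rw [Finset.subtype_map]
    exact Finset.filter_true_of_mem fun a ha => A.2.2 ha
  have hg : Function.Injective g := by
    intro A B hAB
    apply Subtype.ext
    rw [← hmap A, ← hmap B, hAB]
  convert h.comp g hg using 1
  swap
  · rfl
  funext A
  rw [Function.comp_apply, exteriorPower.ιMulti_family, Set.powersetCard.ofFinEmbEquiv_symm_apply]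
  have hgc : (g A).1.card = q := (g A).2
  let w : Fin q → ι := fun j => (((g A).1.orderEmbOfFin hgc j : s) : ι)
  have hw : Function.Injective w :=
    Subtype.val_injective.comp ((g A).1.orderEmbOfFin hgc).injective
  refine Eq.trans ?_ (ιMulti_eq_extGen x hw).symm
  congr 1
  rw [← hmap A]
  ext a
  rw [Finset.mem_image, Finset.mem_map]
  have hr : ∀ b : s, b ∈ (g A).1 ↔ ∃ i, (g A).1.orderEmbOfFin hgc i = b := by
    intro b
    rw [← Set.mem_range, Finset.range_orderEmbOfFin, Finset.mem_coe]
  constructor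
  · rintro ⟨b, hb, rfl⟩
    obtain ⟨i, rfl⟩ := (hr b).1 hb
    exact ⟨i, Finset.mem_univ _, rfl⟩
  · rintro ⟨i, -, rfl⟩
    exact ⟨_, (hr _).2 ⟨i, rfl⟩, rfl⟩

/-- Generators `x a`, `a ∈ F`, of a vector space over `ℤ/2` whose only linear relation is
`∑ x a = 0`; outside `F` the family is zero. This presents the dual of the space of
coefficient vectors on `F` with vanishing sum. -/
structure IsSimplexFrame (x : ι → E) (F : Finset ι) [Fintype ι] : Prop where
  eq_zero : ∀ a ∉ F, x a = 0
  sum_eq_zero : ∑ a, x a = 0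
  span_eq_top : Submodule.span (ZMod 2) (Set.range x) = ⊤
  linearIndependent : ∀ f ∈ F, LinearIndependent (ZMod 2)
    fun a : ((F.erase f : Finset ι) : Set ι) => x a

variable [Fintype ι] {x : ι → E} {F : Finset ι}

lemma IsSimplexFrame.extGen_eq_zero (hx : IsSimplexFrame x F) {q : ℕ} {A : Finset ι}
    (hA : ¬ A ⊆ F) : extGen q x A = 0 := by
  obtain ⟨a, ha, haF⟩ := Finset.not_subset.1 hA
  exact Z2Hodge.extGen_eq_zero ha (hx.eq_zero a haF)

lemma IsSimplexFrame.exists_eq_sum (hx : IsSimplexFrame x F) {q : ℕ} (ω : ⋀[ZMod 2]^q E) :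
    ∃ c : Finset ι → ZMod 2, (∀ A, c A ≠ 0 → A.card = q ∧ A ⊆ F) ∧
      ω = ∑ A, c A • extGen q x A := by
  obtain ⟨c, hc, rfl⟩ := exists_eq_sum_extGen hx.span_eq_top ω
  refine ⟨fun A => if A ⊆ F then c A else 0, fun A hA => ?_, ?_⟩
  · by_cases h : A ⊆ F
    · exact ⟨hc A (by simpa [h] using hA), h⟩
    · simp [h] at hA
  · refine Finset.sum_congr rfl fun A _ => ?_
    by_cases hA : A ⊆ F
    · simp [hA]
    · simp [hA, hx.extGen_eq_zero hA]

/-- The linear relations between the exterior products of a simplex frame are the coboundaries. -/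
lemma IsSimplexFrame.exists_coboundary (hx : IsSimplexFrame x F) (hF : F.Nonempty) {q : ℕ}
    {c : Finset ι → ZMod 2} (hc : ∀ A, c A ≠ 0 → A.card = q ∧ A ⊆ F)
    (h0 : ∑ A, c A • extGen q x A = 0) :
    ∃ b : Finset ι → ZMod 2, (∀ B, b B ≠ 0 → B.card + 1 = q ∧ B ⊆ F) ∧
      ∀ A ⊆ F, c A = ∑ a ∈ A, b (A.erase a) := by
  classical
  obtain ⟨f, hf⟩ := hF
  let b : Finset ι → ZMod 2 := fun B => if f ∈ B then 0 else c (insert f B)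
  have hb : ∀ B, b B ≠ 0 → B.card + 1 = q ∧ B ⊆ F := by
    intro B hB
    by_cases hfB : f ∈ B
    · simp [b, hfB] at hB
    · obtain ⟨h1, h2⟩ := hc (insert f B) (by simpa [b, hfB] using hB)
      rw [Finset.card_insert_of_notMem hfB] at h1
      exact ⟨h1, (Finset.subset_insert _ _).trans h2⟩
  refine ⟨b, hb, ?_⟩
  -- Subtracting the coboundary of `b` removes the terms whose set contains `f`.
  let c' : Finset ι → ZMod 2 := fun A => c A + ∑ a ∈ A, b (A.erase a)
  have hc'f : ∀ A, f ∈ A → c' A = 0 := by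
    intro A hfA
    simp only [c']
    rw [Finset.sum_eq_single f]
    · simp [b, Finset.insert_erase hfA, add_self_zmod2]
    · intro a _ haf
      simp [b, Finset.mem_erase, hfA, haf.symm]
    · exact fun h => absurd hfA h
  have hc'0 : ∑ A, c' A • extGen q x A = 0 := by
    simp only [c', add_smul]
    rw [Finset.sum_add_distrib, h0, sum_coboundary_smul_extGen hx.sum_eq_zero, add_zero]
  have hc' : ∀ A, A ⊆ F → c' A = 0 := by
    intro A hAF
    by_cases hfA : f ∈ A
    · exact hc'f A hfA
    by_cases hAq : A.card = q
    swap
    · have h1 : c A = 0 := by by_contra h; exact hAq (hc A h).1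
      simp only [c', h1, zero_add]
      refine Finset.sum_eq_zero fun a ha => ?_
      by_contra h
      have := (hb _ h).1
      rw [Finset.card_erase_add_one ha] at this
      exact hAq this
    have hli := linearIndependent_extGen (q := q) (hx.linearIndependent f hf)
    rw [Fintype.linearIndependent_iff] at hli
    refine hli (fun A => c' A.1) ?_ ⟨A, hAq, ?_⟩
    · rw [← hc'0]
      rw [← Finset.sum_subtype (Finset.univ.filter fun A : Finset ι => A.card = q ∧
        (A : Set ι) ⊆ (F.erase f : Finset ι)) (by simp) (fun A => c' A • extGen q x A),
        Finset.sum_filter_of_ne]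
      · intro A _ hne
        have h1 : c' A ≠ 0 := fun h => hne (by rw [h, zero_smul])
        have h2 : extGen q x A ≠ 0 := fun h => hne (by rw [h, smul_zero])
        refine ⟨by_contra fun h => h2 (extGen_of_card_ne h), ?_⟩
        have h3 : A ⊆ F := by_contra fun h => h2 (hx.extGen_eq_zero h)
        intro a ha
        refine Finset.mem_coe.2 (Finset.mem_erase.2 ⟨fun h => h1 (hc'f A (h ▸ ha)), h3 ha⟩)
    · intro a ha
      exact Finset.mem_coe.2 (Finset.mem_erase.2 ⟨fun h => hfA (h ▸ ha), hAF ha⟩)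
  intro A hA
  have := hc' A hA
  simp only [c'] at this
  rw [← ZMod.neg_eq_self_mod_two (∑ a ∈ A, b (A.erase a))]
  exact eq_neg_of_add_eq_zero_left this

lemma IsSimplexFrame.eq_zero_of_card_eq (hx : IsSimplexFrame x F) {q : ℕ} (hq : F.card = q)
    (hF : F.Nonempty) (ω : ⋀[ZMod 2]^q E) : ω = 0 := by
  obtain ⟨f, hf⟩ := hF
  have h := sum_extGen_insert (q := q) hx.sum_eq_zero (F.erase f)
  rw [Finset.sum_eq_single f, Finset.insert_erase hf] at h
  · obtain ⟨c, hc, rfl⟩ := hx.exists_eq_sum ω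
    refine Finset.sum_eq_zero fun A _ => ?_
    by_cases hA : c A = 0
    · rw [hA, zero_smul]
    · obtain ⟨h1, h2⟩ := hc A hA
      rw [Finset.eq_of_subset_of_card_le h2 (by omega), h, smul_zero]
  · intro a ha haf
    refine hx.extGen_eq_zero fun h => ?_
    have h1 := h (Finset.mem_insert_self _ _)
    simp only [Finset.mem_compl, Finset.mem_erase, not_and] at ha
    exact ha haf h1
  · intro h; simp at h

/-- The top exterior power of a simplex frame is one-dimensional, and all products of all but one of
the generators are equal to its nonzero element. -/
lemma IsSimplexFrame.exists_dual (hx : IsSimplexFrame x F) {q : ℕ} (hq : F.card = q + 1) :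
    ∃ ε : ⋀[ZMod 2]^q E →ₗ[ZMod 2] ZMod 2, (∀ A ⊆ F, A.card = q → ε (extGen q x A) = 1) ∧
      ∀ ω, ε ω = 0 → ω = 0 := by
  obtain ⟨f, hf⟩ : F.Nonempty := Finset.card_pos.1 (by omega)
  set g := extGen q x (F.erase f) with hg
  have hg0 : g ≠ 0 := by
    have hli := linearIndependent_extGen (q := q) (hx.linearIndependent f hf)
    exact hli.ne_zero ⟨F.erase f, by rw [Finset.card_erase_of_mem hf]; omega, subset_rfl⟩
  have hall : ∀ A ⊆ F, A.card = q → extGen q x A = g := by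
    intro A hAF hA
    by_cases hfA : f ∈ A
    swap
    · rw [hg, Finset.eq_of_subset_of_card_le
        (fun a ha => Finset.mem_erase.2 ⟨fun h => hfA (h ▸ ha), hAF ha⟩ : A ⊆ F.erase f)
        (by rw [Finset.card_erase_of_mem hf]; omega)]
    -- With `A = F \ {a}`, the relation of `F \ {a, f}` has the two terms `A` and `F \ {f}`.
    obtain ⟨a, ha⟩ := Finset.card_eq_one.1
      (by rw [Finset.card_sdiff_of_subset hAF]; omega : (F \ A).card = 1)
    have haF : a ∈ F ∧ a ∉ A := by rw [← Finset.mem_sdiff, ha]; simp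
    have haf : a ≠ f := fun h => haF.2 (h ▸ hfA)
    have hins : insert a (A.erase f) = F.erase f := by
      refine Finset.eq_of_subset_of_card_le ?_ ?_
      · intro i hi
        rcases Finset.mem_insert.1 hi with rfl | hi
        · exact Finset.mem_erase.2 ⟨haf, haF.1⟩
        · exact Finset.mem_erase.2 ⟨(Finset.mem_erase.1 hi).1, hAF (Finset.mem_erase.1 hi).2⟩
      · rw [Finset.card_insert_of_notMem (fun h => haF.2 (Finset.mem_of_mem_erase h)),
          Finset.card_erase_of_mem hf, Finset.card_erase_add_one hfA]
        omega
    have h := sum_extGen_insert (q := q) hx.sum_eq_zero (A.erase f)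
    rw [← Finset.sum_subset (s₁ := {f, a}), Finset.sum_pair haf.symm, Finset.insert_erase hfA,
      hins, ← hg] at h
    · rw [eq_neg_of_add_eq_zero_left h, ZModModule.neg_eq_self]
    · intro i hi
      rcases Finset.mem_insert.1 hi with rfl | hi
      · simp
      · rw [Finset.mem_singleton.1 hi]; simp [haF.2]
    · intro i _ hi
      refine hx.extGen_eq_zero fun h => hi ?_
      have hiF := h (Finset.mem_insert_self _ _)
      by_cases hif : i = f
      · simp [hif]
      · have : i ∈ F \ A := by
          refine Finset.mem_sdiff.2 ⟨hiF, fun hiA => ?_⟩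
          simp_all
        rw [ha, Finset.mem_singleton] at this
        simp [this]
  obtain ⟨ε, hε⟩ : ∃ ε : Module.Dual (ZMod 2) (⋀[ZMod 2]^q E), ε g ≠ 0 := by
    by_contra h
    push Not at h
    exact hg0 ((Module.forall_dual_apply_eq_zero_iff (ZMod 2) g).1 h)
  have hε1 : ε g = 1 := by
    generalize ε g = t at hε
    revert hε; revert t; decide
  refine ⟨ε, fun A hAF hA => by rw [hall A hAF hA, hε1], fun ω hω => ?_⟩
  obtain ⟨c, hc, rfl⟩ := hx.exists_eq_sum ω
  have hsum : ∑ A, c A • extGen q x A = (∑ A, c A) • g := by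
    rw [Finset.sum_smul]
    refine Finset.sum_congr rfl fun A _ => ?_
    by_cases hA : c A = 0
    · rw [hA, zero_smul, zero_smul]
    · rw [hall A (hc A hA).2 (hc A hA).1]
  rw [hsum, map_smul, hε1, smul_eq_mul, mul_one] at hω
  rw [hsum, hω, zero_smul]

end ExteriorPower

/-! ### Lattice vectors independent modulo 2 -/

section OddDuals

variable {d : ℕ} {κ : Type*} [Fintype κ] [DecidableEq κ]

lemma mod2_add (m n : Fin d → ℤ) : mod2 (m + n) = mod2 m + mod2 n := by
  funext i; simp [mod2]

lemma mod2_sub (m n : Fin d → ℤ) : mod2 (m - n) = mod2 m - mod2 n := by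
  funext i; simp [mod2]

lemma mod2_smul (k : ℤ) (n : Fin d → ℤ) : mod2 (k • n) = (k : ZMod 2) • mod2 n := by
  funext i; simp [mod2]

lemma mod2_dotProduct (m n : Fin d → ℤ) : mod2 m ⬝ᵥ mod2 n = ((m ⬝ᵥ n : ℤ) : ZMod 2) := by
  simp [mod2, dotProduct]

lemma mod2_surjective : Function.Surjective (mod2 : (Fin d → ℤ) → Fin d → ZMod 2) := by
  intro x
  refine ⟨fun i => ((x i).val : ℤ), ?_⟩
  funext i
  simp [mod2]

lemma intCast_zmod2_eq_zero {k : ℤ} : (k : ZMod 2) = 0 ↔ ∃ y, k = 2 * y :=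
  (ZMod.intCast_zmod_eq_zero_iff_dvd k 2)

lemma latticePt_add (m n : Fin d → ℤ) : latticePt (m + n) = latticePt m + latticePt n := by
  funext i; simp [latticePt]

lemma latticePt_sub (m n : Fin d → ℤ) : latticePt (m - n) = latticePt m - latticePt n := by
  funext i; simp [latticePt]

lemma latticePt_smul (k : ℤ) (n : Fin d → ℤ) : latticePt (k • n) = (k : ℝ) • latticePt n := by
  funext i; simp [latticePt]

lemma latticePt_dotProduct (m n : Fin d → ℤ) :
    latticePt m ⬝ᵥ latticePt n = ((m ⬝ᵥ n : ℤ) : ℝ) := by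
  simp [latticePt, dotProduct]

/-- Lattice vectors that are linearly independent modulo 2 have a dual family up to an odd factor:
the factor is the determinant of the product of their matrix with a lift of a right inverse
modulo 2. -/
lemma exists_odd_dual {u : κ → Fin d → ℤ}
    (hu : LinearIndependent (ZMod 2) fun i => mod2 (u i)) :
    ∃ (w : κ → Fin d → ℤ) (D : ℤ), Odd D ∧ ∀ i j, u i ⬝ᵥ w j = if i = j then D else 0 := by
  let f : (κ → ZMod 2) →ₗ[ZMod 2] (Fin d → ZMod 2) := Fintype.linearCombination (ZMod 2)
    fun i => mod2 (u i)
  obtain ⟨g, hg⟩ := f.exists_leftInverse_of_injective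
    (LinearMap.ker_eq_bot'.2 fun c hc => funext (Fintype.linearIndependent_iff.1 hu c hc))
  have hgu : ∀ i, g (mod2 (u i)) = Pi.single i 1 := by
    intro i
    have h1 : f (Pi.single i 1) = mod2 (u i) := by
      simp [f, Fintype.linearCombination_apply, Pi.single_apply]
    rw [← h1]
    exact LinearMap.congr_fun hg _
  let B : Matrix (Fin d) κ ℤ := fun k j => ((g (Pi.single k 1) j).val : ℤ)
  let P : Matrix κ κ ℤ := Matrix.of u * B
  have hP : P.map (Int.castRingHom (ZMod 2)) = 1 := by
    ext i j
    have h1 : mod2 (u i) = ∑ k, mod2 (u i) k • (Pi.single k 1 : Fin d → ZMod 2) := by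
      funext l
      simp [Finset.sum_apply, Pi.single_apply]
    have h2 := congrFun (hgu i) j
    rw [h1, map_sum, Finset.sum_apply] at h2
    simp only [map_smul, Pi.smul_apply, smul_eq_mul] at h2
    rw [Matrix.map_apply, show P i j = ∑ k, u i k * B k j from Matrix.mul_apply, map_sum,
      Matrix.one_apply]
    rw [Pi.single_apply] at h2
    simp only [eq_comm (a := i)]
    rw [← h2]
    refine Finset.sum_congr rfl fun k _ => ?_
    simp [B, mod2]
  have hdet : ((P.det : ℤ) : ZMod 2) = 1 := by
    have h := RingHom.map_det (Int.castRingHom (ZMod 2)) P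
    rw [RingHom.mapMatrix_apply, hP, Matrix.det_one] at h
    exact h
  refine ⟨fun j k => (B * P.adjugate) k j, P.det, ?_, ?_⟩
  · rw [← Int.not_even_iff_odd, ← ZMod.intCast_eq_zero_iff_even, hdet]
    decide
  · intro i j
    have h : (Matrix.of u * (B * P.adjugate)) i j = (P.det • (1 : Matrix κ κ ℤ)) i j := by
      rw [← Matrix.mul_assoc, Matrix.mul_adjugate]
    rw [Matrix.mul_apply] at h
    rw [dotProduct]
    refine Eq.trans h ?_
    simp [Matrix.one_apply]

/-- Linear independence modulo 2 implies linear independence over the reals. -/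
lemma linearIndependent_latticePt {u : κ → Fin d → ℤ}
    (hu : LinearIndependent (ZMod 2) fun i => mod2 (u i)) :
    LinearIndependent ℝ fun i => latticePt (u i) := by
  obtain ⟨w, D, hD, hw⟩ := exists_odd_dual hu
  rw [Fintype.linearIndependent_iff]
  intro c hc j
  have h := congrArg (· ⬝ᵥ latticePt (w j)) hc
  simp only [sum_dotProduct, smul_dotProduct, latticePt_dotProduct, hw, zero_dotProduct] at h
  have hD0 : (D : ℝ) ≠ 0 := by
    rintro h0
    rw [Int.cast_eq_zero] at h0
    simp [h0] at hD
  simpa [hD0] using h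

end OddDuals

/-! ### Lattice polytopes and their faces -/

section Polytope

variable {d : ℕ} {ι : Type*} {Δ : Set (Fin d → ℝ)} {v : ι → Fin d → ℤ}

/-- `v` enumerates the vertices of the lattice polytope `Δ`. -/
structure IsVertexSystem (Δ : Set (Fin d → ℝ)) (v : ι → Fin d → ℤ) : Prop where
  injective : Function.Injective v
  eq_hull : Δ = convexHull ℝ (Set.range fun i => latticePt (v i))
  extreme : ∀ i, latticePt (v i) ∈ Δ.extremePoints ℝ

lemma IsLatticePolytope.exists_isVertexSystem (h : IsLatticePolytope Δ) :
    ∃ (N : ℕ) (v : Fin N → Fin d → ℤ), IsVertexSystem Δ v := by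
  classical
  obtain ⟨S, rfl⟩ := h
  set P := convexHull ℝ (latticePt '' (S : Set (Fin d → ℤ))) with hP
  have hfin : (latticePt '' (S : Set (Fin d → ℤ))).Finite := S.finite_toSet.image _
  have hext : P.extremePoints ℝ ⊆ latticePt '' (S : Set (Fin d → ℤ)) :=
    extremePoints_convexHull_subset (𝕜 := ℝ)
  let T : Finset (Fin d → ℤ) := S.filter fun s => latticePt s ∈ P.extremePoints ℝ
  refine ⟨T.card, fun i => (T.equivFin.symm i : Fin d → ℤ), ?_, ?_, ?_⟩
  · exact Subtype.val_injective.comp T.equivFin.symm.injective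
  · have hr : (Set.range fun i => latticePt (T.equivFin.symm i : Fin d → ℤ)) =
        P.extremePoints ℝ := by
      ext m
      constructor
      · rintro ⟨i, rfl⟩
        exact (Finset.mem_filter.1 (T.equivFin.symm i).2).2
      · intro hm
        obtain ⟨s, hs, rfl⟩ := hext hm
        exact ⟨T.equivFin ⟨s, Finset.mem_filter.2 ⟨hs, hm⟩⟩, by simp⟩
    rw [hr]
    have h1 := closure_convexHull_extremePoints (s := P) (hfin.isCompact_convexHull ℝ)
      (convex_convexHull ℝ _)
    rw [((hfin.subset hext).isClosed_convexHull ℝ).closure_eq] at h1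
    exact h1.symm
  · intro i
    exact (Finset.mem_filter.1 (T.equivFin.symm i).2).2

/-- The restrictions to the vertices of the affine functions on the ambient space. -/
def affineFunctions (v : ι → Fin d → ℤ) : Submodule ℝ (ι → ℝ) where
  carrier := {g | ∃ (n : Fin d → ℝ) (c : ℝ), ∀ i, g i = latticePt (v i) ⬝ᵥ n - c}
  zero_mem' := ⟨0, 0, by simp⟩
  add_mem' := by
    rintro g g' ⟨n, c, h⟩ ⟨n', c', h'⟩
    exact ⟨n + n', c + c', fun i => by rw [Pi.add_apply, h, h', dotProduct_add]; ring⟩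
  smul_mem' := by
    rintro r g ⟨n, c, h⟩
    exact ⟨r • n, r * c, fun i => by
      rw [Pi.smul_apply, h, dotProduct_smul, smul_eq_mul, smul_eq_mul]; ring⟩

lemma exposed_affineFunctions_iff {f : Finset ι} : Exposed (affineFunctions v) f ↔
    ∃ (n : Fin d → ℝ) (c : ℝ), (∀ i ∈ f, latticePt (v i) ⬝ᵥ n = c) ∧
      ∀ i ∉ f, c < latticePt (v i) ⬝ᵥ n := by
  constructor
  · rintro ⟨h, ⟨n, c, hn⟩, h0, h1⟩
    exact ⟨n, c, fun i hi => by linarith [hn i, h0 i hi], fun i hi => by linarith [hn i, h1 i hi]⟩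
  · rintro ⟨n, c, h0, h1⟩
    exact ⟨fun i => latticePt (v i) ⬝ᵥ n - c, ⟨n, c, fun i => rfl⟩,
      fun i hi => by simp [h0 i hi], fun i hi => by simpa using h1 i hi⟩

/-- The vectors on which the vertices in `f` take the same value. -/
def constOn (v : ι → Fin d → ℤ) (f : Finset ι) : Submodule ℝ (Fin d → ℝ) where
  carrier := {x | ∀ i ∈ f, ∀ j ∈ f, latticePt (v i) ⬝ᵥ x = latticePt (v j) ⬝ᵥ x}
  zero_mem' := by simp
  add_mem' := by
    intro x y hx hy i hi j hj
    rw [dotProduct_add, dotProduct_add, hx i hi j hj, hy i hi j hj]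
  smul_mem' := by
    intro r x hx i hi j hj
    rw [dotProduct_smul, dotProduct_smul, hx i hi j hj]

/-- The set of vertices of `Δ` labelled by `f`. -/
def vertexSet (v : ι → Fin d → ℤ) (f : Finset ι) : Set (Fin d → ℝ) :=
  (fun i => latticePt (v i)) '' (f : Set ι)

lemma finrank_span_add_finrank_constOn_le (v : ι → Fin d → ℤ) (f : Finset ι) :
    Module.finrank ℝ (Submodule.span ℝ (vertexSet v f)) + Module.finrank ℝ (constOn v f) ≤
      d + 1 := by
  classical
  let A : Matrix f (Fin d) ℝ := Matrix.of fun i => latticePt (v i)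
  have hr : Set.range A.row = vertexSet v f := by
    ext m
    constructor
    · rintro ⟨i, rfl⟩
      exact ⟨i, i.2, rfl⟩
    · rintro ⟨i, hi, rfl⟩
      exact ⟨⟨i, hi⟩, rfl⟩
  have h1 := LinearMap.finrank_range_add_finrank_ker A.mulVecLin
  rw [show Module.finrank ℝ A.mulVecLin.range = Module.finrank ℝ
    (Submodule.span ℝ (vertexSet v f)) by rw [← hr, ← A.rank_eq_finrank_span_row]; rfl,
    Module.finrank_fin_fun] at h1
  have h2 : Module.finrank ℝ (constOn v f) ≤ Module.finrank ℝ A.mulVecLin.ker + 1 := by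
    rcases f.eq_empty_or_nonempty with hf | ⟨i₀, hi₀⟩
    · have h3 : Module.finrank ℝ (Submodule.span ℝ (vertexSet v f)) = 0 := by
        rw [hf, vertexSet]; simp
      have h4 := Submodule.finrank_le (constOn v f)
      rw [Module.finrank_fin_fun] at h4
      omega
    let φ : constOn v f →ₗ[ℝ] ℝ := (LinearMap.proj ⟨i₀, hi₀⟩ ∘ₗ A.mulVecLin) ∘ₗ
      (constOn v f).subtype
    have h3 := LinearMap.finrank_range_add_finrank_ker φ
    have h4 : Module.finrank ℝ φ.range ≤ 1 := by
      simpa using Submodule.finrank_le φ.range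
    have h5 : φ.ker.map (constOn v f).subtype ≤ A.mulVecLin.ker := by
      rintro _ ⟨x, hx, rfl⟩
      have hx0 : latticePt (v i₀) ⬝ᵥ (x : Fin d → ℝ) = 0 := hx
      rw [LinearMap.mem_ker]
      funext i
      exact (x.2 i i.2 i₀ hi₀).trans hx0
    have h6 := Submodule.finrank_mono h5
    rw [Submodule.finrank_map_subtype_eq] at h6
    omega
  omega

lemma le_finrank_constOn_add_card (v : ι → Fin d → ℤ) {f : Finset ι} (hf : f.Nonempty) :
    d + 1 ≤ Module.finrank ℝ (constOn v f) + f.card := by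
  classical
  obtain ⟨i₀, hi₀⟩ := hf
  let A : Matrix (f.erase i₀ : Finset ι) (Fin d) ℝ :=
    Matrix.of fun i => latticePt (v i) - latticePt (v i₀)
  have h1 := LinearMap.finrank_range_add_finrank_ker A.mulVecLin
  have h2 := Submodule.finrank_le A.mulVecLin.range
  rw [Module.finrank_fintype_fun_eq_card, Fintype.card_coe, Finset.card_erase_of_mem hi₀] at h2
  rw [Module.finrank_fin_fun] at h1
  have h3 : A.mulVecLin.ker ≤ constOn v f := by
    intro x hx
    have h4 : ∀ i ∈ f, latticePt (v i) ⬝ᵥ x = latticePt (v i₀) ⬝ᵥ x := by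
      intro i hi
      by_cases hii : i = i₀
      · rw [hii]
      have h5 := congrFun (LinearMap.mem_ker.1 hx) ⟨i, Finset.mem_erase.2 ⟨hii, hi⟩⟩
      have h6 : (latticePt (v i) - latticePt (v i₀)) ⬝ᵥ x = 0 := h5
      rw [sub_dotProduct] at h6
      linarith
    intro i hi j hj
    rw [h4 i hi, h4 j hj]
  have h4 := Submodule.finrank_mono h3
  have := Finset.card_pos.2 ⟨i₀, hi₀⟩
  omega

/-- A positive function can be scaled to dominate any other function on a finite set. -/
lemma exists_forall_add_mul_pos [Finite ι] (f : Finset ι) (g h : ι → ℝ) (hh : ∀ i ∉ f, 0 < h i) :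
    ∃ T₀ : ℝ, 0 ≤ T₀ ∧ ∀ T ≥ T₀, ∀ i ∉ f, 0 < g i + T * h i := by
  have h1 : ∀ i, ∀ᶠ T : ℝ in Filter.atTop, i ∉ f → 0 < g i + T * h i := by
    intro i
    by_cases hi : i ∈ f
    · simp [hi]
    filter_upwards [Filter.eventually_gt_atTop (-g i / h i)] with T hT _
    rw [div_lt_iff₀ (hh i hi)] at hT
    linarith
  obtain ⟨T₀, hT₀⟩ := Filter.eventually_atTop.1 (Filter.eventually_all.2 h1)
  exact ⟨max T₀ 0, le_max_right _ _, fun T hT i hi => hT₀ T ((le_max_left _ _).trans hT) i hi⟩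

lemma IsVertexSystem.mem (hV : IsVertexSystem Δ v) (i : ι) : latticePt (v i) ∈ Δ := (hV.extreme i).1

lemma IsVertexSystem.convex (hV : IsVertexSystem Δ v) : Convex ℝ Δ := by
  rw [hV.eq_hull]; exact convex_convexHull _ _

lemma IsVertexSystem.le_dotProduct (hV : IsVertexSystem Δ v) {n : Fin d → ℝ} {c : ℝ}
    (h : ∀ i, c ≤ latticePt (v i) ⬝ᵥ n)
    {m : Fin d → ℝ} (hm : m ∈ Δ) : c ≤ m ⬝ᵥ n := by
  rw [hV.eq_hull] at hm
  have hconv : Convex ℝ {m : Fin d → ℝ | c ≤ m ⬝ᵥ n} :=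
    convex_halfSpace_ge ⟨fun x y => add_dotProduct x y n, fun r x => smul_dotProduct r x n⟩ c
  refine convexHull_min ?_ hconv hm
  rintro _ ⟨i, rfl⟩
  exact h i

/-- A face is the convex hull of its vertices. -/
lemma IsVertexSystem.mem_convexHull_vertexSet (hV : IsVertexSystem Δ v) {f : Finset ι}
    {n : Fin d → ℝ} {c : ℝ}
    (h0 : ∀ i ∈ f, latticePt (v i) ⬝ᵥ n = c) (h1 : ∀ i ∉ f, c < latticePt (v i) ⬝ᵥ n)
    {m : Fin d → ℝ} (hm : m ∈ Δ) (hmc : m ⬝ᵥ n = c) : m ∈ convexHull ℝ (vertexSet v f) := by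
  classical
  rw [hV.eq_hull, mem_convexHull_iff_exists_fintype] at hm
  obtain ⟨κ, _, w, z, hw, hw1, hz, rfl⟩ := hm
  choose k hk using hz
  have hle : ∀ i, c ≤ latticePt (v i) ⬝ᵥ n := fun i => by
    by_cases hi : i ∈ f
    · exact (h0 i hi).ge
    · exact (h1 i hi).le
  have hsum : ∑ j, w j * (latticePt (v (k j)) ⬝ᵥ n - c) = 0 := by
    simp only [mul_sub]
    rw [Finset.sum_sub_distrib, ← Finset.sum_mul, hw1, one_mul, sub_eq_zero, ← hmc, sum_dotProduct]
    refine Finset.sum_congr rfl fun j _ => ?_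
    rw [smul_dotProduct, ← hk j, smul_eq_mul]
  have hzero := (Finset.sum_eq_zero_iff_of_nonneg fun j _ =>
    mul_nonneg (hw j) (sub_nonneg.2 (hle (k j)))).1 hsum
  have hkf : ∀ j, w j ≠ 0 → k j ∈ f := by
    intro j hj
    by_contra hkj
    have h2 := (mul_eq_zero.1 (hzero j (Finset.mem_univ j))).resolve_left hj
    linarith [h1 (k j) hkj]
  have hfil : ∀ g : κ → Fin d → ℝ, ∑ j with w j ≠ 0, w j • g j = ∑ j, w j • g j := by
    intro g
    refine Finset.sum_filter_of_ne fun j _ hj hw0 => hj ?_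
    rw [hw0, zero_smul]
  rw [← hfil]
  refine (convex_convexHull ℝ (vertexSet v f)).sum_mem (fun j _ => hw j) ?_ fun j hj => ?_
  · rw [Finset.sum_filter_ne_zero, hw1]
  · rw [← hk j]
    exact subset_convexHull ℝ _ ⟨k j, hkf j (Finset.mem_filter.1 hj).2, rfl⟩

end Polytope

/-! ### Reflexive polytopes -/

section Reflexive

variable {d : ℕ} {ι : Type*} {Δ : Set (Fin d → ℝ)} {v : ι → Fin d → ℤ}

lemma exists_pos_smul_mem {P : Set (Fin d → ℝ)} (h0 : (0 : Fin d → ℝ) ∈ interior P)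
    (x : Fin d → ℝ) : ∃ ε : ℝ, 0 < ε ∧ ε • x ∈ P := by
  have hc : Filter.Tendsto (fun t : ℝ => t • x) (nhdsWithin 0 (Set.Ioi 0)) (nhds ((0 : ℝ) • x)) :=
    (Continuous.tendsto (by fun_prop) 0).mono_left nhdsWithin_le_nhds
  rw [zero_smul] at hc
  have h := (hc.eventually (mem_interior_iff_mem_nhds.1 h0)).and self_mem_nhdsWithin
  obtain ⟨ε, h1, h2⟩ := h.exists
  exact ⟨ε, h2, h1⟩

lemma dotProduct_neg_of_forall_le {n : Fin d → ℝ} {c : ℝ} (h0 : (0 : Fin d → ℝ) ∈ interior Δ)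
    (hn : n ≠ 0) (hc : ∀ m ∈ Δ, c ≤ m ⬝ᵥ n) : c < 0 := by
  obtain ⟨ε, hε, hmem⟩ := exists_pos_smul_mem h0 (-n)
  have h1 := hc _ hmem
  rw [smul_dotProduct, neg_dotProduct, smul_eq_mul] at h1
  have h2 : 0 < n ⬝ᵥ n := lt_of_le_of_ne (by
    rw [dotProduct]; exact Finset.sum_nonneg fun i _ => mul_self_nonneg _)
    (fun h => hn (dotProduct_self_eq_zero.1 h.symm))
  nlinarith

lemma IsVertexSystem.nonempty (hV : IsVertexSystem Δ v) (h0 : (0 : Fin d → ℝ) ∈ interior Δ) :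
    Nonempty ι := by
  have h1 : Δ.Nonempty := ⟨0, interior_subset h0⟩
  rw [hV.eq_hull, convexHull_nonempty_iff] at h1
  exact Set.range_nonempty_iff_nonempty.1 h1

lemma IsVertexSystem.constOn_univ [Fintype ι] (hV : IsVertexSystem Δ v)
    (h0 : (0 : Fin d → ℝ) ∈ interior Δ) : constOn v Finset.univ = ⊥ := by
  obtain ⟨i₀⟩ := hV.nonempty h0
  rw [eq_bot_iff]
  intro x hx
  by_contra hx0
  have hx0 : x ≠ 0 := hx0
  set c := latticePt (v i₀) ⬝ᵥ x with hc
  have h1 : ∀ i, latticePt (v i) ⬝ᵥ x = c := fun i => hx i (Finset.mem_univ _) i₀ (Finset.mem_univ _)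
  have h2 := dotProduct_neg_of_forall_le h0 hx0 fun m hm =>
    hV.le_dotProduct (fun i => (h1 i).ge) hm
  have h3 : -c < 0 := dotProduct_neg_of_forall_le h0 (neg_ne_zero.2 hx0) fun m hm =>
    hV.le_dotProduct (fun i => by rw [dotProduct_neg, h1]) hm
  linarith

variable [Fintype ι] [DecidableEq ι]

/-- A lattice vector exposing a proper face of a reflexive polytope, and a lattice vector of
height `-1` on it: the normalized exposing vector lies in the polar polytope, hence is a convex
combination of lattice points of it, all of which have height `-1` on the face. -/
lemma IsVertexSystem.exists_lattice_exposing (hV : IsVertexSystem Δ v) (hΔ : IsReflexive Δ)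
    {f : Finset ι} (hf : f.Nonempty) (hfu : f ≠ Finset.univ)
    (hE : Exposed (affineFunctions v) f) :
    (∃ (n₀ : Fin d → ℤ) (J : ℤ), (∀ i ∈ f, v i ⬝ᵥ n₀ = J) ∧ ∀ i ∉ f, J < v i ⬝ᵥ n₀) ∧
      ∃ n₁ : Fin d → ℤ, ∀ i ∈ f, v i ⬝ᵥ n₁ = -1 := by
  obtain ⟨n, c, hn0, hn1⟩ := exposed_affineFunctions_iff.1 hE
  obtain ⟨i₀, hi₀⟩ := hf
  have hle : ∀ m ∈ Δ, c ≤ m ⬝ᵥ n := fun m hm => hV.le_dotProduct (fun i => by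
    by_cases hi : i ∈ f
    · exact (hn0 i hi).ge
    · exact (hn1 i hi).le) hm
  have hn : n ≠ 0 := by
    rintro rfl
    refine hfu (Finset.eq_univ_iff_forall.2 fun i => ?_)
    by_contra hi
    have h1 := hn1 i hi
    have h2 := hn0 i₀ hi₀
    rw [dotProduct_zero] at h1 h2
    linarith
  have hc := dotProduct_neg_of_forall_le hΔ.zero_mem_interior hn hle
  have hpol : (-c)⁻¹ • n ∈ polar Δ := by
    intro m hm
    rw [dotProduct_smul, smul_eq_mul, ← neg_le_neg_iff, neg_neg, ← mul_neg,
      inv_mul_le_iff₀ (by linarith)]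
    linarith [hle m hm]
  obtain ⟨S, hS⟩ := hΔ.isLatticePolytope_polar
  have hpol' := hpol
  rw [hS, mem_convexHull_iff_exists_fintype] at hpol'
  obtain ⟨κ, _, w, z, hw, hw1, hz, hwz⟩ := hpol'
  choose s hs hsz using hz
  have hge : ∀ i j, (-1 : ℤ) ≤ v i ⬝ᵥ s j := by
    intro i j
    have h1 : latticePt (s j) ∈ polar Δ := by
      rw [hS]; exact subset_convexHull ℝ _ ⟨s j, hs j, rfl⟩
    have h2 := h1 _ (hV.mem i)
    rw [latticePt_dotProduct] at h2
    exact_mod_cast h2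
  have hval : ∀ i, ∑ j, w j * ((v i ⬝ᵥ s j + 1 : ℤ) : ℝ) =
      (-c)⁻¹ * (latticePt (v i) ⬝ᵥ n - c) := by
    intro i
    have h1 : ∑ j, w j * ((v i ⬝ᵥ s j : ℤ) : ℝ) = (-c)⁻¹ * (latticePt (v i) ⬝ᵥ n) := by
      rw [← smul_eq_mul (-c)⁻¹, ← dotProduct_smul, ← hwz, dotProduct_sum]
      refine Finset.sum_congr rfl fun j _ => ?_
      rw [dotProduct_smul, ← hsz, latticePt_dotProduct, smul_eq_mul]
    push_cast
    simp only [mul_add, mul_one]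
    rw [Finset.sum_add_distrib, hw1, h1]
    have hc1 : (-c)⁻¹ * -c = 1 := inv_mul_cancel₀ (by linarith)
    linear_combination -hc1
  have hnn : ∀ i j, 0 ≤ w j * ((v i ⬝ᵥ s j + 1 : ℤ) : ℝ) := fun i j =>
    mul_nonneg (hw j) (by exact_mod_cast (by linarith [hge i j] : (0 : ℤ) ≤ v i ⬝ᵥ s j + 1))
  have hin : ∀ i ∈ f, ∀ j, w j ≠ 0 → v i ⬝ᵥ s j = -1 := by
    intro i hi j hj
    have h1 := hval i
    rw [hn0 i hi, sub_self, mul_zero] at h1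
    have h2 := (Finset.sum_eq_zero_iff_of_nonneg fun j _ => hnn i j).1 h1 j (Finset.mem_univ j)
    have h3 : v i ⬝ᵥ s j + 1 = 0 := by exact_mod_cast (mul_eq_zero.1 h2).resolve_left hj
    linarith
  constructor
  · refine ⟨∑ j with w j ≠ 0, s j, ∑ j with w j ≠ 0, (-1 : ℤ), fun i hi => ?_, fun i hi => ?_⟩
    · rw [dotProduct_sum]
      exact Finset.sum_congr rfl fun j hj => hin i hi j (Finset.mem_filter.1 hj).2
    · rw [dotProduct_sum]
      refine Finset.sum_lt_sum (fun j _ => hge i j) ?_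
      by_contra hno
      push Not at hno
      have h1 : ∑ j, w j * ((v i ⬝ᵥ s j + 1 : ℤ) : ℝ) = 0 := by
        refine Finset.sum_eq_zero fun j _ => ?_
        by_cases hj : w j = 0
        · rw [hj, zero_mul]
        · have h2 := hno j (Finset.mem_filter.2 ⟨Finset.mem_univ j, hj⟩)
          have h3 : v i ⬝ᵥ s j + 1 = 0 := by linarith [hge i j]
          rw [h3, Int.cast_zero, mul_zero]
      rw [hval i] at h1
      have h2 : 0 < (-c)⁻¹ * (latticePt (v i) ⬝ᵥ n - c) :=
        mul_pos (inv_pos.2 (by linarith)) (by linarith [hn1 i hi])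
      linarith
  · obtain ⟨j, -, hj⟩ : ∃ j ∈ Finset.univ, w j ≠ 0 :=
      Finset.exists_ne_zero_of_sum_ne_zero (by rw [hw1]; exact one_ne_zero)
    exact ⟨s j, fun i hi => hin i hi j hj⟩

/-- The cone over a convex set consists of the nonnegative multiples of its points. -/
lemma exists_smul_of_mem_hull {F : Set (Fin d → ℝ)} (hF : Convex ℝ F) (hne : F.Nonempty)
    {x : Fin d → ℝ} (hx : x ∈ PointedCone.hull ℝ F) : ∃ r : ℝ, 0 ≤ r ∧ ∃ p ∈ F, x = r • p := by
  induction hx using Submodule.span_induction with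
  | mem p hp => exact ⟨1, zero_le_one, p, hp, (one_smul ℝ p).symm⟩
  | zero =>
    obtain ⟨p, hp⟩ := hne
    exact ⟨0, le_rfl, p, hp, (zero_smul ℝ p).symm⟩
  | add x y _ _ hx hy =>
    obtain ⟨r, hr, p, hp, rfl⟩ := hx
    obtain ⟨s, hs, q, hq, rfl⟩ := hy
    rcases (add_nonneg hr hs).eq_or_lt with h | h
    · have hr0 : r = 0 := by linarith
      have hs0 : s = 0 := by linarith
      exact ⟨0, le_rfl, p, hp, by simp [hr0, hs0]⟩
    · refine ⟨r + s, h.le, (r / (r + s)) • p + (s / (r + s)) • q, ?_, ?_⟩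
      · refine hF hp hq (by positivity) (by positivity) ?_
        rw [← add_div, div_self h.ne']
      · rw [smul_add, smul_smul, smul_smul, mul_div_cancel₀ _ h.ne', mul_div_cancel₀ _ h.ne']
  | smul a x _ hx =>
    obtain ⟨r, hr, p, hp, rfl⟩ := hx
    refine ⟨a * r, mul_nonneg a.2 hr, p, hp, ?_⟩
    rw [mul_smul]
    rfl

/-- The rays through the vertices of a proper face are faces of the cone over it, since the face
lies at height `-1` and its vertices are extreme points. -/
lemma hull_singleton_isFaceOf {F : Set (Fin d → ℝ)} (hF : Convex ℝ F) {n : Fin d → ℝ}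
    (hn : ∀ m ∈ F, m ⬝ᵥ n = -1) {p : Fin d → ℝ} (hp : p ∈ F.extremePoints ℝ) :
    (PointedCone.hull ℝ {p}).IsFaceOf (PointedCone.hull ℝ F) := by
  have hne : F.Nonempty := ⟨p, hp.1⟩
  refine ⟨Submodule.span_mono (Set.singleton_subset_iff.2 hp.1), ?_⟩
  intro x y a hx hy ha hxy
  obtain ⟨r, hr, x', hx', rfl⟩ := exists_smul_of_mem_hull hF hne hx
  obtain ⟨s, hs, y', hy', rfl⟩ := exists_smul_of_mem_hull hF hne hy
  obtain ⟨t, ht, p', hp', h⟩ := exists_smul_of_mem_hull (convex_singleton p)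
    (Set.singleton_nonempty p) hxy
  rw [Set.mem_singleton_iff.1 hp'] at h
  have hmem : ∀ t : ℝ, 0 ≤ t → t • p ∈ PointedCone.hull ℝ {p} := fun t ht =>
    Submodule.smul_mem _ (⟨t, ht⟩ : NNReal) (Submodule.subset_span rfl)
  rcases hr.eq_or_lt with rfl | hr
  · rw [zero_smul]; exact Submodule.zero_mem _
  suffices x' = p by rw [this]; exact hmem r hr.le
  have hsum : a * r + s = t := by
    have h1 := congrArg (· ⬝ᵥ n) h
    simp only [add_dotProduct, smul_dotProduct, hn _ hx', hn _ hy', hn _ hp.1, smul_eq_mul] at h1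
    linarith
  have hart : 0 < a * r := mul_pos ha hr
  have ht0 : 0 < t := by linarith
  rcases hs.eq_or_lt with rfl | hs
  · rw [zero_smul, add_zero, smul_smul] at h
    rw [add_zero] at hsum
    rw [hsum] at h
    exact smul_right_injective _ ht0.ne' h
  · refine ((mem_extremePoints.1 hp).2 x' hx' y' hy' ⟨a * r / t, s / t, by positivity,
      by positivity, ?_, ?_⟩).1
    · rw [← add_div, hsum, div_self ht0.ne']
    · rw [div_eq_inv_mul, div_eq_inv_mul, mul_smul, mul_smul t⁻¹ s, ← smul_add, mul_smul a, h,
        smul_smul, inv_mul_cancel₀ ht0.ne', one_smul]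

/-- The vertices of a proper face whose cone is `ℤ/2`-regular are linearly independent modulo 2:
they are primitive, being at height `-1`, so they are the ray generators of the cone. -/
lemma IsVertexSystem.linearIndependent_mod2 (hV : IsVertexSystem Δ v) (hΔ : IsReflexive Δ) {e : ℕ}
    (hreg : ∀ σ ∈ faceFan Δ, coneDim σ ≤ e → IsZ2Regular σ)
    {f : Finset ι} (hfu : f ≠ Finset.univ)
    (hE : Exposed (affineFunctions v) f)
    (hdim : Module.finrank ℝ (Submodule.span ℝ (vertexSet v f)) ≤ e) :
    LinearIndependent (ZMod 2) fun i : f => mod2 (v i) := by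
  rcases f.eq_empty_or_nonempty with rfl | hf
  · exact linearIndependent_empty_type
  obtain ⟨-, n₁, hn₁⟩ := hV.exists_lattice_exposing hΔ hf hfu hE
  obtain ⟨n, c, hn0, hn1⟩ := exposed_affineFunctions_iff.1 hE
  have hle : ∀ m ∈ Δ, c ≤ m ⬝ᵥ n := fun m hm => hV.le_dotProduct (fun i => by
    by_cases hi : i ∈ f
    · exact (hn0 i hi).ge
    · exact (hn1 i hi).le) hm
  let F : Set (Fin d → ℝ) := {m | m ∈ Δ ∧ m ⬝ᵥ n = c}
  obtain ⟨i₀, hi₀⟩ := hf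
  have hvF : ∀ i ∈ f, latticePt (v i) ∈ F := fun i hi => ⟨hV.mem i, hn0 i hi⟩
  have hFhull : F ⊆ convexHull ℝ (vertexSet v f) := fun m hm =>
    hV.mem_convexHull_vertexSet hn0 hn1 hm.1 hm.2
  have hconv : Convex ℝ F := hV.convex.inter
    (convex_hyperplane ⟨fun x y => add_dotProduct x y n, fun r x => smul_dotProduct r x n⟩ c)
  have hexp : IsExposed ℝ Δ F := by
    intro _
    let l : (Fin d → ℝ) →ₗ[ℝ] ℝ :=
      { toFun := fun m => -(m ⬝ᵥ n)
        map_add' := fun x y => by rw [add_dotProduct]; ring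
        map_smul' := fun r x => by rw [smul_dotProduct]; simp }
    refine ⟨LinearMap.toContinuousLinearMap l, ?_⟩
    ext m
    show (m ∈ Δ ∧ m ⬝ᵥ n = c) ↔ (m ∈ Δ ∧ ∀ y ∈ Δ, -(y ⬝ᵥ n) ≤ -(m ⬝ᵥ n))
    refine and_congr_right fun hm => ⟨fun h y hy => ?_, fun h => ?_⟩
    · rw [h]; linarith [hle y hy]
    · have := h _ (hV.mem i₀)
      rw [hn0 i₀ hi₀] at this
      linarith [hle m hm]
  have hFne : F ≠ Δ := by
    intro h
    refine hfu (Finset.eq_univ_iff_forall.2 fun i => ?_)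
    by_contra hi
    have : latticePt (v i) ∈ F := h ▸ hV.mem i
    exact (hn1 i hi).ne' this.2
  have hfan : PointedCone.hull ℝ F ∈ faceFan Δ :=
    Or.inr ⟨F, ⟨⟨_, hvF i₀ hi₀⟩, hexp⟩, hFne, rfl⟩
  have hspan : Submodule.span ℝ (PointedCone.hull ℝ F : Set (Fin d → ℝ)) ≤
      Submodule.span ℝ (vertexSet v f) := by
    rw [Submodule.span_le]
    intro x hx
    obtain ⟨r, -, p, hp, rfl⟩ := exists_smul_of_mem_hull hconv ⟨_, hvF i₀ hi₀⟩ hx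
    exact Submodule.smul_mem _ _ (convexHull_min Submodule.subset_span
      (Submodule.span ℝ (vertexSet v f)).convex (hFhull hp))
  have hli := (hreg _ hfan ((Submodule.finrank_mono hspan).trans hdim)).1
  have hn1F : ∀ m ∈ F, m ⬝ᵥ latticePt n₁ = -1 := by
    intro m hm
    have hc : Convex ℝ {m : Fin d → ℝ | m ⬝ᵥ latticePt n₁ = -1} :=
      convex_hyperplane ⟨fun x y => add_dotProduct x y _, fun r x => smul_dotProduct r x _⟩ (-1)
    refine convexHull_min ?_ hc (hFhull hm)
    rintro _ ⟨i, hi, rfl⟩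
    show latticePt (v i) ⬝ᵥ latticePt n₁ = -1
    rw [latticePt_dotProduct, hn₁ i hi]
    norm_num
  have hray : ∀ i ∈ f, v i ∈ rayGenerators (PointedCone.hull ℝ F) := by
    intro i hi
    refine ⟨fun k s hks => ?_, ?_⟩
    · have h1 := hn₁ i hi
      rw [hks, smul_dotProduct, smul_eq_mul] at h1
      exact IsUnit.of_mul_eq_one (-(s ⬝ᵥ n₁)) (by rw [mul_neg, h1, neg_neg])
    · refine hull_singleton_isFaceOf hconv hn1F ?_
      exact inter_extremePoints_subset_extremePoints_of_subset (fun m hm => hm.1)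
        ⟨hvF i hi, hV.extreme i⟩
  exact hli.comp (fun i : f => (⟨v i, hray i i.2⟩ : rayGenerators (PointedCone.hull ℝ F)))
    fun i j h => Subtype.ext (hV.injective (congrArg Subtype.val h))

end Reflexive

/-! ### Normal cones and simplices -/

section Cones

variable {d : ℕ} {ι : Type*} [Fintype ι] [DecidableEq ι] {Δ : Set (Fin d → ℝ)} {v : ι → Fin d → ℤ}
  {e : ℕ}

/-- `v` enumerates the vertices of a reflexive polytope such that all cones of its face fan of
dimension at most `e` are `ℤ/2`-regular. -/
structure IsRegularUpTo (Δ : Set (Fin d → ℝ)) (v : ι → Fin d → ℤ) (e : ℕ) : Prop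
    extends IsVertexSystem Δ v where
  isReflexive : IsReflexive Δ
  le : e ≤ d
  regular : ∀ σ ∈ faceFan Δ, coneDim σ ≤ e → IsZ2Regular σ

lemma IsRegularUpTo.ne_univ (hV : IsRegularUpTo Δ v e) {f : Finset ι}
    (hf : d + 1 ≤ Module.finrank ℝ (constOn v f) + e) : f ≠ Finset.univ := by
  rintro rfl
  rw [hV.constOn_univ hV.isReflexive.zero_mem_interior, finrank_bot] at hf
  have := hV.le
  omega

lemma IsRegularUpTo.linearIndependent (hV : IsRegularUpTo Δ v e) {f : Finset ι}
    (hE : Exposed (affineFunctions v) f)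
    (hf : d + 1 ≤ Module.finrank ℝ (constOn v f) + e) :
    LinearIndependent (ZMod 2) fun i : f => mod2 (v i) := by
  refine hV.linearIndependent_mod2 hV.isReflexive hV.regular (hV.ne_univ hf) hE ?_
  have := finrank_span_add_finrank_constOn_le v f
  omega

lemma finrank_constOn_add_card {f : Finset ι} (hf : f.Nonempty)
    (hli : LinearIndependent (ZMod 2) fun i : f => mod2 (v i)) :
    Module.finrank ℝ (constOn v f) + f.card = d + 1 := by
  have h1 := le_finrank_constOn_add_card v hf
  have h2 := finrank_span_add_finrank_constOn_le v f
  have h3 := finrank_span_eq_card (linearIndependent_latticePt hli)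
  have h4 : (Set.range fun i : f => latticePt (v i)) = vertexSet v f := by
    ext m
    constructor
    · rintro ⟨i, rfl⟩
      exact ⟨i, i.2, rfl⟩
    · rintro ⟨i, hi, rfl⟩
      exact ⟨⟨i, hi⟩, rfl⟩
  rw [h4, Fintype.card_coe] at h3
  omega

lemma IsRegularUpTo.linearIndependent_of_card_le (hV : IsRegularUpTo Δ v e) {f : Finset ι}
    (hE : Exposed (affineFunctions v) f) (hf : f.card ≤ e) :
    LinearIndependent (ZMod 2) fun i : f => mod2 (v i) := by
  rcases f.eq_empty_or_nonempty with rfl | hne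
  · exact linearIndependent_empty_type
  · refine hV.linearIndependent hE ?_
    have := le_finrank_constOn_add_card v hne
    omega

/-- The faces of dimension less than `e` are simplices. -/
lemma IsRegularUpTo.simplicialUpTo (hV : IsRegularUpTo Δ v e) :
    SimplicialUpTo (affineFunctions v) e := by
  have hne := hV.nonempty hV.isReflexive.zero_mem_interior
  have hcard : e < Fintype.card ι := by
    have h1 := le_finrank_constOn_add_card v (Finset.univ_nonempty (α := ι))
    rw [hV.constOn_univ hV.isReflexive.zero_mem_interior, finrank_bot, Finset.card_univ] at h1
    have := hV.le
    omega
  refine ⟨hcard, ?_, ?_, ?_⟩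
  · exact exposed_affineFunctions_iff.2 ⟨0, -1, by simp, by simp⟩
  · intro F F' hE hF hsub
    have hli := hV.linearIndependent_of_card_le hE hF
    obtain ⟨w, D, hD, hw⟩ := exists_odd_dual hli
    have hD0 : (D : ℝ) ≠ 0 := by
      rintro h0
      rw [Int.cast_eq_zero] at h0
      simp [h0] at hD
    obtain ⟨n, c, hn0, hn1⟩ := exposed_affineFunctions_iff.1 hE
    -- A linear form which is `1` on the vertices to be removed and `0` on the others.
    let g : Fin d → ℝ := ∑ j : F with j.1 ∉ F', (D : ℝ)⁻¹ • latticePt (w j)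
    have hg : ∀ i ∈ F, latticePt (v i) ⬝ᵥ g = if i ∈ F' then 0 else 1 := by
      intro i hi
      simp only [g, dotProduct_sum, dotProduct_smul, latticePt_dotProduct]
      rw [Finset.sum_congr rfl fun j _ => by rw [hw ⟨i, hi⟩ j]]
      by_cases hiF : i ∈ F'
      · rw [if_pos hiF]
        refine Finset.sum_eq_zero fun j hj => ?_
        rw [if_neg, Int.cast_zero, smul_zero]
        rintro rfl
        exact (Finset.mem_filter.1 hj).2 hiF
      · rw [if_neg hiF, Finset.sum_eq_single ⟨i, hi⟩]
        · simp [hD0]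
        · intro j _ hj
          rw [if_neg hj.symm, Int.cast_zero, smul_zero]
        · intro h
          simp [hiF] at h
    obtain ⟨T, -, hT⟩ := exists_forall_add_mul_pos F (fun i => latticePt (v i) ⬝ᵥ g)
      (fun i => latticePt (v i) ⬝ᵥ n - c) (fun i hi => sub_pos.2 (hn1 i hi))
    refine exposed_affineFunctions_iff.2 ⟨g + T • n, T * c, fun i hi => ?_, fun i hi => ?_⟩
    · rw [dotProduct_add, dotProduct_smul, hg i (hsub hi), if_pos hi, hn0 i (hsub hi), zero_add,
        smul_eq_mul]
    · rw [dotProduct_add, dotProduct_smul, smul_eq_mul]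
      by_cases hiF : i ∈ F
      · rw [hg i hiF, if_neg hi, hn0 i hiF]
        linarith
      · have := hT T le_rfl i hiF
        linarith
  · intro S G u hE hsub hS hvan
    have hle : constOn v (insert u S) ≤ constOn v G := by
      intro x hx i hi j hj
      have h1 : ∀ i ∈ G, latticePt (v i) ⬝ᵥ x - latticePt (v u) ⬝ᵥ x = 0 :=
        hvan (fun i => latticePt (v i) ⬝ᵥ x - latticePt (v u) ⬝ᵥ x) ⟨x, _, fun i => rfl⟩
          fun i hi => by rw [hx i hi u (Finset.mem_insert_self _ _), sub_self]
      linarith [h1 i hi, h1 j hj]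
    have h1 := Submodule.finrank_mono hle
    have h2 := le_finrank_constOn_add_card v (Finset.insert_nonempty u S)
    have h3 := Finset.card_insert_le u S
    have hli := hV.linearIndependent hE (by omega)
    have h4 := finrank_constOn_add_card ((Finset.insert_nonempty u S).mono hsub) hli
    exact (Finset.eq_of_subset_of_card_le hsub (by omega)).symm

lemma IsVertexSystem.mem_normalCone_iff (hV : IsVertexSystem Δ v) {f : Finset ι}
    {n : Fin d → ℝ} : n ∈ normalCone Δ (vertexSet v f) ↔
      ∀ i ∈ f, ∀ k, latticePt (v i) ⬝ᵥ n ≤ latticePt (v k) ⬝ᵥ n := by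
  constructor
  · intro h i hi k
    exact h _ ⟨i, hi, rfl⟩ _ (hV.mem k)
  · rintro h _ ⟨i, hi, rfl⟩ m hm
    exact hV.le_dotProduct (h i hi) hm

lemma IsVertexSystem.mem_normalCone_of_exposing (hV : IsVertexSystem Δ v) {f : Finset ι}
    {n : Fin d → ℝ} {c : ℝ} (h0 : ∀ i ∈ f, latticePt (v i) ⬝ᵥ n = c)
    (h1 : ∀ i ∉ f, c < latticePt (v i) ⬝ᵥ n) : n ∈ normalCone Δ (vertexSet v f) := by
  rw [hV.mem_normalCone_iff]
  intro i hi k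
  rw [h0 i hi]
  by_cases hk : k ∈ f
  · exact (h0 k hk).ge
  · exact (h1 k hk).le

/-- Large multiples of an exposing vector move the linear span of a normal cone into the cone. -/
lemma IsVertexSystem.exists_forall_add_smul_mem (hV : IsVertexSystem Δ v) {f : Finset ι}
    {n : Fin d → ℝ} {c : ℝ} (h0 : ∀ i ∈ f, latticePt (v i) ⬝ᵥ n = c)
    (h1 : ∀ i ∉ f, c < latticePt (v i) ⬝ᵥ n) {x : Fin d → ℝ} (hx : x ∈ constOn v f) :
    ∃ T₀ : ℝ, ∀ T ≥ T₀, x + T • n ∈ normalCone Δ (vertexSet v f) := by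
  rcases f.eq_empty_or_nonempty with rfl | ⟨i₀, hi₀⟩
  · exact ⟨0, fun T _ => hV.mem_normalCone_iff.2 (by simp)⟩
  obtain ⟨T₀, -, hT₀⟩ := exists_forall_add_mul_pos f
    (fun i => latticePt (v i) ⬝ᵥ x - latticePt (v i₀) ⬝ᵥ x)
    (fun i => latticePt (v i) ⬝ᵥ n - c) (fun i hi => sub_pos.2 (h1 i hi))
  refine ⟨T₀, fun T hT => ?_⟩
  refine hV.mem_normalCone_of_exposing (c := latticePt (v i₀) ⬝ᵥ x + T * c) ?_ ?_
  · intro i hi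
    rw [dotProduct_add, dotProduct_smul, smul_eq_mul, h0 i hi, hx i hi i₀ hi₀]
  · intro i hi
    rw [dotProduct_add, dotProduct_smul, smul_eq_mul]
    linarith [hT₀ T hT i hi]

lemma IsVertexSystem.normalCone_subset_constOn (hV : IsVertexSystem Δ v) {f : Finset ι}
    {x : Fin d → ℝ} (hx : x ∈ normalCone Δ (vertexSet v f)) : x ∈ constOn v f := by
  rw [hV.mem_normalCone_iff] at hx
  exact fun i hi j hj => le_antisymm (hx i hi j) (hx j hj i)

lemma IsVertexSystem.coneDim_normalCone (hV : IsVertexSystem Δ v) {f : Finset ι}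
    (hE : Exposed (affineFunctions v) f) :
    coneDim (normalCone Δ (vertexSet v f)) = Module.finrank ℝ (constOn v f) := by
  have h : Submodule.span ℝ (normalCone Δ (vertexSet v f) : Set (Fin d → ℝ)) = constOn v f := by
    refine le_antisymm (Submodule.span_le.2 fun x hx => hV.normalCone_subset_constOn hx) ?_
    intro x hx
    obtain ⟨n, c, h0, h1⟩ := exposed_affineFunctions_iff.1 hE
    obtain ⟨T, hT⟩ := hV.exists_forall_add_smul_mem h0 h1 hx
    rw [← add_sub_cancel_right x (T • n)]
    exact Submodule.sub_mem _ (Submodule.subset_span (hT T le_rfl))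
      (Submodule.smul_mem _ _ (Submodule.subset_span (hV.mem_normalCone_of_exposing h0 h1)))
  rw [coneDim, h]

open Classical in
/-- The vertices at which every vector of `σ` attains its minimum over the polytope: for the normal
cone of a face, the vertices of the face. -/
noncomputable def minVertices (v : ι → Fin d → ℤ) (σ : PointedCone ℝ (Fin d → ℝ)) : Finset ι :=
  Finset.univ.filter fun i => ∀ n ∈ σ, ∀ k, latticePt (v i) ⬝ᵥ n ≤ latticePt (v k) ⬝ᵥ n

lemma IsVertexSystem.minVertices_normalCone (hV : IsVertexSystem Δ v) {f : Finset ι}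
    (hE : Exposed (affineFunctions v) f) (hf : f.Nonempty) :
    minVertices v (normalCone Δ (vertexSet v f)) = f := by
  obtain ⟨n, c, h0, h1⟩ := exposed_affineFunctions_iff.1 hE
  obtain ⟨i₀, hi₀⟩ := hf
  ext i
  simp only [minVertices, Finset.mem_filter, Finset.mem_univ, true_and]
  constructor
  · intro h
    by_contra hi
    have := h n (hV.mem_normalCone_of_exposing h0 h1) i₀
    rw [h0 i₀ hi₀] at this
    linarith [h1 i hi]
  · intro hi x hx k
    exact hV.mem_normalCone_iff.1 hx i hi k

/-- Inclusion of faces reverses to the face relation of their normal cones. -/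
lemma IsVertexSystem.normalCone_isFaceOf_iff (hV : IsVertexSystem Δ v) {f g : Finset ι}
    (hf : Exposed (affineFunctions v) f) (hne : f.Nonempty)
    (hg : g.Nonempty) :
    (normalCone Δ (vertexSet v f)).IsFaceOf (normalCone Δ (vertexSet v g)) ↔ g ⊆ f := by
  constructor
  · intro h i hi
    obtain ⟨n, c, h0, h1⟩ := exposed_affineFunctions_iff.1 hf
    by_contra hif
    have hn := hV.mem_normalCone_iff.1 (h.le (hV.mem_normalCone_of_exposing h0 h1)) i hi
    obtain ⟨j, hj⟩ := hne
    have := hn j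
    rw [h0 j hj] at this
    linarith [h1 i hif]
  · intro hgf
    have hle : normalCone Δ (vertexSet v f) ≤ normalCone Δ (vertexSet v g) := fun x hx =>
      hV.mem_normalCone_iff.2 fun i hi => hV.mem_normalCone_iff.1 hx i (hgf hi)
    refine ⟨hle, fun {x y a} hx hy ha hxy => hV.mem_normalCone_iff.2 fun i hi k => ?_⟩
    obtain ⟨j, hj⟩ := hg
    rw [hV.mem_normalCone_iff] at hx hy hxy
    have h1 := hxy i hi j
    have h2 := hx j hj i
    have h3 := hy j hj i
    have h4 := hx j hj k
    simp only [dotProduct_add, dotProduct_smul, smul_eq_mul] at h1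
    have h5 : a * (latticePt (v i) ⬝ᵥ x) ≤ a * (latticePt (v j) ⬝ᵥ x) := by linarith
    exact (le_of_mul_le_mul_left h5 ha).trans h4

/-- The cones of the normal fan are the normal cones of the sets of vertices of the faces. -/
lemma IsVertexSystem.exists_eq_normalCone (hV : IsVertexSystem Δ v)
    {σ : PointedCone ℝ (Fin d → ℝ)} (hσ : σ ∈ normalFan Δ) :
    ∃ f : Finset ι, f.Nonempty ∧ Exposed (affineFunctions v) f ∧
      σ = normalCone Δ (vertexSet v f) := by
  classical
  obtain ⟨F, ⟨⟨m₀, hm₀⟩, hF⟩, rfl⟩ := hσ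
  obtain ⟨l, rfl⟩ := hF ⟨m₀, hm₀⟩
  let n : Fin d → ℝ := fun j => -l (Pi.single j 1)
  have hl : ∀ m, l m = -(m ⬝ᵥ n) := by
    intro m
    conv_lhs => rw [← Finset.univ_sum_single m]
    simp only [map_sum, dotProduct, n, mul_neg, Finset.sum_neg_distrib, neg_neg]
    refine Finset.sum_congr rfl fun j _ => ?_
    rw [← smul_eq_mul, ← map_smul, ← Pi.single_smul, smul_eq_mul, mul_one]
  obtain ⟨hm₀Δ, hm₀l⟩ := hm₀
  set c := m₀ ⬝ᵥ n with hc
  have hmin : ∀ m ∈ Δ, c ≤ m ⬝ᵥ n := by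
    intro m hm
    have := hm₀l m hm
    rw [hl, hl] at this
    linarith
  let f : Finset ι := Finset.univ.filter fun i => latticePt (v i) ⬝ᵥ n = c
  have h0 : ∀ i ∈ f, latticePt (v i) ⬝ᵥ n = c := fun i hi => (Finset.mem_filter.1 hi).2
  have h1 : ∀ i ∉ f, c < latticePt (v i) ⬝ᵥ n := fun i hi =>
    lt_of_le_of_ne (hmin _ (hV.mem i)) fun h =>
      hi (Finset.mem_filter.2 ⟨Finset.mem_univ _, h.symm⟩)
  have hmemF : ∀ m ∈ Δ, m ⬝ᵥ n = c → m ∈ {x | x ∈ Δ ∧ ∀ y ∈ Δ, l y ≤ l x} := by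
    intro m hm hmc
    refine ⟨hm, fun y hy => ?_⟩
    rw [hl, hl, hmc]
    linarith [hmin y hy]
  have hsub : {x | x ∈ Δ ∧ ∀ y ∈ Δ, l y ≤ l x} ⊆ convexHull ℝ (vertexSet v f) := by
    intro m hm
    refine hV.mem_convexHull_vertexSet h0 h1 hm.1 (le_antisymm ?_ (hmin m hm.1))
    have := hm.2 m₀ hm₀Δ
    rw [hl, hl] at this
    linarith
  refine ⟨f, ?_, exposed_affineFunctions_iff.2 ⟨n, c, h0, h1⟩, ?_⟩
  · have h2 : (vertexSet v f).Nonempty :=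
      convexHull_nonempty_iff.1 ⟨m₀, hsub (hmemF m₀ hm₀Δ rfl)⟩
    exact_mod_cast (Set.image_nonempty.1 h2)
  · ext x
    constructor
    · intro hx
      refine hV.mem_normalCone_iff.2 fun i hi k => ?_
      exact hx _ (hmemF _ (hV.mem i) (h0 i hi)) _ (hV.mem k)
    · intro hx m hm m' hm'
      have hconv : Convex ℝ {m : Fin d → ℝ | m ⬝ᵥ x ≤ m' ⬝ᵥ x} :=
        convex_halfSpace_le ⟨fun y z => add_dotProduct y z x, fun r y => smul_dotProduct r y x⟩ _
      refine convexHull_min ?_ hconv (hsub hm)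
      rintro _ ⟨i, hi, rfl⟩
      exact hx _ ⟨i, hi, rfl⟩ m' hm'

lemma IsVertexSystem.normalCone_mem_normalFan (hV : IsVertexSystem Δ v) {f : Finset ι}
    (hE : Exposed (affineFunctions v) f) (hf : f.Nonempty) :
    normalCone Δ (vertexSet v f) ∈ normalFan Δ := by
  obtain ⟨n, c, h0, h1⟩ := exposed_affineFunctions_iff.1 hE
  obtain ⟨i₀, hi₀⟩ := hf
  have hle : ∀ m ∈ Δ, c ≤ m ⬝ᵥ n := fun m hm => hV.le_dotProduct (fun i => by
    by_cases hi : i ∈ f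
    · exact (h0 i hi).ge
    · exact (h1 i hi).le) hm
  let l : (Fin d → ℝ) →ₗ[ℝ] ℝ :=
    { toFun := fun m => -(m ⬝ᵥ n)
      map_add' := fun x y => by rw [add_dotProduct]; ring
      map_smul' := fun r x => by rw [smul_dotProduct]; simp }
  refine ⟨{m | m ∈ Δ ∧ ∀ y ∈ Δ, l y ≤ l m}, ⟨⟨latticePt (v i₀), hV.mem i₀, fun y hy => ?_⟩,
    fun _ => ⟨LinearMap.toContinuousLinearMap l, rfl⟩⟩, ?_⟩
  · show -(y ⬝ᵥ n) ≤ -(latticePt (v i₀) ⬝ᵥ n)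
    rw [h0 i₀ hi₀]
    linarith [hle y hy]
  · ext x
    constructor
    · rintro hx m ⟨hm, hml⟩ m' hm'
      have hmc : m ⬝ᵥ n = c := by
        refine le_antisymm ?_ (hle m hm)
        have : -(latticePt (v i₀) ⬝ᵥ n) ≤ -(m ⬝ᵥ n) := hml _ (hV.mem i₀)
        rw [h0 i₀ hi₀] at this
        linarith
      have hconv : Convex ℝ {m : Fin d → ℝ | m ⬝ᵥ x ≤ m' ⬝ᵥ x} :=
        convex_halfSpace_le ⟨fun y z => add_dotProduct y z x, fun r y => smul_dotProduct r y x⟩ _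
      refine convexHull_min ?_ hconv (hV.mem_convexHull_vertexSet h0 h1 hm hmc)
      rintro _ ⟨i, hi, rfl⟩
      exact hx _ ⟨i, hi, rfl⟩ m' hm'
    · intro hx
      refine hV.mem_normalCone_iff.2 fun i hi k => hx _ ⟨hV.mem i, fun y hy => ?_⟩ _ (hV.mem k)
      show -(y ⬝ᵥ n) ≤ -(latticePt (v i) ⬝ᵥ n)
      rw [h0 i hi]
      linarith [hle y hy]

/-- The label `f` of a cone of codimension `p < e`: the vertices of the corresponding face. -/
structure IsLabel (Δ : Set (Fin d → ℝ)) (v : ι → Fin d → ℤ) (σ : PointedCone ℝ (Fin d → ℝ))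
    (f : Finset ι) : Prop where
  eq : σ = normalCone Δ (vertexSet v f)
  exposed : Exposed (affineFunctions v) f
  nonempty : f.Nonempty
  ne_univ : f ≠ Finset.univ
  linearIndependent : LinearIndependent (ZMod 2) fun i : f => mod2 (v i)

lemma IsRegularUpTo.isLabel_minVertices (hV : IsRegularUpTo Δ v e) {p : ℤ} (hp : p + 1 ≤ e)
    (σ : ConesOfCodim (normalFan Δ) p) :
    IsLabel Δ v σ.1 (minVertices v σ.1) ∧ ((minVertices v σ.1).card : ℤ) = p + 1 := by
  obtain ⟨σ, hσ, hdim⟩ := σ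
  obtain ⟨f, hf, hE, rfl⟩ := hV.exists_eq_normalCone hσ
  rw [hV.coneDim_normalCone hE] at hdim
  have h1 : d + 1 ≤ Module.finrank ℝ (constOn v f) + e := by omega
  have hli := hV.linearIndependent hE h1
  have h2 := finrank_constOn_add_card hf hli
  simp only [hV.minVertices_normalCone hE hf]
  exact ⟨⟨rfl, hE, hf, hV.ne_univ h1, hli⟩, by omega⟩

lemma IsRegularUpTo.exists_minVertices_eq (hV : IsRegularUpTo Δ v e) {p : ℤ} (hp : p + 1 ≤ e)
    {f : Finset ι} (hE : Exposed (affineFunctions v) f) (hf : f.Nonempty)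
    (hcard : (f.card : ℤ) = p + 1) :
    ∃ σ : ConesOfCodim (normalFan Δ) p, minVertices v σ.1 = f := by
  have hli := hV.linearIndependent_of_card_le hE (by omega)
  have h2 := finrank_constOn_add_card hf hli
  refine ⟨⟨normalCone Δ (vertexSet v f), hV.normalCone_mem_normalFan hE hf, ?_⟩,
    hV.minVertices_normalCone hE hf⟩
  rw [hV.coneDim_normalCone hE]
  omega

lemma IsRegularUpTo.minVertices_injective (hV : IsRegularUpTo Δ v e) {p : ℤ} (hp : p + 1 ≤ e) :
    Function.Injective fun σ : ConesOfCodim (normalFan Δ) p => minVertices v σ.1 := by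
  intro σ τ h
  apply Subtype.ext
  rw [(hV.isLabel_minVertices hp σ).1.eq, (hV.isLabel_minVertices hp τ).1.eq]
  simp only at h
  rw [h]

lemma IsLabel.isFaceOf_iff (hV : IsVertexSystem Δ v) {σ τ : PointedCone ℝ (Fin d → ℝ)}
    {f g : Finset ι} (hσ : IsLabel Δ v σ f) (hτ : IsLabel Δ v τ g) : σ.IsFaceOf τ ↔ g ⊆ f := by
  rw [hσ.eq, hτ.eq]
  exact hV.normalCone_isFaceOf_iff hσ.exposed hσ.nonempty hτ.nonempty

lemma IsLabel.dotProduct_eq (hV : IsVertexSystem Δ v) {σ : PointedCone ℝ (Fin d → ℝ)}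
    {f : Finset ι} (hσ : IsLabel Δ v σ f) {n : Fin d → ℤ} (hn : latticePt n ∈ σ) {i j : ι}
    (hi : i ∈ f) (hj : j ∈ f) : v i ⬝ᵥ n = v j ⬝ᵥ n := by
  rw [hσ.eq] at hn
  have := hV.normalCone_subset_constOn hn i hi j hj
  rw [latticePt_dotProduct, latticePt_dotProduct] at this
  exact_mod_cast this

/-- A lattice vector on which the vertices of a face agree can be moved into the normal cone by
adding an even multiple of a lattice vector of the cone. -/
lemma IsLabel.exists_add_mem (hV : IsVertexSystem Δ v) (hΔ : IsReflexive Δ)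
    {σ : PointedCone ℝ (Fin d → ℝ)}
    {f : Finset ι} (hσ : IsLabel Δ v σ f) {n : Fin d → ℤ}
    (hn : ∀ i ∈ f, ∀ j ∈ f, v i ⬝ᵥ n = v j ⬝ᵥ n) :
    ∃ (n₀ : Fin d → ℤ) (k : ℤ), latticePt n₀ ∈ σ ∧ latticePt (n + (2 * k) • n₀) ∈ σ := by
  obtain ⟨⟨n₀, J, h0, h1⟩, -⟩ := hV.exists_lattice_exposing hΔ hσ.nonempty hσ.ne_univ hσ.exposed
  have h0' : ∀ i ∈ f, latticePt (v i) ⬝ᵥ latticePt n₀ = (J : ℝ) := fun i hi => by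
    rw [latticePt_dotProduct, h0 i hi]
  have h1' : ∀ i ∉ f, (J : ℝ) < latticePt (v i) ⬝ᵥ latticePt n₀ := fun i hi => by
    rw [latticePt_dotProduct]; exact_mod_cast h1 i hi
  obtain ⟨T, hT⟩ := hV.exists_forall_add_smul_mem h0' h1' (x := latticePt n) fun i hi j hj => by
    rw [latticePt_dotProduct, latticePt_dotProduct, hn i hi j hj]
  refine ⟨n₀, max ⌈T⌉ 0, ?_, ?_⟩
  · rw [hσ.eq]; exact hV.mem_normalCone_of_exposing h0' h1'
  · rw [hσ.eq, latticePt_add, latticePt_smul]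
    refine hT _ ?_
    have h2 : T ≤ (⌈T⌉ : ℝ) := Int.le_ceil T
    have h3 : (⌈T⌉ : ℝ) ≤ ((max ⌈T⌉ 0 : ℤ) : ℝ) := by exact_mod_cast le_max_left _ _
    have h4 : (0 : ℝ) ≤ ((max ⌈T⌉ 0 : ℤ) : ℝ) := by exact_mod_cast le_max_right _ _
    push_cast at h3 h4 ⊢
    linarith

/-- The lattice of a normal cone consists of the lattice vectors on which the vertices of the face
agree. -/
lemma IsLabel.mem_coneLattice_iff (hV : IsVertexSystem Δ v) (hΔ : IsReflexive Δ)
    {σ : PointedCone ℝ (Fin d → ℝ)} {f : Finset ι} (hσ : IsLabel Δ v σ f) {n : Fin d → ℤ} :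
    n ∈ coneLattice σ ↔ ∀ i ∈ f, ∀ j ∈ f, v i ⬝ᵥ n = v j ⬝ᵥ n := by
  constructor
  · intro h i hi j hj
    induction h using AddSubgroup.closure_induction with
    | mem x hx => exact hσ.dotProduct_eq hV hx hi hj
    | zero => simp
    | add x y _ _ hx hy => rw [dotProduct_add, dotProduct_add, hx, hy]
    | neg x _ hx => rw [dotProduct_neg, dotProduct_neg, hx]
  · intro h
    obtain ⟨n₀, k, h0, h1⟩ := hσ.exists_add_mem hV hΔ h
    rw [← add_sub_cancel_right n ((2 * k) • n₀)]
    have h0' : n₀ ∈ coneLattice σ := AddSubgroup.subset_closure h0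
    exact AddSubgroup.sub_mem _ (AddSubgroup.subset_closure h1) (AddSubgroup.zsmul_mem _ h0' _)

/-- A class modulo 2 on which the vertices of the face agree is represented by a lattice point of
the normal cone. -/
lemma IsLabel.exists_mod2_eq (hV : IsVertexSystem Δ v) (hΔ : IsReflexive Δ)
    {σ : PointedCone ℝ (Fin d → ℝ)} {f : Finset ι} (hσ : IsLabel Δ v σ f) {x : Fin d → ZMod 2}
    (hx : ∀ i ∈ f, ∀ j ∈ f, mod2 (v i) ⬝ᵥ x = mod2 (v j) ⬝ᵥ x) :
    ∃ n, latticePt n ∈ σ ∧ mod2 n = x := by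
  obtain ⟨w, D, hD, hw⟩ := exists_odd_dual hσ.linearIndependent
  obtain ⟨i₀, hi₀⟩ := hσ.nonempty
  obtain ⟨m, rfl⟩ := mod2_surjective x
  have hD2 : (D : ZMod 2) = 1 := by
    obtain ⟨k, rfl⟩ := hD
    push_cast
    rw [show (2 : ZMod 2) = 0 from rfl, zero_mul, zero_add]
  have hy : ∀ i : f, ∃ y, v i ⬝ᵥ m - v i₀ ⬝ᵥ m = 2 * y := by
    intro i
    rw [← intCast_zmod2_eq_zero]
    push_cast
    rw [← mod2_dotProduct, ← mod2_dotProduct, hx i i.2 i₀ hi₀, sub_self]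
  choose y hy using hy
  -- The deviations `2 * y i` of `D • m` from a vector with equal values are corrected by even
  -- multiples of the dual vectors.
  let n : Fin d → ℤ := D • m - ∑ j : f, (2 * y j) • w j
  have hn : ∀ i ∈ f, v i ⬝ᵥ n = D * (v i₀ ⬝ᵥ m) := by
    intro i hi
    have h1 := hy ⟨i, hi⟩
    simp only [n, dotProduct_sub, dotProduct_smul, dotProduct_sum, smul_eq_mul]
    rw [Finset.sum_congr rfl fun j _ => by rw [hw ⟨i, hi⟩ j]]
    simp only [mul_ite, mul_zero, Finset.sum_ite_eq, Finset.mem_univ, if_true]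
    linear_combination D * h1
  obtain ⟨n₀, k, -, hk⟩ := hσ.exists_add_mem hV hΔ (n := n) fun i hi j hj => by rw [hn i hi, hn j hj]
  refine ⟨_, hk, ?_⟩
  have h2 : ((2 : ℤ) : ZMod 2) = 0 := rfl
  have h3 : mod2 (∑ j : f, (2 * y j) • w j) = 0 := by
    funext l
    simp only [mod2, Finset.sum_apply, Pi.smul_apply, smul_eq_mul, Int.cast_sum, Int.cast_mul, h2,
      zero_mul, Finset.sum_const_zero, Pi.zero_apply]
  rw [mod2_add, mod2_smul, mod2_sub, mod2_smul, h3, hD2, Int.cast_mul, h2, zero_mul, zero_smul,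
    one_smul, sub_zero, add_zero]

lemma IsLabel.mem_coneMod2_iff (hV : IsVertexSystem Δ v) (hΔ : IsReflexive Δ)
    {σ : PointedCone ℝ (Fin d → ℝ)} {f : Finset ι} (hσ : IsLabel Δ v σ f) {x : Fin d → ZMod 2} :
    x ∈ coneMod2 σ ↔ ∀ i ∈ f, ∀ j ∈ f, mod2 (v i) ⬝ᵥ x = mod2 (v j) ⬝ᵥ x := by
  constructor
  · intro h i hi j hj
    induction h using Submodule.span_induction with
    | mem x hx =>
      obtain ⟨n, hn, rfl⟩ := hx
      rw [mod2_dotProduct, mod2_dotProduct, hσ.dotProduct_eq hV hn hi hj]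
    | zero => simp
    | add x y _ _ hx hy => rw [dotProduct_add, dotProduct_add, hx, hy]
    | smul a x _ hx => rw [dotProduct_smul, dotProduct_smul, hx]
  · intro h
    obtain ⟨n, hn, rfl⟩ := hσ.exists_mod2_eq hV hΔ h
    exact Submodule.subset_span ⟨n, hn, rfl⟩

end Cones

/-! ### The stalks of the cosheaves -/

section Stalks

variable {d : ℕ} {ι : Type*} [Fintype ι] [LinearOrder ι] {Δ : Set (Fin d → ℝ)} {v : ι → Fin d → ℤ}
  {e : ℕ} {σ τ : PointedCone ℝ (Fin d → ℝ)}

lemma IsLabel.exists_dual {f : Finset ι} (hσ : IsLabel Δ v σ f) (a : ι) :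
    ∃ x : Fin d → ZMod 2, ∀ b ∈ f, mod2 (v b) ⬝ᵥ x = if b = a then 1 else 0 := by
  obtain ⟨w, D, hD, hw⟩ := exists_odd_dual hσ.linearIndependent
  have hD2 : (D : ZMod 2) = 1 := by
    obtain ⟨k, rfl⟩ := hD
    push_cast
    rw [show (2 : ZMod 2) = 0 from rfl, zero_mul, zero_add]
  by_cases ha : a ∈ f
  · refine ⟨mod2 (w ⟨a, ha⟩), fun b hb => ?_⟩
    rw [mod2_dotProduct, hw ⟨b, hb⟩ ⟨a, ha⟩]
    by_cases hba : b = a <;> simp [hba, hD2]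
  · refine ⟨0, fun b hb => ?_⟩
    rw [dotProduct_zero, if_neg]
    rintro rfl
    exact ha hb

/-- A vector in `N / 2N` on which the vertex `a` has value `1` and the other vertices in `f` have
value `0`. -/
noncomputable def dualVec (v : ι → Fin d → ℤ) (f : Finset ι) (a : ι) : Fin d → ZMod 2 :=
  Classical.epsilon fun x => ∀ b ∈ f, mod2 (v b) ⬝ᵥ x = if b = a then 1 else 0

lemma IsLabel.dotProduct_dualVec {f : Finset ι} (hσ : IsLabel Δ v σ f) (a : ι) {b : ι}
    (hb : b ∈ f) : mod2 (v b) ⬝ᵥ dualVec v f a = if b = a then 1 else 0 :=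
  Classical.epsilon_spec (hσ.exists_dual a) b hb

/-- The generators of the stalk `E_σ` of a cone corresponding to a simplex: the classes of the dual
vectors of its vertices. -/
noncomputable def stalkGen (v : ι → Fin d → ℤ) (σ : PointedCone ℝ (Fin d → ℝ)) (a : ι) :
    stalkE σ :=
  if a ∈ minVertices v σ then (coneMod2 σ).mkQ (dualVec v (minVertices v σ) a) else 0

lemma IsLabel.isSimplexFrame (hV : IsVertexSystem Δ v) (hΔ : IsReflexive Δ)
    (hσ : IsLabel Δ v σ (minVertices v σ)) :
    IsSimplexFrame (stalkGen v σ) (minVertices v σ) := by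
  set f := minVertices v σ with hf
  have hin : ∀ a ∈ f, stalkGen v σ a = (coneMod2 σ).mkQ (dualVec v f a) := fun a ha => if_pos ha
  have hout : ∀ a ∉ f, stalkGen v σ a = 0 := fun a ha => if_neg ha
  refine ⟨hout, ?_, ?_, ?_⟩
  · rw [← Finset.sum_subset (Finset.subset_univ f) fun a _ ha => hout a ha,
      Finset.sum_congr rfl hin, ← map_sum, Submodule.mkQ_apply, Submodule.Quotient.mk_eq_zero,
      hσ.mem_coneMod2_iff hV hΔ]
    have h1 : ∀ i ∈ f, mod2 (v i) ⬝ᵥ ∑ a ∈ f, dualVec v f a = 1 := by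
      intro i hi
      rw [dotProduct_sum, Finset.sum_congr rfl fun a _ => hσ.dotProduct_dualVec a hi,
        Finset.sum_ite_eq, if_pos hi]
    intro i hi j hj
    rw [h1 i hi, h1 j hj]
  · rw [eq_top_iff]
    rintro x -
    obtain ⟨x, rfl⟩ := Submodule.mkQ_surjective _ x
    have h1 : (coneMod2 σ).mkQ x =
        ∑ a ∈ f, (mod2 (v a) ⬝ᵥ x) • (coneMod2 σ).mkQ (dualVec v f a) := by
      rw [← sub_eq_zero]
      simp only [← map_smul]
      rw [← map_sum, ← map_sub, Submodule.mkQ_apply, Submodule.Quotient.mk_eq_zero,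
        hσ.mem_coneMod2_iff hV hΔ]
      have h2 : ∀ i ∈ f, mod2 (v i) ⬝ᵥ (x - ∑ a ∈ f, (mod2 (v a) ⬝ᵥ x) • dualVec v f a) = 0 := by
        intro i hi
        rw [dotProduct_sub, dotProduct_sum, Finset.sum_congr rfl fun a _ => by
          rw [dotProduct_smul, hσ.dotProduct_dualVec a hi, smul_eq_mul, mul_ite, mul_one, mul_zero],
          Finset.sum_ite_eq, if_pos hi, sub_self]
      intro i hi j hj
      rw [h2 i hi, h2 j hj]
    rw [h1]
    refine Submodule.sum_mem _ fun a ha => Submodule.smul_mem _ _ (Submodule.subset_span ⟨a, ?_⟩)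
    exact hin a ha
  · intro i₀ hi₀
    rw [Fintype.linearIndependent_iff]
    intro c hc b
    have hmem : ∀ a : ((f.erase i₀ : Finset ι) : Set ι), (a : ι) ∈ f := fun a =>
      Finset.mem_of_mem_erase a.2
    rw [Finset.sum_congr rfl fun a _ => by rw [hin a (hmem a), ← map_smul], ← map_sum,
      Submodule.mkQ_apply, Submodule.Quotient.mk_eq_zero, hσ.mem_coneMod2_iff hV hΔ] at hc
    have h1 : ∀ i ∈ f, mod2 (v i) ⬝ᵥ (∑ a, c a • dualVec v f (a : ι)) =
        ∑ a : ((f.erase i₀ : Finset ι) : Set ι), if i = (a : ι) then c a else 0 := by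
      intro i hi
      rw [dotProduct_sum]
      refine Finset.sum_congr rfl fun a _ => ?_
      rw [dotProduct_smul, hσ.dotProduct_dualVec _ hi, smul_eq_mul, mul_ite, mul_one, mul_zero]
    have h2 := hc b (hmem b) i₀ hi₀
    rw [h1 b (hmem b), h1 i₀ hi₀, Finset.sum_eq_single b, if_pos rfl, Finset.sum_eq_zero] at h2
    · exact h2
    · intro a _
      rw [if_neg]
      exact fun h => (Finset.mem_erase.1 a.2).1 h.symm
    · intro a _ hab
      rw [if_neg]
      exact fun h => hab (Subtype.ext h.symm)
    · simp

lemma resE_stalkGen (hV : IsVertexSystem Δ v) (hΔ : IsReflexive Δ)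
    (hσ : IsLabel Δ v σ (minVertices v σ)) (hτ : IsLabel Δ v τ (minVertices v τ))
    (h : σ.IsFaceOf τ) (a : ι) :
    resE h (stalkGen v σ a) = stalkGen v τ a := by
  have hsub := (hσ.isFaceOf_iff hV hτ).1 h
  by_cases haτ : a ∈ minVertices v τ
  · rw [stalkGen, if_pos (hsub haτ), stalkGen, if_pos haτ]
    show (coneMod2 τ).mkQ (dualVec v (minVertices v σ) a) = _
    rw [← sub_eq_zero, ← map_sub, Submodule.mkQ_apply, Submodule.Quotient.mk_eq_zero,
      hτ.mem_coneMod2_iff hV hΔ]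
    intro i hi j hj
    simp only [dotProduct_sub, hσ.dotProduct_dualVec a (hsub hi), hσ.dotProduct_dualVec a (hsub hj),
      hτ.dotProduct_dualVec a hi, hτ.dotProduct_dualVec a hj, sub_self]
  · rw [show stalkGen v τ a = 0 from if_neg haτ]
    by_cases haσ : a ∈ minVertices v σ
    · rw [stalkGen, if_pos haσ]
      show (coneMod2 τ).mkQ (dualVec v (minVertices v σ) a) = _
      rw [Submodule.mkQ_apply, Submodule.Quotient.mk_eq_zero, hτ.mem_coneMod2_iff hV hΔ]
      have h1 : ∀ i ∈ minVertices v τ, mod2 (v i) ⬝ᵥ dualVec v (minVertices v σ) a = 0 := by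
        intro i hi
        rw [hσ.dotProduct_dualVec a (hsub hi), if_neg]
        rintro rfl
        exact haτ hi
      intro i hi j hj
      rw [h1 i hi, h1 j hj]
    · rw [stalkGen, if_neg haσ, map_zero]

/-- The exterior product of the generators of `E_σ` labelled by `A`, in the stalk `⋀^q E_σ`. -/
noncomputable def extStalkGen (v : ι → Fin d → ℤ) (q : ℕ) (σ : PointedCone ℝ (Fin d → ℝ))
    (A : Finset ι) : ExtStalk q σ :=
  extGen q (stalkGen v σ) A

lemma extRes_extStalkGen (hV : IsVertexSystem Δ v) (hΔ : IsReflexive Δ)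
    (hσ : IsLabel Δ v σ (minVertices v σ)) (hτ : IsLabel Δ v τ (minVertices v τ))
    (h : σ.IsFaceOf τ) (q : ℕ) (A : Finset ι) :
    extRes q h (extStalkGen v q σ A) = extStalkGen v q τ A := by
  refine (map_extGen q (resE h) (stalkGen v σ) A).trans ?_
  simp only [resE_stalkGen hV hΔ hσ hτ h]
  rfl

lemma extStalkGen_eq_zero (hV : IsVertexSystem Δ v) (hΔ : IsReflexive Δ)
    (hσ : IsLabel Δ v σ (minVertices v σ)) (q : ℕ) {A : Finset ι}
    (hA : ¬ A ⊆ minVertices v σ) : extStalkGen v q σ A = 0 :=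
  (hσ.isSimplexFrame hV hΔ).extGen_eq_zero hA

lemma exists_eq_sum_extStalkGen (hV : IsVertexSystem Δ v) (hΔ : IsReflexive Δ)
    (hσ : IsLabel Δ v σ (minVertices v σ)) {q : ℕ} (ω : ExtStalk q σ) :
    ∃ c : Finset ι → ZMod 2, (∀ A, c A ≠ 0 → A.card = q ∧ A ⊆ minVertices v σ) ∧
      ω = ∑ A, c A • extStalkGen v q σ A :=
  (hσ.isSimplexFrame hV hΔ).exists_eq_sum ω

lemma exists_coboundary_of_sum_extStalkGen_eq_zero (hV : IsVertexSystem Δ v) (hΔ : IsReflexive Δ)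
    (hσ : IsLabel Δ v σ (minVertices v σ)) {q : ℕ} {c : Finset ι → ZMod 2}
    (hc : ∀ A, c A ≠ 0 → A.card = q ∧ A ⊆ minVertices v σ)
    (h0 : ∑ A, c A • extStalkGen v q σ A = 0) :
    ∃ b : Finset ι → ZMod 2, (∀ B, b B ≠ 0 → B.card + 1 = q ∧ B ⊆ minVertices v σ) ∧
      ∀ A ⊆ minVertices v σ, c A = ∑ a ∈ A, b (A.erase a) :=
  (hσ.isSimplexFrame hV hΔ).exists_coboundary hσ.nonempty hc h0

lemma sum_coboundary_smul_extStalkGen (hV : IsVertexSystem Δ v) (hΔ : IsReflexive Δ)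
    (hσ : IsLabel Δ v σ (minVertices v σ)) (q : ℕ) (b : Finset ι → ZMod 2) :
    ∑ A, (∑ a ∈ A, b (A.erase a)) • extStalkGen v q σ A = 0 :=
  sum_coboundary_smul_extGen (hσ.isSimplexFrame hV hΔ).sum_eq_zero b

lemma extStalk_eq_zero_of_card_eq (hV : IsVertexSystem Δ v) (hΔ : IsReflexive Δ)
    (hσ : IsLabel Δ v σ (minVertices v σ)) {q : ℕ} (hq : (minVertices v σ).card = q)
    (ω : ExtStalk q σ) : ω = 0 :=
  (hσ.isSimplexFrame hV hΔ).eq_zero_of_card_eq hq hσ.nonempty ω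

lemma exists_dual_extStalk (hV : IsVertexSystem Δ v) (hΔ : IsReflexive Δ)
    (hσ : IsLabel Δ v σ (minVertices v σ)) {q : ℕ} (hq : (minVertices v σ).card = q + 1) :
    ∃ ε : ExtStalk q σ →ₗ[ZMod 2] ZMod 2,
      (∀ A ⊆ minVertices v σ, A.card = q → ε (extStalkGen v q σ A) = 1) ∧
      ∀ ω, ε ω = 0 → ω = 0 :=
  (hσ.isSimplexFrame hV hΔ).exists_dual hq

end Stalks

/-! ### Chains, and vanishing below the diagonal -/

section Chains

variable {d : ℕ} {Sig : Set (PointedCone ℝ (Fin d → ℝ))} {q : ℕ} {p p' : ℤ}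

open Classical in
lemma boundary_summand [Fintype (ConesOfCodim Sig p')] (σ : ConesOfCodim Sig p)
    (ω : ExtStalk q σ.1) :
    boundary Sig q p p' (summand Sig q p σ ω) =
      ∑ τ : ConesOfCodim Sig p',
        if h : σ.1.IsFaceOf τ.1 then summand Sig q p' τ (extRes q h ω) else 0 := by
  rw [boundary, summand, DirectSum.toModule_lof, finsum_eq_sum_of_fintype, LinearMap.sum_apply]
  refine Finset.sum_congr rfl fun τ _ => ?_
  by_cases h : σ.1.IsFaceOf τ.1
  · simp only [h, dif_pos]; rfl
  · simp only [h, dif_neg, not_false_iff, LinearMap.zero_apply]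

lemma summand_apply_self (σ : ConesOfCodim Sig p) (ω : ExtStalk q σ.1) :
    (summand Sig q p σ ω) σ = ω := by
  classical
  exact DirectSum.lof_apply _ _ _

lemma summand_apply_of_ne {σ τ : ConesOfCodim Sig p} (h : τ ≠ σ) (ω : ExtStalk q σ.1) :
    (summand Sig q p σ ω) τ = 0 := by
  classical
  exact DirectSum.of_eq_of_ne _ _ _ h

lemma sum_summand_apply [Fintype (ConesOfCodim Sig p)]
    (ω : ∀ σ : ConesOfCodim Sig p, ExtStalk q σ.1) (τ : ConesOfCodim Sig p) :
    (∑ σ, summand Sig q p σ (ω σ)) τ = ω τ := by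
  rw [DirectSum.sum_apply, Finset.sum_eq_single τ, summand_apply_self]
  · intro σ _ h
    exact summand_apply_of_ne h.symm _
  · simp

lemma sum_summand [Fintype (ConesOfCodim Sig p)] (z : Chains Sig q p) :
    ∑ σ, summand Sig q p σ (z σ) = z := by
  ext τ : 1
  exact sum_summand_apply _ τ

variable {ι : Type*} [Fintype ι] [LinearOrder ι] {Δ : Set (Fin d → ℝ)} {v : ι → Fin d → ℤ} {e : ℕ}

/-- The chain of the cosheaf complex with coefficients `c` with respect to the exterior products of
the generators of the stalks. -/
noncomputable def chainOf (v : ι → Fin d → ℤ) (Sig : Set (PointedCone ℝ (Fin d → ℝ))) (q : ℕ)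
    (p : ℤ) [Fintype (ConesOfCodim Sig p)] (c : Finset ι → Finset ι → ZMod 2) : Chains Sig q p :=
  ∑ σ, summand Sig q p σ (∑ A, c (minVertices v σ.1) A • extStalkGen v q σ.1 A)

lemma chainOf_apply [Fintype (ConesOfCodim Sig p)] (c : Finset ι → Finset ι → ZMod 2)
    (σ : ConesOfCodim Sig p) :
    chainOf v Sig q p c σ = ∑ A, c (minVertices v σ.1) A • extStalkGen v q σ.1 A :=
  sum_summand_apply _ σ

lemma chainOf_add [Fintype (ConesOfCodim Sig p)] (b c : Finset ι → Finset ι → ZMod 2) :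
    chainOf v Sig q p (b + c) = chainOf v Sig q p b + chainOf v Sig q p c := by
  simp only [chainOf, Pi.add_apply, add_smul, Finset.sum_add_distrib, map_add]

lemma IsRegularUpTo.finite_cones (hV : IsRegularUpTo Δ v e) (hp : p + 1 ≤ e) :
    Finite (ConesOfCodim (normalFan Δ) p) :=
  Finite.of_injective _ (hV.minVertices_injective hp)

lemma IsRegularUpTo.chainOf_vd (hV : IsRegularUpTo Δ v e) (hp : p + 1 ≤ e)
    [Fintype (ConesOfCodim (normalFan Δ) p)] (b : Finset ι → Finset ι → ZMod 2) :
    chainOf v (normalFan Δ) q p (vd b) = 0 := by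
  ext σ : 1
  have hσ := (hV.isLabel_minVertices hp σ).1
  rw [chainOf_apply]
  refine Eq.trans ?_ (sum_coboundary_smul_extStalkGen hV.toIsVertexSystem hV.isReflexive hσ q
    (b (minVertices v σ.1)))
  refine Finset.sum_congr rfl fun A _ => ?_
  by_cases hA : A ⊆ minVertices v σ.1
  · simp only [vd, hA, if_true]
  · rw [extStalkGen_eq_zero hV.toIsVertexSystem hV.isReflexive hσ q hA, smul_zero, smul_zero]

/-- Chains whose labelled coefficients represent zero are vertical boundaries. -/
lemma IsRegularUpTo.exists_eq_vd (hV : IsRegularUpTo Δ v e) (hp : p + 1 ≤ e) (hp0 : 0 ≤ p)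
    [Fintype (ConesOfCodim (normalFan Δ) p)] {c : Finset ι → Finset ι → ZMod 2}
    (hc : IsBichain (affineFunctions v) (p + 1) q c) (h0 : chainOf v (normalFan Δ) q p c = 0) :
    ∃ b, IsBichain (affineFunctions v) (p + 1) (q - 1) b ∧ c = vd b := by
  classical
  have hex : ∀ σ : ConesOfCodim (normalFan Δ) p, ∃ b : Finset ι → ZMod 2,
      (∀ B, b B ≠ 0 → B.card + 1 = q ∧ B ⊆ minVertices v σ.1) ∧
      ∀ A ⊆ minVertices v σ.1, c (minVertices v σ.1) A = ∑ a ∈ A, b (A.erase a) := by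
    intro σ
    have hσ := (hV.isLabel_minVertices hp σ).1
    refine exists_coboundary_of_sum_extStalkGen_eq_zero hV.toIsVertexSystem hV.isReflexive hσ
      (fun A hA => ?_) (by rw [← chainOf_apply, h0]; rfl)
    obtain ⟨-, -, h2, h3⟩ := hc _ _ hA
    exact ⟨by exact_mod_cast h2, h3⟩
  choose b hb hbc using hex
  have hinj := hV.minVertices_injective hp
  let b' : Finset ι → Finset ι → ZMod 2 := fun F B =>
    ∑ σ : ConesOfCodim (normalFan Δ) p, if minVertices v σ.1 = F then b σ B else 0
  have hb' : ∀ σ B, b' (minVertices v σ.1) B = b σ B := by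
    intro σ B
    simp only [b']
    rw [Finset.sum_eq_single σ, if_pos rfl]
    · intro τ _ h
      rw [if_neg fun h' => h (hinj h')]
    · simp
  have hb'0 : ∀ F B, b' F B ≠ 0 → ∃ σ : ConesOfCodim (normalFan Δ) p, minVertices v σ.1 = F := by
    intro F B h
    obtain ⟨σ, -, hσ⟩ := Finset.exists_ne_zero_of_sum_ne_zero h
    exact ⟨σ, by by_contra h'; exact hσ (if_neg h')⟩
  refine ⟨b', ?_, ?_⟩
  · intro F B h
    obtain ⟨σ, rfl⟩ := hb'0 F B h
    rw [hb'] at h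
    obtain ⟨h1, h2⟩ := hb σ B h
    obtain ⟨h3, h4⟩ := hV.isLabel_minVertices hp σ
    exact ⟨h3.exposed, h4, by omega, h2⟩
  · funext F A
    by_cases hAF : A ⊆ F
    swap
    · rw [vd, if_neg hAF]
      by_contra h
      exact hAF (hc F A h).2.2.2
    rw [vd, if_pos hAF]
    by_cases hF : ∃ σ : ConesOfCodim (normalFan Δ) p, minVertices v σ.1 = F
    · obtain ⟨σ, rfl⟩ := hF
      simp only [hb']
      exact hbc σ A hAF
    · rw [Finset.sum_eq_zero fun a _ => by_contra fun h => hF (hb'0 F _ h)]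
      by_contra h
      obtain ⟨h1, h2, -, -⟩ := hc F A h
      exact hF (hV.exists_minVertices_eq hp h1 (Finset.card_pos.1 (by omega)) h2)

lemma IsRegularUpTo.exists_eq_chainOf (hV : IsRegularUpTo Δ v e) (hp : p + 1 ≤ e)
    [Fintype (ConesOfCodim (normalFan Δ) p)] (z : Chains (normalFan Δ) q p) :
    ∃ c, IsBichain (affineFunctions v) (p + 1) q c ∧ z = chainOf v (normalFan Δ) q p c := by
  classical
  have hex := fun σ : ConesOfCodim (normalFan Δ) p => exists_eq_sum_extStalkGen
    hV.toIsVertexSystem hV.isReflexive (hV.isLabel_minVertices hp σ).1 (z σ)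
  choose b hb hbz using hex
  have hinj := hV.minVertices_injective hp
  let c : Finset ι → Finset ι → ZMod 2 := fun F A =>
    ∑ σ : ConesOfCodim (normalFan Δ) p, if minVertices v σ.1 = F then b σ A else 0
  have hc : ∀ σ A, c (minVertices v σ.1) A = b σ A := by
    intro σ A
    simp only [c]
    rw [Finset.sum_eq_single σ, if_pos rfl]
    · intro τ _ h
      rw [if_neg fun h' => h (hinj h')]
    · simp
  refine ⟨c, ?_, ?_⟩
  · intro F A h
    obtain ⟨σ, -, hσ⟩ := Finset.exists_ne_zero_of_sum_ne_zero h
    obtain rfl : minVertices v σ.1 = F := by by_contra h'; exact hσ (if_neg h')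
    rw [hc] at h
    obtain ⟨h1, h2⟩ := hb σ A h
    obtain ⟨h3, h4⟩ := hV.isLabel_minVertices hp σ
    exact ⟨h3.exposed, h4, by exact_mod_cast h1, h2⟩
  · ext σ : 1
    rw [chainOf_apply, hbz σ]
    simp only [hc]

/-- Sums over the cones of codimension `p` are sums over the faces with `p + 1` vertices. -/
lemma IsRegularUpTo.sum_minVertices (hV : IsRegularUpTo Δ v e) (hp : p + 1 ≤ e) (hp0 : 0 ≤ p)
    [Fintype (ConesOfCodim (normalFan Δ) p)] {M : Type*} [AddCommMonoid M] (φ : Finset ι → M)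
    (hφ : ∀ F, φ F ≠ 0 → Exposed (affineFunctions v) F ∧ (F.card : ℤ) = p + 1) :
    ∑ σ : ConesOfCodim (normalFan Δ) p, φ (minVertices v σ.1) = ∑ F, φ F := by
  classical
  rw [← Finset.sum_image (f := φ) ((hV.minVertices_injective hp).injOn)]
  refine Finset.sum_subset (Finset.subset_univ _) fun F _ hF => ?_
  by_contra h
  obtain ⟨h1, h2⟩ := hφ F h
  obtain ⟨σ, hσ⟩ := hV.exists_minVertices_eq hp h1 (Finset.card_pos.1 (by omega)) h2
  exact hF (Finset.mem_image.2 ⟨σ, Finset.mem_univ _, hσ⟩)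

/-- The boundary of the cosheaf complex is induced by the horizontal differential. -/
lemma IsRegularUpTo.boundary_chainOf (hV : IsRegularUpTo Δ v e) (hp : p + 1 ≤ e) (hp0 : 0 ≤ p)
    (hpp' : p' + 1 = p) [Fintype (ConesOfCodim (normalFan Δ) p)]
    [Fintype (ConesOfCodim (normalFan Δ) p')] {c : Finset ι → Finset ι → ZMod 2}
    (hc : IsBichain (affineFunctions v) (p + 1) q c) :
    boundary (normalFan Δ) q p p' (chainOf v (normalFan Δ) q p c) =
      chainOf v (normalFan Δ) q p' (hd c) := by
  classical
  have hVs := hV.toIsVertexSystem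
  have hR := hV.isReflexive
  rw [chainOf, map_sum]
  simp only [boundary_summand]
  rw [Finset.sum_comm, chainOf]
  refine Finset.sum_congr rfl fun τ _ => ?_
  obtain ⟨hτ, hτc⟩ := hV.isLabel_minVertices (by omega) τ
  have hterm : ∀ σ : ConesOfCodim (normalFan Δ) p,
      (if h : σ.1.IsFaceOf τ.1 then summand (normalFan Δ) q p' τ
        (extRes q h (∑ A, c (minVertices v σ.1) A • extStalkGen v q σ.1 A)) else 0) =
      summand (normalFan Δ) q p' τ (∑ A, (if minVertices v τ.1 ⊆ minVertices v σ.1 then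
        c (minVertices v σ.1) A else 0) • extStalkGen v q τ.1 A) := by
    intro σ
    have hσ := (hV.isLabel_minVertices hp σ).1
    by_cases h : σ.1.IsFaceOf τ.1
    · have hsub := (hσ.isFaceOf_iff hVs hτ).1 h
      simp only [h, hsub, dif_pos, if_true, map_sum, map_smul]
      refine Finset.sum_congr rfl fun A _ => ?_
      rw [extRes_extStalkGen hVs hR hσ hτ h]
    · have hsub : ¬ minVertices v τ.1 ⊆ minVertices v σ.1 := fun h' =>
        h ((hσ.isFaceOf_iff hVs hτ).2 h')
      simp only [h, hsub, dif_neg, not_false_iff, if_false, zero_smul, Finset.sum_const_zero,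
        map_zero]
  rw [Finset.sum_congr rfl fun σ _ => hterm σ, ← map_sum, Finset.sum_comm]
  congr 1
  refine Finset.sum_congr rfl fun A _ => ?_
  by_cases hA : A ⊆ minVertices v τ.1
  swap
  · rw [extStalkGen_eq_zero hVs hR hτ q hA, smul_zero]
    simp only [smul_zero, Finset.sum_const_zero]
  rw [← Finset.sum_smul, hd, if_pos hA]
  congr 1
  rw [hV.sum_minVertices hp hp0 (fun F => if minVertices v τ.1 ⊆ F then c F A else 0)]
  · rw [sum_eq_sum_insert (G := minVertices v τ.1)]
    · simp
    · intro F hF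
      by_cases h : minVertices v τ.1 ⊆ F
      · rw [if_pos h] at hF
        exact ⟨h, by have := (hc F A hF).2.1; omega⟩
      · simp [h] at hF
  · intro F hF
    by_cases h : minVertices v τ.1 ⊆ F
    · rw [if_pos h] at hF
      exact ⟨(hc F A hF).1, (hc F A hF).2.1⟩
    · simp [h] at hF

/-- The `ℤ/2` Hodge spaces below the diagonal vanish in the regular range. -/
theorem IsRegularUpTo.subsingleton_hodgeSpace (hV : IsRegularUpTo Δ v e) {p q : ℕ} (hqp : q < p)
    (hp : p + 1 < e) : Subsingleton (HodgeSpace (normalFan Δ) p q) := by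
  have := hV.finite_cones (p := (p : ℤ)) (by omega)
  have := hV.finite_cones (p := (p : ℤ) - 1) (by omega)
  have := hV.finite_cones (p := (p : ℤ) + 1) (by omega)
  have := Fintype.ofFinite (ConesOfCodim (normalFan Δ) (p : ℤ))
  have := Fintype.ofFinite (ConesOfCodim (normalFan Δ) ((p : ℤ) - 1))
  have := Fintype.ofFinite (ConesOfCodim (normalFan Δ) ((p : ℤ) + 1))
  have K := hV.simplicialUpTo
  rw [Submodule.Quotient.subsingleton_iff, eq_top_iff]
  rintro ⟨z, hz⟩ -
  obtain ⟨c, hc, rfl⟩ := hV.exists_eq_chainOf (by omega) z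
  have hz' : chainOf v (normalFan Δ) q ((p : ℤ) - 1) (hd c) = 0 := by
    rw [← hV.boundary_chainOf (by omega) (by omega) (by omega) hc]
    exact hz
  have hhd := hc.hd K (by omega)
  rw [add_sub_cancel_right] at hhd
  obtain ⟨a, ha, hca⟩ := hV.exists_eq_vd (by omega) (by omega)
    (by rw [sub_add_cancel]; exact hhd) hz'
  rw [sub_add_cancel] at ha
  obtain ⟨b, b', hb, -, hcb⟩ := K.exists_eq_hd_add_vd q (m := (p : ℤ) + 1) (by omega) (by omega) hc
    (by rw [add_sub_cancel_right]; exact ha) hca (fun h => by omega)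
  refine ⟨chainOf v (normalFan Δ) q ((p : ℤ) + 1) b, ?_⟩
  rw [hV.boundary_chainOf (by omega) (by omega) rfl hb]
  show _ = chainOf v (normalFan Δ) q p c
  rw [hcb, chainOf_add, hV.chainOf_vd (by omega), add_zero]

end Chains

/-! ### Facets and relations between orbit closures -/

section Facets

variable {d : ℕ} {ι : Type*} [Fintype ι] [LinearOrder ι] {Δ : Set (Fin d → ℝ)} {v : ι → Fin d → ℤ}
  {e q : ℕ} {p p' : ℤ}

/-- The cones of codimension one less having a given cone as a face, labelled by the vertex removed
from its simplex. -/
lemma IsRegularUpTo.exists_facets (hV : IsRegularUpTo Δ v e) (hp : p + 1 ≤ e) (hp1 : 1 ≤ p)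
    (hpp' : p' + 1 = p) (σ : ConesOfCodim (normalFan Δ) p) :
    ∃ t : ι → ConesOfCodim (normalFan Δ) p', ∀ w ∈ minVertices v σ.1,
      minVertices v (t w).1 = (minVertices v σ.1).erase w := by
  obtain ⟨hσ, hc⟩ := hV.isLabel_minVertices hp σ
  have hex : ∀ w, w ∈ minVertices v σ.1 → ∃ τ : ConesOfCodim (normalFan Δ) p',
      minVertices v τ.1 = (minVertices v σ.1).erase w := by
    intro w hw
    have h1 := Finset.card_erase_add_one hw
    exact hV.exists_minVertices_eq (by omega) (hV.simplicialUpTo.mono hσ.exposed (by omega)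
      (Finset.erase_subset _ _)) (Finset.card_pos.1 (by omega)) (by omega)
  obtain ⟨w₀, hw₀⟩ := hσ.nonempty
  obtain ⟨τ₀, -⟩ := hex w₀ hw₀
  have : Nonempty (ConesOfCodim (normalFan Δ) p') := ⟨τ₀⟩
  choose! t ht using hex
  exact ⟨t, ht⟩

/-- Sums over the cones having `σ` as a face are sums over the vertices of the simplex of `σ`. -/
lemma IsRegularUpTo.sum_facets (hV : IsRegularUpTo Δ v e) (hp : p + 1 ≤ e)
    (hpp' : p' + 1 = p) [Fintype (ConesOfCodim (normalFan Δ) p')]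
    {σ : ConesOfCodim (normalFan Δ) p} {t : ι → ConesOfCodim (normalFan Δ) p'}
    (ht : ∀ w ∈ minVertices v σ.1, minVertices v (t w).1 = (minVertices v σ.1).erase w)
    {M : Type*} [AddCommMonoid M] (h : ConesOfCodim (normalFan Δ) p' → M)
    (h0 : ∀ τ, ¬ minVertices v τ.1 ⊆ minVertices v σ.1 → h τ = 0) :
    ∑ τ, h τ = ∑ w ∈ minVertices v σ.1, h (t w) := by
  classical
  obtain ⟨hσ, hc⟩ := hV.isLabel_minVertices hp σ
  have hinj : Set.InjOn t (minVertices v σ.1) := by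
    intro w hw w' hw' htt
    by_contra hne
    have h1 : (minVertices v σ.1).erase w = (minVertices v σ.1).erase w' := by
      rw [← ht w hw, ← ht w' hw', htt]
    have h2 : w ∈ (minVertices v σ.1).erase w' := Finset.mem_erase.2 ⟨hne, hw⟩
    simp [← h1] at h2
  rw [← Finset.sum_image (f := h) hinj]
  refine (Finset.sum_subset (Finset.subset_univ _) fun τ _ hτ => ?_).symm
  refine h0 τ fun hsub => hτ ?_
  have hτc := (hV.isLabel_minVertices (by omega) τ).2
  obtain ⟨w, hw⟩ := Finset.card_eq_one.1
    (by rw [Finset.card_sdiff_of_subset hsub]; omega :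
      (minVertices v σ.1 \ minVertices v τ.1).card = 1)
  have hwF : w ∈ minVertices v σ.1 ∧ w ∉ minVertices v τ.1 := by
    rw [← Finset.mem_sdiff, hw]; simp
  refine Finset.mem_image.2 ⟨w, hwF.1, ?_⟩
  apply hV.minVertices_injective (p := p') (by omega)
  simp only [ht w hwF.1]
  refine (Finset.eq_of_subset_of_card_le (fun i hi => Finset.mem_erase.2 ⟨?_, hsub hi⟩) ?_).symm
  · rintro rfl; exact hwF.2 hi
  · rw [Finset.card_erase_of_mem hwF.1]; omega

lemma IsLabel.exists_isRelativeGenerator (hV : IsVertexSystem Δ v) (hΔ : IsReflexive Δ)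
    {σ τ : PointedCone ℝ (Fin d → ℝ)} {f : Finset ι} {w : ι} (hσ : IsLabel Δ v σ f)
    (hτ : IsLabel Δ v τ (f.erase w)) : ∃ n, IsRelativeGenerator σ τ n := by
  obtain ⟨j, hj⟩ := hτ.nonempty
  have hjf := Finset.mem_of_mem_erase hj
  -- The relative lattice is the image of the functional `v w - v j`, a subgroup of `ℤ`.
  let φ : (Fin d → ℤ) →+ ℤ := AddMonoidHom.mk' (fun n => v w ⬝ᵥ n - v j ⬝ᵥ n) fun a b => by
    rw [dotProduct_add, dotProduct_add]; ring
  obtain ⟨a, ha⟩ := Int.subgroup_cyclic ((coneLattice τ).map φ)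
  rw [← AddSubgroup.zmultiples_eq_closure] at ha
  obtain ⟨n, hn, hna⟩ : a ∈ (coneLattice τ).map φ := by
    rw [ha]; exact AddSubgroup.mem_zmultiples a
  have hle : coneLattice σ ≤ coneLattice τ := by
    intro x hx
    rw [hσ.mem_coneLattice_iff hV hΔ] at hx
    rw [hτ.mem_coneLattice_iff hV hΔ]
    exact fun i hi k hk => hx i (Finset.mem_of_mem_erase hi) k (Finset.mem_of_mem_erase hk)
  refine ⟨n, hn, le_antisymm ?_ (sup_le hle (AddSubgroup.zmultiples_le_of_mem hn))⟩
  intro x hx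
  obtain ⟨k, hk⟩ : ∃ k : ℤ, k • a = φ x := by
    rw [← AddSubgroup.mem_zmultiples_iff, ← ha]
    exact ⟨x, hx, rfl⟩
  rw [← sub_add_cancel x (k • n)]
  refine AddSubgroup.add_mem_sup ?_ (AddSubgroup.zsmul_mem_zmultiples n k)
  have hmem : x - k • n ∈ coneLattice τ :=
    AddSubgroup.sub_mem _ hx (AddSubgroup.zsmul_mem _ hn k)
  have hφ : φ (x - k • n) = 0 := by rw [map_sub, map_zsmul, hna, hk, sub_self]
  rw [hτ.mem_coneLattice_iff hV hΔ] at hmem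
  rw [hσ.mem_coneLattice_iff hV hΔ]
  have hall : ∀ i ∈ f, v i ⬝ᵥ (x - k • n) = v j ⬝ᵥ (x - k • n) := by
    intro i hi
    by_cases hiw : i = w
    · rw [hiw]; exact sub_eq_zero.1 hφ
    · exact hmem i (Finset.mem_erase.2 ⟨hiw, hi⟩) j hj
  intro i hi i' hi'
  rw [hall i hi, hall i' hi']

/-- A relative generator takes values of the same parity at all vertices except the removed one. -/
lemma IsLabel.dotProduct_relativeGenerator (hV : IsVertexSystem Δ v) (hΔ : IsReflexive Δ)
    {σ τ : PointedCone ℝ (Fin d → ℝ)} {f : Finset ι} {w : ι} (hw : w ∈ f) (hσ : IsLabel Δ v σ f)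
    (hτ : IsLabel Δ v τ (f.erase w)) {n : Fin d → ℤ} (hn : IsRelativeGenerator σ τ n)
    {i j : ι} (hi : i ∈ f) (hj : j ∈ f) (hij : i ≠ j) :
    mod2 (v i) ⬝ᵥ mod2 n - mod2 (v j) ⬝ᵥ mod2 n = if i = w ∨ j = w then 1 else 0 := by
  have hodd : ∀ k ∈ f, k ≠ w → mod2 (v w) ⬝ᵥ mod2 n - mod2 (v k) ⬝ᵥ mod2 n = 1 := by
    intro k hk hkw
    have hkτ : k ∈ f.erase w := Finset.mem_erase.2 ⟨hkw, hk⟩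
    -- A lattice point of `τ` which is odd at `w` and even at the other vertices.
    have hval : ∀ b ∈ f.erase w, mod2 (v b) ⬝ᵥ dualVec v f w = 0 := by
      intro b hb
      rw [hσ.dotProduct_dualVec w (Finset.mem_of_mem_erase hb), if_neg (Finset.mem_erase.1 hb).1]
    obtain ⟨m, hm, hmx⟩ := hτ.exists_mod2_eq hV hΔ (x := dualVec v f w) fun i hi j hj => by
      rw [hval i hi, hval j hj]
    have hmτ : m ∈ coneLattice τ := AddSubgroup.subset_closure hm
    rw [hn.2, AddSubgroup.mem_sup] at hmτ
    obtain ⟨s, hs, y, hy, rfl⟩ := hmτ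
    obtain ⟨l, rfl⟩ := AddSubgroup.mem_zmultiples_iff.1 hy
    have h1 : mod2 (v w) ⬝ᵥ mod2 (s + l • n) - mod2 (v k) ⬝ᵥ mod2 (s + l • n) = 1 := by
      rw [hmx, hval k hkτ, hσ.dotProduct_dualVec w hw, if_pos rfl, sub_zero]
    have h2 : mod2 (v w) ⬝ᵥ mod2 s = mod2 (v k) ⬝ᵥ mod2 s := by
      rw [mod2_dotProduct, mod2_dotProduct, (hσ.mem_coneLattice_iff hV hΔ).1 hs w hw k hk]
    rw [mod2_add, mod2_smul, dotProduct_add, dotProduct_add, dotProduct_smul, dotProduct_smul, h2,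
      add_sub_add_left_eq_sub, smul_eq_mul, smul_eq_mul, ← mul_sub] at h1
    generalize mod2 (v w) ⬝ᵥ mod2 n - mod2 (v k) ⬝ᵥ mod2 n = t at h1 ⊢
    revert h1
    generalize (l : ZMod 2) = l'
    revert l' t
    decide
  by_cases hiw : i = w
  · subst hiw
    rw [if_pos (Or.inl rfl), hodd j hj hij.symm]
  by_cases hjw : j = w
  · subst hjw
    rw [if_pos (Or.inr rfl), ← neg_sub, hodd i hi hij]
    decide
  rw [if_neg (by simp [hiw, hjw]), mod2_dotProduct, mod2_dotProduct,
    (hτ.mem_coneLattice_iff hV hΔ).1 hn.1 i (Finset.mem_erase.2 ⟨hiw, hi⟩) j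
      (Finset.mem_erase.2 ⟨hjw, hj⟩), sub_self]

end Facets

section Chow

variable {d : ℕ} {ι : Type*} [Fintype ι] [LinearOrder ι] {Δ : Set (Fin d → ℝ)} {v : ι → Fin d → ℤ}
  {e q : ℕ}

/-- Two orbit closures contained in a common orbit closure of one dimension more are equal in the
Chow group: the difference of the two vertices gives a relation between them. -/
lemma IsRegularUpTo.single_add_single_mem (hV : IsRegularUpTo Δ v e) (hq : q + 1 < e)
    {σ : ConesOfCodim (normalFan Δ) ((q : ℤ) + 1)} {t : ι → ConesOfCodim (normalFan Δ) (q : ℤ)}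
    (ht : ∀ w ∈ minVertices v σ.1, minVertices v (t w).1 = (minVertices v σ.1).erase w)
    {i j : ι} (hi : i ∈ minVertices v σ.1) (hj : j ∈ minVertices v σ.1) (hij : i ≠ j) :
    (Finsupp.single (t i) 1 + Finsupp.single (t j) 1 : InvariantCycles (normalFan Δ) q) ∈
      invariantRelations (normalFan Δ) q := by
  classical
  have hVs := hV.toIsVertexSystem
  have hR := hV.isReflexive
  obtain ⟨hσ, hσc⟩ := hV.isLabel_minVertices (by omega) σ
  have hlab : ∀ τ : ConesOfCodim (normalFan Δ) (q : ℤ), IsLabel Δ v τ.1 (minVertices v τ.1) :=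
    fun τ => (hV.isLabel_minVertices (by omega) τ).1
  have hτeq : ∀ τ : ConesOfCodim (normalFan Δ) (q : ℤ), σ.1.IsFaceOf τ.1 →
      ∃ w ∈ minVertices v σ.1, minVertices v τ.1 = (minVertices v σ.1).erase w := by
    intro τ h
    have hsub := (hσ.isFaceOf_iff hVs (hlab τ)).1 h
    have hτc := (hV.isLabel_minVertices (by omega) τ).2
    obtain ⟨w, hw⟩ := Finset.card_eq_one.1
      (by rw [Finset.card_sdiff_of_subset hsub]; omega :
        (minVertices v σ.1 \ minVertices v τ.1).card = 1)
    have hwF : w ∈ minVertices v σ.1 ∧ w ∉ minVertices v τ.1 := by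
      rw [← Finset.mem_sdiff, hw]; simp
    refine ⟨w, hwF.1, Finset.eq_of_subset_of_card_le
      (fun k hk => Finset.mem_erase.2 ⟨?_, hsub hk⟩) ?_⟩
    · rintro rfl; exact hwF.2 hk
    · rw [Finset.card_erase_of_mem hwF.1]; omega
  have hgen : ∀ τ : ConesOfCodim (normalFan Δ) (q : ℤ), ∃ n, σ.1.IsFaceOf τ.1 →
      IsRelativeGenerator σ.1 τ.1 n := by
    intro τ
    by_cases h : σ.1.IsFaceOf τ.1
    · obtain ⟨w, hw, hτw⟩ := hτeq τ h
      obtain ⟨n, hn⟩ := hσ.exists_isRelativeGenerator hVs hR (hτw ▸ hlab τ)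
      exact ⟨n, fun _ => hn⟩
    · exact ⟨0, fun h' => absurd h' h⟩
  choose n hn using hgen
  have hiff : ∀ (τ : ConesOfCodim (normalFan Δ) (q : ℤ)) (w k : ι), w ∈ minVertices v σ.1 →
      k ∈ minVertices v σ.1 → minVertices v τ.1 = (minVertices v σ.1).erase w →
      (t k = τ ↔ k = w) := by
    intro τ w k hw hk hτw
    constructor
    · intro h
      by_contra hne
      have h1 : k ∈ (minVertices v σ.1).erase w := Finset.mem_erase.2 ⟨hne, hk⟩
      rw [← hτw, ← h, ht k hk] at h1
      simp at h1
    · rintro rfl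
      apply hV.minVertices_injective (p := (q : ℤ)) (by omega)
      simp only [ht k hk, hτw]
  refine Submodule.subset_span ⟨σ, v i - v j, n, ?_, fun τ => ⟨fun h => ⟨hn τ h, ?_⟩, fun h => ?_⟩⟩
  · intro x hx
    rw [hσ.eq] at hx
    rw [latticePt_sub, sub_dotProduct, hVs.normalCone_subset_constOn hx i hi j hj, sub_self]
  · obtain ⟨w, hw, hτw⟩ := hτeq τ h
    have hval := hσ.dotProduct_relativeGenerator hVs hR hw (hτw ▸ hlab τ) (hn τ h) hi hj hij
    rw [← mod2_dotProduct, mod2_sub, sub_dotProduct, hval, Finsupp.add_apply, Finsupp.single_apply,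
      Finsupp.single_apply]
    simp only [hiff τ w i hw hi hτw, hiff τ w j hw hj hτw]
    by_cases h1 : i = w
    · have h2 : j ≠ w := fun h2 => hij (h1.trans h2.symm)
      simp [h1, h2]
    · by_cases h2 : j = w <;> simp [h1, h2]
  · have hne : ∀ k ∈ minVertices v σ.1, t k ≠ τ := by
      rintro k hk rfl
      refine h ((hσ.isFaceOf_iff hVs (hlab _)).2 ?_)
      rw [ht k hk]
      exact Finset.erase_subset _ _
    rw [Finsupp.add_apply, Finsupp.single_eq_of_ne (hne i hi).symm,
      Finsupp.single_eq_of_ne (hne j hj).symm, add_zero]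

/-- The coefficients of a relation add up to zero: they are the values of a form vanishing on `N_σ`
at the relative generators, whose sum lies in `N_σ`. -/
lemma IsRegularUpTo.sum_eq_zero_of_mem (hV : IsRegularUpTo Δ v e) (hq : q + 1 < e)
    [Fintype (ConesOfCodim (normalFan Δ) (q : ℤ))] {x : InvariantCycles (normalFan Δ) q}
    (hx : x ∈ invariantRelations (normalFan Δ) q) : ∑ τ, x τ = 0 := by
  classical
  have hVs := hV.toIsVertexSystem
  have hR := hV.isReflexive
  induction hx using Submodule.span_induction with
  | zero => simp
  | add x y _ _ hx hy => simp only [Finsupp.add_apply, Finset.sum_add_distrib, hx, hy, add_zero]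
  | smul a x _ hx => simp only [Finsupp.smul_apply, ← Finset.smul_sum, hx, smul_zero]
  | mem r hr =>
    obtain ⟨σ, u, n, hu, hr⟩ := hr
    obtain ⟨hσ, hσc⟩ := hV.isLabel_minVertices (by omega) σ
    have hlab : ∀ τ : ConesOfCodim (normalFan Δ) (q : ℤ), IsLabel Δ v τ.1 (minVertices v τ.1) :=
      fun τ => (hV.isLabel_minVertices (by omega) τ).1
    obtain ⟨t, ht⟩ := hV.exists_facets (p' := (q : ℤ)) (by omega) (by omega) rfl σ
    rw [hV.sum_facets (by omega) rfl ht r fun τ hτ =>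
      (hr τ).2 fun h => hτ ((hσ.isFaceOf_iff hVs (hlab τ)).1 h)]
    have hface : ∀ w ∈ minVertices v σ.1, σ.1.IsFaceOf (t w).1 := by
      intro w hw
      rw [hσ.isFaceOf_iff hVs (hlab _), ht w hw]
      exact Finset.erase_subset _ _
    have hsum : ∑ w ∈ minVertices v σ.1, r (t w) =
        mod2 u ⬝ᵥ ∑ w ∈ minVertices v σ.1, mod2 (n (t w)) := by
      rw [dotProduct_sum]
      refine Finset.sum_congr rfl fun w hw => ?_
      rw [((hr (t w)).1 (hface w hw)).2, mod2_dotProduct]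
    have hmem : ∀ i ∈ minVertices v σ.1, ∀ j ∈ minVertices v σ.1,
        mod2 (v i) ⬝ᵥ ∑ w ∈ minVertices v σ.1, mod2 (n (t w)) =
        mod2 (v j) ⬝ᵥ ∑ w ∈ minVertices v σ.1, mod2 (n (t w)) := by
      intro i hi j hj
      by_cases hij : i = j
      · rw [hij]
      rw [← sub_eq_zero, dotProduct_sum, dotProduct_sum, ← Finset.sum_sub_distrib]
      have hterm : ∀ w ∈ minVertices v σ.1, mod2 (v i) ⬝ᵥ mod2 (n (t w)) -
          mod2 (v j) ⬝ᵥ mod2 (n (t w)) = (if i = w then 1 else 0) + if j = w then 1 else 0 := by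
        intro w hw
        rw [hσ.dotProduct_relativeGenerator hVs hR hw (ht w hw ▸ hlab (t w))
          ((hr (t w)).1 (hface w hw)).1 hi hj hij]
        by_cases h1 : i = w
        · have h2 : j ≠ w := fun h2 => hij (h1.trans h2.symm)
          simp [h1, h2]
        · by_cases h2 : j = w <;> simp [h1, h2]
      rw [Finset.sum_congr rfl hterm, Finset.sum_add_distrib, Finset.sum_ite_eq,
        Finset.sum_ite_eq, if_pos hi, if_pos hj]
      rfl
    obtain ⟨m, hm, hmx⟩ := hσ.exists_mod2_eq hVs hR hmem
    have h0 := hu _ hm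
    rw [latticePt_dotProduct, Int.cast_eq_zero] at h0
    rw [hsum, ← hmx, mod2_dotProduct, h0, Int.cast_zero]

end Chow

/-! ### The diagonal Hodge spaces and Chow groups -/

section Diagonal

variable {d : ℕ} {ι : Type*} [Fintype ι] [LinearOrder ι] {Δ : Set (Fin d → ℝ)} {v : ι → Fin d → ℤ}
  {e q : ℕ}

/-- The forms identifying the one-dimensional stalks `⋀^q E_σ`, for `σ` of codimension `q`, with
`ℤ/2`. -/
lemma IsRegularUpTo.exists_stalkForms (hV : IsRegularUpTo Δ v e) (hq : q + 1 ≤ e) :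
    ∃ ε : ∀ σ : ConesOfCodim (normalFan Δ) (q : ℤ), ExtStalk q σ.1 →ₗ[ZMod 2] ZMod 2,
      (∀ σ, ∀ A ⊆ minVertices v σ.1, A.card = q → ε σ (extStalkGen v q σ.1 A) = 1) ∧
      ∀ σ ω, ε σ ω = 0 → ω = 0 := by
  have hex : ∀ σ : ConesOfCodim (normalFan Δ) (q : ℤ), ∃ ε : ExtStalk q σ.1 →ₗ[ZMod 2] ZMod 2,
      (∀ A ⊆ minVertices v σ.1, A.card = q → ε (extStalkGen v q σ.1 A) = 1) ∧
      ∀ ω, ε ω = 0 → ω = 0 := by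
    intro σ
    obtain ⟨hσ, hc⟩ := hV.isLabel_minVertices (by omega) σ
    exact exists_dual_extStalk hV.toIsVertexSystem hV.isReflexive hσ (by exact_mod_cast hc)
  choose ε hε using hex
  exact ⟨ε, fun σ => (hε σ).1, fun σ => (hε σ).2⟩

open Classical in
/-- The map on chains given on the summand at `σ` by `ω ↦ ε_σ(ω) m_σ`. -/
noncomputable def weightedSum {Sig : Set (PointedCone ℝ (Fin d → ℝ))} {p : ℤ}
    {M : Type*} [AddCommGroup M] [Module (ZMod 2) M]
    (ε : ∀ σ : ConesOfCodim Sig p, ExtStalk q σ.1 →ₗ[ZMod 2] ZMod 2) (m : ConesOfCodim Sig p → M) :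
    Chains Sig q p →ₗ[ZMod 2] M :=
  DirectSum.toModule (ZMod 2) (ConesOfCodim Sig p) M fun σ => (ε σ).smulRight (m σ)

lemma weightedSum_summand {Sig : Set (PointedCone ℝ (Fin d → ℝ))} {p : ℤ}
    {M : Type*} [AddCommGroup M] [Module (ZMod 2) M]
    (ε : ∀ σ : ConesOfCodim Sig p, ExtStalk q σ.1 →ₗ[ZMod 2] ZMod 2) (m : ConesOfCodim Sig p → M)
    (σ : ConesOfCodim Sig p) (ω : ExtStalk q σ.1) :
    weightedSum ε m (summand Sig q p σ ω) = ε σ ω • m σ := by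
  rw [weightedSum, summand, DirectSum.toModule_lof, LinearMap.smulRight_apply]

/-- Weights whose values agree on the facets of each simplex give a map that vanishes on boundaries:
the restrictions of an exterior product of `q` generators to all but two of the `q + 2` facets are
zero. -/
lemma IsRegularUpTo.weightedSum_boundary (hV : IsRegularUpTo Δ v e) (hq : q + 1 < e)
    {ε : ∀ σ : ConesOfCodim (normalFan Δ) (q : ℤ), ExtStalk q σ.1 →ₗ[ZMod 2] ZMod 2}
    (hε : ∀ σ, ∀ A ⊆ minVertices v σ.1, A.card = q → ε σ (extStalkGen v q σ.1 A) = 1)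
    {M : Type*} [AddCommGroup M] [Module (ZMod 2) M] {m : ConesOfCodim (normalFan Δ) (q : ℤ) → M}
    (hm : ∀ (σ : ConesOfCodim (normalFan Δ) ((q : ℤ) + 1))
      (t : ι → ConesOfCodim (normalFan Δ) (q : ℤ)),
      (∀ w ∈ minVertices v σ.1, minVertices v (t w).1 = (minVertices v σ.1).erase w) →
      ∀ i ∈ minVertices v σ.1, ∀ j ∈ minVertices v σ.1, i ≠ j → m (t i) + m (t j) = 0)
    (z : Chains (normalFan Δ) q ((q : ℤ) + 1)) :
    weightedSum ε m (boundary (normalFan Δ) q ((q : ℤ) + 1) q z) = 0 := by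
  classical
  have hVs := hV.toIsVertexSystem
  have hR := hV.isReflexive
  have := hV.finite_cones (p := (q : ℤ)) (by omega)
  have := hV.finite_cones (p := (q : ℤ) + 1) (by omega)
  have := Fintype.ofFinite (ConesOfCodim (normalFan Δ) (q : ℤ))
  have := Fintype.ofFinite (ConesOfCodim (normalFan Δ) ((q : ℤ) + 1))
  have hlab : ∀ τ : ConesOfCodim (normalFan Δ) (q : ℤ), IsLabel Δ v τ.1 (minVertices v τ.1) :=
    fun τ => (hV.isLabel_minVertices (by omega) τ).1
  rw [← sum_summand z, map_sum, map_sum]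
  refine Finset.sum_eq_zero fun σ _ => ?_
  obtain ⟨hσ, hσc⟩ := hV.isLabel_minVertices (by omega) σ
  obtain ⟨c, hc, hz⟩ := exists_eq_sum_extStalkGen hVs hR hσ (z σ)
  rw [hz, map_sum, map_sum, map_sum]
  refine Finset.sum_eq_zero fun A _ => ?_
  rw [map_smul, map_smul, map_smul]
  by_cases hcA : c A = 0
  · rw [hcA, zero_smul]
  obtain ⟨hAc, hAσ⟩ := hc A hcA
  obtain ⟨t, ht⟩ := hV.exists_facets (p' := (q : ℤ)) (by omega) (by omega) rfl σ
  have hface : ∀ w ∈ minVertices v σ.1, σ.1.IsFaceOf (t w).1 := by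
    intro w hw
    rw [hσ.isFaceOf_iff hVs (hlab _), ht w hw]
    exact Finset.erase_subset _ _
  rw [boundary_summand, map_sum, hV.sum_facets (by omega) rfl ht _ fun τ hτ => by
    rw [dif_neg fun h => hτ ((hσ.isFaceOf_iff hVs (hlab τ)).1 h), map_zero]]
  have hterm : ∀ w ∈ minVertices v σ.1, (weightedSum ε m (if h : σ.1.IsFaceOf (t w).1 then
      summand (normalFan Δ) q q (t w) (extRes q h (extStalkGen v q σ.1 A)) else 0)) =
      if w ∈ A then 0 else m (t w) := by
    intro w hw
    rw [dif_pos (hface w hw), weightedSum_summand, extRes_extStalkGen hVs hR hσ (hlab _)]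
    by_cases hwA : w ∈ A
    · rw [if_pos hwA, extStalkGen_eq_zero hVs hR (hlab _) q, map_zero, zero_smul]
      intro hsub
      have h1 := hsub hwA
      rw [ht w hw] at h1
      simp at h1
    · rw [if_neg hwA, hε _ A _ hAc, one_smul]
      rw [ht w hw]
      exact fun a ha => Finset.mem_erase.2 ⟨fun h => hwA (h ▸ ha), hAσ ha⟩
  obtain ⟨i, j, hij, hsd⟩ := Finset.card_eq_two.1
    (by rw [Finset.card_sdiff_of_subset hAσ]; omega : (minVertices v σ.1 \ A).card = 2)
  have hmem : ∀ k, k = i ∨ k = j → k ∈ minVertices v σ.1 := by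
    intro k hk
    have : k ∈ minVertices v σ.1 \ A := by rw [hsd]; simpa using hk
    exact (Finset.mem_sdiff.1 this).1
  rw [Finset.sum_congr rfl hterm, ← Finset.sum_sdiff hAσ,
    Finset.sum_eq_zero (s := A) fun w hw => if_pos hw, add_zero,
    Finset.sum_congr rfl fun w hw => if_neg (Finset.mem_sdiff.1 hw).2, hsd,
    Finset.sum_pair hij, hm σ t ht i (hmem i (Or.inl rfl)) j (hmem j (Or.inr rfl)) hij, smul_zero]

/-- A chain of codimension `q` is a boundary as soon as its coefficients add up to zero. -/
lemma IsRegularUpTo.mem_range_boundary (hV : IsRegularUpTo Δ v e) (hq : q + 1 < e)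
    {ε : ∀ σ : ConesOfCodim (normalFan Δ) (q : ℤ), ExtStalk q σ.1 →ₗ[ZMod 2] ZMod 2}
    (hε : ∀ σ, ∀ A ⊆ minVertices v σ.1, A.card = q → ε σ (extStalkGen v q σ.1 A) = 1)
    {z : Chains (normalFan Δ) q q} (hz : weightedSum ε (fun _ => (1 : ZMod 2)) z = 0) :
    z ∈ LinearMap.range (boundary (normalFan Δ) q ((q : ℤ) + 1) q) := by
  classical
  have := hV.finite_cones (p := (q : ℤ)) (by omega)
  have := hV.finite_cones (p := (q : ℤ) + 1) (by omega)
  have := Fintype.ofFinite (ConesOfCodim (normalFan Δ) (q : ℤ))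
  have := Fintype.ofFinite (ConesOfCodim (normalFan Δ) ((q : ℤ) + 1))
  obtain ⟨c, hc, rfl⟩ := hV.exists_eq_chainOf (by omega) z
  have htot : total c = 0 := by
    rw [← hz, total, chainOf, map_sum, ← hV.sum_minVertices (p := (q : ℤ)) (by omega) (by omega)
      (fun F => ∑ A, c F A)]
    · refine Finset.sum_congr rfl fun σ _ => ?_
      rw [weightedSum_summand, smul_eq_mul, mul_one, map_sum]
      refine Finset.sum_congr rfl fun A _ => ?_
      rw [map_smul, smul_eq_mul]
      by_cases hA : c (minVertices v σ.1) A = 0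
      · rw [hA, zero_mul]
      · obtain ⟨-, -, h2, h3⟩ := hc _ _ hA
        rw [hε σ A h3 (by exact_mod_cast h2), mul_one]
    · intro F hF
      obtain ⟨A, -, hA⟩ := Finset.exists_ne_zero_of_sum_ne_zero hF
      exact ⟨(hc F A hA).1, (hc F A hA).2.1⟩
  obtain ⟨b, b', hb, -, hcb⟩ :=
    hV.simplicialUpTo.exists_eq_hd_add_vd_of_total_eq_zero q hq hc htot
  refine ⟨chainOf v (normalFan Δ) q ((q : ℤ) + 1) b, ?_⟩
  rw [hV.boundary_chainOf (by omega) (by omega) rfl hb, hcb, chainOf_add,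
    hV.chainOf_vd (by omega), add_zero]

/-- Every chain of codimension `q` is a cycle, since `⋀^q E_τ = 0` for `τ` of codimension `q - 1`.
-/
lemma IsRegularUpTo.cycles_eq_top (hV : IsRegularUpTo Δ v e) (hq : q + 1 < e) :
    cycles (normalFan Δ) q q = ⊤ := by
  rw [eq_top_iff]
  intro z _
  rw [LinearMap.mem_ker]
  ext τ : 1
  obtain ⟨hτ, hc⟩ := hV.isLabel_minVertices (by omega) τ
  exact extStalk_eq_zero_of_card_eq hV.toIsVertexSystem hV.isReflexive hτ (by omega) _

lemma IsRegularUpTo.nonempty_cones (hV : IsRegularUpTo Δ v e) (hq : q + 1 ≤ e) :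
    Nonempty (ConesOfCodim (normalFan Δ) (q : ℤ)) := by
  obtain ⟨F, hF, hc⟩ := hV.simplicialUpTo.exists_exposed_card_eq hq
  obtain ⟨σ, -⟩ := hV.exists_minVertices_eq (p := (q : ℤ)) (by omega) hF
    (Finset.card_pos.1 (by omega)) (by exact_mod_cast hc)
  exact ⟨σ⟩

lemma IsRegularUpTo.exists_extStalk_form_eq_one (hV : IsRegularUpTo Δ v e) (hq : q + 1 ≤ e)
    {ε : ∀ σ : ConesOfCodim (normalFan Δ) (q : ℤ), ExtStalk q σ.1 →ₗ[ZMod 2] ZMod 2}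
    (hε : ∀ σ, ∀ A ⊆ minVertices v σ.1, A.card = q → ε σ (extStalkGen v q σ.1 A) = 1)
    (σ : ConesOfCodim (normalFan Δ) (q : ℤ)) : ∃ ω, ε σ ω = 1 := by
  obtain ⟨hσ, hc⟩ := hV.isLabel_minVertices (by omega) σ
  obtain ⟨A, hA, hAc⟩ := Finset.exists_subset_card_eq (n := q) (s := minVertices v σ.1) (by omega)
  exact ⟨_, hε σ A hA hAc⟩

/-- The sum of the coefficients identifies the diagonal Hodge space with `ℤ/2`. -/
lemma IsRegularUpTo.exists_hodgeSpace_equiv (hV : IsRegularUpTo Δ v e) (hq : q + 1 < e)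
    {ε : ∀ σ : ConesOfCodim (normalFan Δ) (q : ℤ), ExtStalk q σ.1 →ₗ[ZMod 2] ZMod 2}
    (hε : ∀ σ, ∀ A ⊆ minVertices v σ.1, A.card = q → ε σ (extStalkGen v q σ.1 A) = 1) :
    ∃ Ψ : HodgeSpace (normalFan Δ) q q ≃ₗ[ZMod 2] ZMod 2, ∀ z : cycles (normalFan Δ) q q,
      Ψ ((boundaries (normalFan Δ) q q).mkQ z) = weightedSum ε (fun _ => (1 : ZMod 2)) z.1 := by
  let s : cycles (normalFan Δ) q q →ₗ[ZMod 2] ZMod 2 :=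
    weightedSum ε (fun _ => (1 : ZMod 2)) ∘ₗ (cycles (normalFan Δ) q q).subtype
  have hs : Function.Surjective s := by
    intro a
    obtain ⟨σ⟩ := hV.nonempty_cones hq.le
    obtain ⟨ω, hω⟩ := hV.exists_extStalk_form_eq_one hq.le hε σ
    refine ⟨⟨summand (normalFan Δ) q q σ (a • ω), by rw [hV.cycles_eq_top hq]; trivial⟩, ?_⟩
    show weightedSum ε (fun _ => (1 : ZMod 2)) (summand (normalFan Δ) q q σ (a • ω)) = a
    rw [weightedSum_summand, map_smul, hω, smul_eq_mul, smul_eq_mul, mul_one, mul_one]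
  have hker : boundaries (normalFan Δ) q q = LinearMap.ker s := by
    ext z
    constructor
    · rintro ⟨y, hy⟩
      rw [LinearMap.mem_ker]
      show weightedSum ε _ z.1 = 0
      rw [← Submodule.subtype_apply, ← hy]
      exact hV.weightedSum_boundary hq hε (fun _ _ _ _ _ _ _ _ => by decide) y
    · exact fun hz => hV.mem_range_boundary hq hε hz
  exact ⟨(Submodule.quotEquivOfEq _ _ hker).trans (s.quotKerEquivOfSurjective hs), fun z => rfl⟩

/-- The sum of the coefficients identifies the torus invariant Chow group with `ℤ/2`. -/
lemma IsRegularUpTo.exists_invariantChow_equiv (hV : IsRegularUpTo Δ v e) (hq : q + 1 < e) :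
    ∃ Θ : InvariantChow (normalFan Δ) q ≃ₗ[ZMod 2] ZMod 2,
      ∀ β, Θ (orbitClosureClass (normalFan Δ) q β) = 1 := by
  classical
  obtain ⟨ε, hε, -⟩ := hV.exists_stalkForms hq.le
  have := hV.finite_cones (p := (q : ℤ)) (by omega)
  have := Fintype.ofFinite (ConesOfCodim (normalFan Δ) (q : ℤ))
  let s : InvariantCycles (normalFan Δ) q →ₗ[ZMod 2] ZMod 2 :=
    Finsupp.linearCombination (ZMod 2) fun _ => (1 : ZMod 2)
  have hsum : ∀ x, s x = ∑ τ, x τ := by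
    intro x
    rw [Finsupp.linearCombination_apply, Finsupp.sum_fintype _ _ fun _ => zero_smul (ZMod 2) (1 : ZMod 2)]
    simp only [smul_eq_mul, mul_one]
  have hs1 : ∀ (β : ConesOfCodim (normalFan Δ) (q : ℤ)) (a : ZMod 2), s (Finsupp.single β a) = a := by
    intro β a
    rw [Finsupp.linearCombination_single, smul_eq_mul, mul_one]
  have hker : invariantRelations (normalFan Δ) q = LinearMap.ker s := by
    refine le_antisymm (fun x hx => ?_) fun x hx => ?_
    · rw [LinearMap.mem_ker, hsum]
      exact hV.sum_eq_zero_of_mem hq hx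
    -- Lift `x` to a chain; it is a boundary, and boundaries map to zero in the Chow group.
    · choose g hg using hV.exists_extStalk_form_eq_one hq.le hε
      let z : Chains (normalFan Δ) q q := ∑ σ, summand (normalFan Δ) q q σ (x σ • g σ)
      have hz : ∀ {M : Type} [AddCommGroup M] [Module (ZMod 2) M]
          (m : ConesOfCodim (normalFan Δ) (q : ℤ) → M), weightedSum ε m z = ∑ σ, x σ • m σ := by
        intro M _ _ m
        rw [map_sum]
        refine Finset.sum_congr rfl fun σ _ => ?_
        rw [weightedSum_summand, map_smul, hg, smul_eq_mul, mul_one]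
      obtain ⟨y, hy⟩ := hV.mem_range_boundary hq hε (z := z) (by
        rw [hz]
        rw [LinearMap.mem_ker, hsum] at hx
        simpa using hx)
      have h0 : weightedSum ε (orbitClosureClass (normalFan Δ) (q : ℤ)) z = 0 := by
        rw [← hy]
        refine hV.weightedSum_boundary hq hε (fun σ t ht i hi j hj hij => ?_) y
        rw [orbitClosureClass, orbitClosureClass, ← map_add, Submodule.mkQ_apply,
          Submodule.Quotient.mk_eq_zero]
        exact hV.single_add_single_mem hq ht hi hj hij
      rw [hz] at h0
      rw [← Submodule.Quotient.mk_eq_zero, ← Submodule.mkQ_apply, ← h0,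
        ← Finsupp.univ_sum_single x, map_sum]
      refine Finset.sum_congr rfl fun σ _ => ?_
      rw [orbitClosureClass, ← map_smul, Finsupp.smul_single, smul_eq_mul, mul_one,
        Finsupp.univ_sum_single]
  obtain ⟨σ⟩ := hV.nonempty_cones hq.le
  exact ⟨(Submodule.quotEquivOfEq _ _ hker).trans
    (s.quotKerEquivOfSurjective fun a => ⟨Finsupp.single σ a, hs1 σ a⟩), fun β => hs1 β 1⟩

/-- The diagonal Hodge spaces in the regular range are torus invariant Chow groups of order two. -/
theorem IsRegularUpTo.exists_hodgeSpace_equiv_invariantChow (hV : IsRegularUpTo Δ v e)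
    (hq : q + 1 < e) :
    Nonempty (HodgeSpace (normalFan Δ) q q ≃ₗ[ZMod 2] ZMod 2) ∧
      ∃ Φ : HodgeSpace (normalFan Δ) q q ≃ₗ[ZMod 2] InvariantChow (normalFan Δ) q,
        ∀ β : ConesOfCodim (normalFan Δ) q,
          (∀ ω : ExtStalk q β.1, ω ≠ 0 → ∃ z : cycles (normalFan Δ) q q,
            (z : Chains (normalFan Δ) q q) = summand (normalFan Δ) q q β ω ∧
            Φ ((boundaries (normalFan Δ) q q).mkQ z) = orbitClosureClass (normalFan Δ) q β) ∧
          Submodule.span (ZMod 2) {orbitClosureClass (normalFan Δ) q β} = ⊤ := by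
  obtain ⟨ε, hε, hinj⟩ := hV.exists_stalkForms hq.le
  obtain ⟨Ψ, hΨ⟩ := hV.exists_hodgeSpace_equiv hq hε
  obtain ⟨Θ, hΘ⟩ := hV.exists_invariantChow_equiv hq
  refine ⟨⟨Ψ⟩, Ψ.trans Θ.symm, fun β => ⟨fun ω hω => ?_, ?_⟩⟩
  · have hmem : summand (normalFan Δ) q q β ω ∈ cycles (normalFan Δ) q q := by
      rw [hV.cycles_eq_top hq]; trivial
    refine ⟨⟨_, hmem⟩, rfl, ?_⟩
    have h1 : ε β ω = 1 := by
      have h2 : ε β ω ≠ 0 := fun h => hω (hinj β ω h)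
      revert h2
      generalize ε β ω = a
      revert a
      decide
    rw [LinearEquiv.trans_apply, LinearEquiv.symm_apply_eq, hΘ, hΨ]
    show weightedSum ε _ (summand (normalFan Δ) q q β ω) = 1
    rw [weightedSum_summand, h1, one_smul]
  · refine eq_top_iff.2 fun x _ => Submodule.mem_span_singleton.2 ⟨Θ x, Θ.injective ?_⟩
    rw [map_smul, hΘ, smul_eq_mul, mul_one]

end Diagonal

end Z2Hodge

theorem mainTheorem1 (d e : ℕ) (he : e ≤ d) (Δ : Set (Fin d → ℝ))
    (hΔ : Z2Hodge.IsReflexive Δ)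
    (hreg : ∀ σ ∈ Z2Hodge.faceFan Δ, Z2Hodge.coneDim σ ≤ e → Z2Hodge.IsZ2Regular σ) :
    (∀ p q : ℕ, q < p → p + 1 < e →
      Subsingleton (Z2Hodge.HodgeSpace (Z2Hodge.normalFan Δ) p q)) ∧
    (∀ q : ℕ, q + 1 < e →
      Nonempty (Z2Hodge.HodgeSpace (Z2Hodge.normalFan Δ) q q ≃ₗ[ZMod 2] ZMod 2) ∧
      ∃ Φ : Z2Hodge.HodgeSpace (Z2Hodge.normalFan Δ) q q ≃ₗ[ZMod 2]
          Z2Hodge.InvariantChow (Z2Hodge.normalFan Δ) q,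
        ∀ β : Z2Hodge.ConesOfCodim (Z2Hodge.normalFan Δ) q,
          (∀ ω : Z2Hodge.ExtStalk q β.1, ω ≠ 0 →
            ∃ z : Z2Hodge.cycles (Z2Hodge.normalFan Δ) q q,
              (z : Z2Hodge.Chains (Z2Hodge.normalFan Δ) q q) =
                Z2Hodge.summand (Z2Hodge.normalFan Δ) q q β ω ∧
              Φ ((Z2Hodge.boundaries (Z2Hodge.normalFan Δ) q q).mkQ z) =
                Z2Hodge.orbitClosureClass (Z2Hodge.normalFan Δ) q β) ∧
          Submodule.span (ZMod 2)
            {Z2Hodge.orbitClosureClass (Z2Hodge.normalFan Δ) q β} = ⊤) := by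
  obtain ⟨N, v, hv⟩ := hΔ.isLatticePolytope.exists_isVertexSystem
  have hV : Z2Hodge.IsRegularUpTo Δ v e := ⟨hv, hΔ, he, hreg⟩
  exact ⟨fun p q hqp hp => hV.subsingleton_hodgeSpace hqp hp,
    fun q hq => hV.exists_hodgeSpace_equiv_invariantChow hq⟩
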